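/- **Syntactic Control of Interference (SCI).** Types are $A ::= \mathtt{nat} \mid \mathtt{comm} \mid \mathtt{var} \mid A \multimap A$. Terms (up to $\alpha$-equivalence) are $$M ::= n \mid M \odot M \mid \mathtt{skip} \mid M;M \mid M:=M \mid {!M} \mid \mathtt{while}\,M\,\mathtt{do}\,M \mid \mathtt{ifzero}\,M\,\mathtt{then}\,M\,\mathtt{else}\,M \mid x \mid \lambda x^A.M \mid MM \mid \mathtt{new}\,x\,\mathtt{in}\,M,$$ with $n\in\mathbb N$ and $\odot$ ranging over a set of total binary operations on $\mathbb N$ that contains $+$ and truncated subtraction. Typing judgements $\Gamma\vdash M:A$, where $\Gamma=x_1:A_1,\dots,x_n:A_n$ has distinct identifiers, are generated by $x:A\vdash x:A$; weakening; exchange; $\lambda$-abstraction; affine application (from $\Gamma\vdash M:A\multimap B$ and $\Delta\vdash N:A$ with disjoint identifiers infer $\Gamma,\Delta\vdash MN:B$); and rules whose premises share one context $\Gamma$: $\vdash n:\mathtt{nat}$; $M\odot N:\mathtt{nat}$ for $M,N:\mathtt{nat}$; $\vdash\mathtt{skip}:\mathtt{comm}$; $M;N:B$ for $M:\mathtt{comm}$,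 $N:B$, $B\in\{\mathtt{comm},\mathtt{nat},\mathtt{var}\}$; $M:=N:\mathtt{comm}$ for $M:\mathtt{var}$, $N:\mathtt{nat}$; ${!M}:\mathtt{nat}$ for $M:\mathtt{var}$; $\mathtt{while}\,M\,\mathtt{do}\,N:\mathtt{comm}$ for $M:\mathtt{nat}$, $N:\mathtt{comm}$; $\mathtt{ifzero}\,M\,\mathtt{then}\,N_1\,\mathtt{else}\,N_2:B$ for $M:\mathtt{nat}$, $N_i:B$, $B\in\{\mathtt{comm},\mathtt{nat},\mathtt{var}\}$; and $\Gamma\vdash\mathtt{new}\,x\,\mathtt{in}\,M:B$ for $\Gamma,x:\mathtt{var}\vdash M:B$, $B\in\{\mathtt{comm},\mathtt{nat}\}$. **Operational semantics.** $\sigma,M\Downarrow\sigma',V$ is the big-step call-by-name evaluation relation, for stores $\sigma,\sigma'$ assigning natural numbers to the $\mathtt{var}$-typed free identifiers, where values $V$ are numerals, $\mathtt{skip}$, identifiers and abstractions: operands of $\odot$ are evaluated left to right; $M:=N$ evaluates $N$, then $M$ to an identifier, and updates the store; ${!M}$ evaluates $M$ to an identifier and reads it; $M;N$ evaluates $M$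 to $\mathtt{skip}$, then $N$; $\mathtt{while}\,M\,\mathtt{do}\,N$ iterates $N$ as long as $M$ evaluates to $0$; $\mathtt{ifzero}$ takes the first branch when the test evaluates to $0$ and the second when it evaluates to some $n\neq 0$; $MN$ evaluates $M$ to $\lambda x^A.M'$ and then evaluates $M'[N/x]$; $\mathtt{new}\,x\,\mathtt{in}\,M$ evaluates $M$ with a fresh cell $x$ initialised to $0$, which is discarded afterwards. **Contextual equivalence.** For $\Gamma\vdash M:A$ and $\Gamma\vdash N:A$, write $M\cong N$ if for every $B\in\{\mathtt{comm},\mathtt{nat}\}$, every SCI context $C[-]$ (possibly capturing identifiers, with any number of occurrences of the hole) such that $\vdash C[-]:B$ is derivable by the typing rules from the assumption $\Gamma\vdash[-]:A$ for the hole, and every closed value $\vdash V:B$, one has $C[M]\Downarrow V\iff C[N]\Downarrow V$. **The model.** $\mathbf{MonRel}$ is the opposite of the Kleisli category of the powerset monad on monoids: objects are monoids, and a map $X\to Y$ is a monoid homomorphism $Y\to\mathcal P(X)$, where $ST=\{xy\mid x\in S,y\in T\}$ (equivalently a relation between $X$ and $Y$). Its tensor $\otimes$ is the product of monoids, and a map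 $X\to C^*$ into a free monoid amounts to a subset of $X\times C$. A type $A$ denotes the free monoid $(\alpha A)^*$ with $\alpha\,\mathtt{nat}=\mathbb N$, $\alpha\,\mathtt{comm}=\{*\}$, $\alpha\,\mathtt{var}=\{\mathsf{read}(n),\mathsf{write}(n)\mid n\in\mathbb N\}$, $\alpha(A\multimap B)=(\alpha A)^*\times\alpha B$. A term $x_1:A_1,\dots,x_n:A_n\vdash M:B$ denotes a map $[\![M]\!]:[\![A_1]\!]\otimes\cdots\otimes[\![A_n]\!]\to[\![B]\!]$, i.e. a set of tuples $(\vec s,b)$ with $s_i\in(\alpha A_i)^*$, $b\in\alpha B$, by induction on the typing derivation ($\vec s\,\vec t$ is componentwise concatenation): - $[\![x]\!]=\{(a,a)\}$; weakening adds the component $\varepsilon$; exchange permutes components; $[\![n]\!]=\{n\}$; $[\![\mathtt{skip}]\!]=\{*\}$; - $[\![\lambda x.M]\!]=\{(\vec s,(s,b))\mid(\vec s,s,b)\in[\![M]\!]\}$; - $[\![MN]\!]=\{(\vec s,\vec t^{\,1}\cdots\vec t^{\,k},b)\mid\exists a_1,\dots,a_k.\ (\vec s,(a_1\cdots a_k,b))\in[\![M]\!],\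 (\vec t^{\,i},a_i)\in[\![N]\!]\ \text{for all } i\}$; - $[\![M\odot N]\!]=\{(\vec s\,\vec t,m\odot n)\mid(\vec s,m)\in[\![M]\!],(\vec t,n)\in[\![N]\!]\}$; - $[\![M;N]\!]=\{(\vec s\,\vec t,b)\mid(\vec s,*)\in[\![M]\!],(\vec t,b)\in[\![N]\!]\}$; - $[\![M:=N]\!]=\{(\vec s\,\vec t,*)\mid\exists n.\ (\vec s,n)\in[\![N]\!],(\vec t,\mathsf{write}(n))\in[\![M]\!]\}$ and $[\![{!M}]\!]=\{(\vec s,n)\mid(\vec s,\mathsf{read}(n))\in[\![M]\!]\}$; - $[\![\mathtt{while}\,M\,\mathtt{do}\,N]\!]=\{(\vec s^{\,1}\vec t^{\,1}\cdots\vec s^{\,j}\vec t^{\,j}\vec s,*)\mid j\ge 0,\ (\vec s^{\,i},0)\in[\![M]\!],\ (\vec t^{\,i},*)\in[\![N]\!],\ \exists m\ne0.\,(\vec s,m)\in[\![M]\!]\}$; - $[\![\mathtt{ifzero}\,M\,\mathtt{then}\,N_1\,\mathtt{else}\,N_2]\!]$ consists of the $(\vec s\,\vec t,b)$ with either $(\vec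 s,0)\in[\![M]\!]$ and $(\vec t,b)\in[\![N_1]\!]$, or $(\vec s,m)\in[\![M]\!]$ for some $m\neq0$ and $(\vec t,b)\in[\![N_2]\!]$; - $[\![\mathtt{new}\,x\,\mathtt{in}\,M]\!]=\{(\vec s,b)\mid\exists s.\ (\vec s,s,b)\in[\![M]\!],\ s\text{ a cell-trace}\}$, where $s$ is a cell-trace if each $\mathsf{read}(n)$ in it carries the value of the most recent $\mathsf{write}$, or $0$ if there has been none. **Theorem (full abstraction).** The model of SCI in $\mathbf{MonRel}$ is fully abstract: for all SCI terms $\Gamma\vdash M:A$ and $\Gamma\vdash N:A$, with denotations computed from any typing derivations of these judgements, $$[\![\Gamma\vdash M:A]\!]=[\![\Gamma\vdash N:A]\!]\iff M\cong N .$$ -/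

import Mathlib

open CategoryTheory

/-! ## The category of monoids and relations -/

/-- An object of `MonRel`: a monoid. -/
structure MonRel : Type 1 where
  of ::
  carrier : Type
  [monoid : Monoid carrier]

namespace MonRel

open scoped Pointwise

attribute [instance] MonRel.monoid

instance : CoeSort MonRel Type := ⟨MonRel.carrier⟩

/-- `MonRel` is the opposite of the Kleisli category of the powerset monad on monoids: a map
`X ⟶ Y` is a monoid homomorphism from `Y` to the monoid of subsets of `X`, where
`S * T = {x * y | x ∈ S, y ∈ T}`. -/
@[ext]
structure Hom (X Y : MonRel) where
  toFun : Y →* Set X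

/-- Relational composition, `(f ; g)(c) = {a | ∃ b ∈ g(c), a ∈ f(b)}`. -/
def Hom.comp {X Y Z : MonRel} (f : Hom X Y) (g : Hom Y Z) : Hom X Z where
  toFun :=
    { toFun := fun c => {a | ∃ b ∈ g.toFun c, a ∈ f.toFun b}
      map_one' := by
        ext a
        simp
      map_mul' := by
        intro c c'
        ext a
        simp only [map_mul, Set.mem_mul, Set.mem_ofPred_eq]
        constructor
        · rintro ⟨_, ⟨b, hb, b', hb', rfl⟩, ha⟩
          rw [map_mul] at ha
          obtain ⟨a₁, h₁, a₂, h₂, rfl⟩ := ha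
          exact ⟨a₁, ⟨b, hb, h₁⟩, a₂, ⟨b', hb', h₂⟩, rfl⟩
        · rintro ⟨a₁, ⟨b, hb, h₁⟩, a₂, ⟨b', hb', h₂⟩, rfl⟩
          refine ⟨b * b', ⟨b, hb, b', hb', rfl⟩, ?_⟩
          rw [map_mul]
          exact Set.mul_mem_mul h₁ h₂ }

instance : Category MonRel where
  Hom := Hom
  id X := ⟨Set.singletonMonoidHom⟩
  comp f g := Hom.comp f g
  id_comp f := by
    apply Hom.ext; ext c a; simp [Hom.comp]
  comp_id f := by
    apply Hom.ext; ext c a; simp [Hom.comp]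
  assoc f g h := by
    apply Hom.ext; ext c a
    simp only [Hom.comp, MonoidHom.coe_mk, OneHom.coe_mk, Set.mem_ofPred_eq]
    constructor
    · rintro ⟨y, hy, z, hz, hx⟩; exact ⟨z, ⟨y, hy, hz⟩, hx⟩
    · rintro ⟨z, ⟨y, hy, hz⟩, hx⟩; exact ⟨y, hy, z, hz, hx⟩

/-- A monoid homomorphism `Y → X`, regarded as a map `X ⟶ Y` by means of singletons. -/
def ofHom {X Y : MonRel} (φ : Y →* X) : X ⟶ Y :=
  Hom.mk ((Set.singletonMonoidHom : X →* Set X).comp φ)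

/-- The unit object, the one-element monoid. -/
def unit : MonRel := of PUnit

/-- The tensor product `X ⊗ Y` is the product monoid. -/
def tensor (X Y : MonRel) : MonRel := of (X × Y)

/-- The tensor product of maps, `(b, d) ↦ f(b) × g(d)`. -/
def tensorMap {X Y Z W : MonRel} (f : X ⟶ Y) (g : Z ⟶ W) : tensor X Z ⟶ tensor Y W :=
  Hom.mk
    { toFun := fun p : Y × W => (f.toFun p.1 ×ˢ g.toFun p.2 : Set (X × Z))
      map_one' := by
        ext ⟨a, b⟩
        exact (by simp : (a, b) ∈ f.toFun (1 : Y × W).1 ×ˢ g.toFun (1 : Y × W).2 ↔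
          (a, b) ∈ (1 : Set (X × Z)))
      map_mul' := by
        rintro ⟨y, w⟩ ⟨y', w'⟩
        exact (by rw [map_mul, map_mul, Set.prod_mul_prod_comm] :
          (f.toFun (y * y') ×ˢ g.toFun (w * w') : Set (X × Z)) =
            (f.toFun y ×ˢ g.toFun w) * (f.toFun y' ×ˢ g.toFun w')) }

/-- The projection `X ⊗ Y ⟶ X`. -/
def fstProj (X Y : MonRel) : tensor X Y ⟶ X := ofHom (MonoidHom.inl X Y)

/-- The projection `X ⊗ Y ⟶ Y`. -/
def sndProj (X Y : MonRel) : tensor X Y ⟶ Y := ofHom (MonoidHom.inr X Y)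

/-- The free monoid over an alphabet. -/
def free (C : Type) : MonRel := of (FreeMonoid C)

/-- The map `X ⟶ C*` determined by a set of tuples, i.e. by a relation between `X` and `C`. -/
def ofTuples {X : MonRel} {C : Type} (R : C → Set X) : X ⟶ free C :=
  Hom.mk (FreeMonoid.lift R)

/-- The subset of `X × C` corresponding to a map `X ⟶ C*`, presented as `c ↦ {x | (x, c) ∈ f}`. -/
def tuples {X : MonRel} {C : Type} (f : X ⟶ free C) (c : C) : Set X :=
  f.toFun (FreeMonoid.of c)

/-- The exponential `Y ⊸ C* = (Y × C)*`. -/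
def lolli (Y : MonRel) (C : Type) : MonRel := free (Y × C)

/-- Currying. -/
def curry {X Y : MonRel} {C : Type} (f : tensor X Y ⟶ free C) : X ⟶ lolli Y C :=
  ofTuples fun p : Y × C => {x : X | ((x, p.1) : X × Y) ∈ tuples f p.2}

/-- Evaluation. -/
def ev (Y : MonRel) (C : Type) : tensor (lolli Y C) Y ⟶ free C :=
  ofTuples fun c => {p : FreeMonoid (Y × C) × Y | p.1 = FreeMonoid.of (p.2, c)}

/-- Pairing into the product of `C*` and `D*` in `MonRel`, which is `(C + D)*`. -/
def pair {X : MonRel} {C D : Type} (f : X ⟶ free C) (g : X ⟶ free D) : X ⟶ free (C ⊕ D) :=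
  ofTuples (Sum.elim (tuples f) (tuples g))

end MonRel

/-! ## Syntax of SCI -/

namespace SCI

/-- Types. -/
inductive Ty : Type
  | nat : Ty
  | comm : Ty
  | var : Ty
  | fn : Ty → Ty → Ty

/-- Arithmetic operators: addition, (truncated) subtraction, and any further ones, named by the
elements of `Ω`. -/
inductive BinOp (Ω : Type) : Type
  | add : BinOp Ω
  | sub : BinOp Ω
  | ext : Ω → BinOp Ω

/-- The function on `ℕ` computed by an operator, where `δ` interprets the further ones. -/
def BinOp.eval {Ω : Type} (δ : Ω → ℕ → ℕ → ℕ) : BinOp Ω → ℕ → ℕ → ℕ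
  | .add => fun m n => m + n
  | .sub => fun m n => m - n
  | .ext o => δ o

/-- Terms up to `α`-equivalence, with de Bruijn indices for identifiers: `lam` and `new` bind
index `0` of their body. -/
inductive Tm (Ω : Type) : Type
  | num : ℕ → Tm Ω
  | op : BinOp Ω → Tm Ω → Tm Ω → Tm Ω
  | skip : Tm Ω
  | seq : Tm Ω → Tm Ω → Tm Ω
  | assign : Tm Ω → Tm Ω → Tm Ω
  | deref : Tm Ω → Tm Ω
  | loop : Tm Ω → Tm Ω → Tm Ω
  | ifz : Tm Ω → Tm Ω → Tm Ω → Tm Ω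
  | var : ℕ → Tm Ω
  | lam : Ty → Tm Ω → Tm Ω
  | app : Tm Ω → Tm Ω → Tm Ω
  | new : Tm Ω → Tm Ω

/-- Extension of a renaming under a binder. -/
def liftRen (ρ : ℕ → ℕ) : ℕ → ℕ
  | 0 => 0
  | i + 1 => ρ i + 1

namespace Tm

variable {Ω : Type}

/-- Renaming of free identifiers. -/
def rename : (ℕ → ℕ) → Tm Ω → Tm Ω
  | _, num n => num n
  | ρ, op o M N => op o (rename ρ M) (rename ρ N)
  | _, skip => skip
  | ρ, seq M N => seq (rename ρ M) (rename ρ N)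
  | ρ, assign M N => assign (rename ρ M) (rename ρ N)
  | ρ, deref M => deref (rename ρ M)
  | ρ, loop M N => loop (rename ρ M) (rename ρ N)
  | ρ, ifz M N₁ N₂ => ifz (rename ρ M) (rename ρ N₁) (rename ρ N₂)
  | ρ, var i => var (ρ i)
  | ρ, lam A M => lam A (rename (liftRen ρ) M)
  | ρ, app M N => app (rename ρ M) (rename ρ N)
  | ρ, new M => new (rename (liftRen ρ) M)

/-- Extension of a substitution under a binder. -/
def liftSub (θ : ℕ → Tm Ω) : ℕ → Tm Ω
  | 0 => var 0
  | i + 1 => rename Nat.succ (θ i)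

/-- Simultaneous capture-avoiding substitution. -/
def subst : (ℕ → Tm Ω) → Tm Ω → Tm Ω
  | _, num n => num n
  | θ, op o M N => op o (subst θ M) (subst θ N)
  | _, skip => skip
  | θ, seq M N => seq (subst θ M) (subst θ N)
  | θ, assign M N => assign (subst θ M) (subst θ N)
  | θ, deref M => deref (subst θ M)
  | θ, loop M N => loop (subst θ M) (subst θ N)
  | θ, ifz M N₁ N₂ => ifz (subst θ M) (subst θ N₁) (subst θ N₂)
  | θ, var i => θ i
  | θ, lam A M => lam A (subst (liftSub θ) M)
  | θ, app M N => app (subst θ M) (subst θ N)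
  | θ, new M => new (subst (liftSub θ) M)

/-- `M.inst N` is `M[N/x]`, for `x` the identifier with index `0` in `M`. -/
def inst (M N : Tm Ω) : Tm Ω :=
  subst (fun i => Nat.casesOn i N var) M

/-- Values: numerals, `skip`, identifiers and abstractions. -/
def IsValue : Tm Ω → Prop
  | num _ => True
  | skip => True
  | var _ => True
  | lam _ _ => True
  | _ => False

end Tm

/-! ## The type system

A typing context is a list of types, the most recently added identifier (index `0`) first. So
`Γ, x : A` is `A :: Γ`, and `Γ, Δ` is `Δ ++ Γ`. -/

/-- Permutations of a context. -/
inductive Perm : List Ty → List Ty → Type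
  | nil : Perm [] []
  | cons (A : Ty) {Γ Γ' : List Ty} : Perm Γ Γ' → Perm (A :: Γ) (A :: Γ')
  | swap (A B : Ty) (Γ : List Ty) : Perm (A :: B :: Γ) (B :: A :: Γ)
  | trans {Γ Γ' Γ'' : List Ty} : Perm Γ Γ' → Perm Γ' Γ'' → Perm Γ Γ''

/-- The new index of each identifier after a permutation of the context. -/
def Perm.ren : {Γ Γ' : List Ty} → Perm Γ Γ' → ℕ → ℕ
  | _, _, .nil => id
  | _, _, .cons _ p => liftRen p.ren
  | _, _, .swap _ _ _ => fun i =>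
      match i with
      | 0 => 1
      | 1 => 0
      | i + 2 => i + 2
  | _, _, .trans p q => fun i => q.ren (p.ren i)

/-- `Deriv Γ M A` is the type of derivations of the typing judgement `Γ ⊢ M : A`. -/
inductive Deriv {Ω : Type} : List Ty → Tm Ω → Ty → Type
  | var (A : Ty) : Deriv [A] (.var 0) A
  | lam {Γ : List Ty} {A B : Ty} {M : Tm Ω} :
      Deriv (A :: Γ) M B → Deriv Γ (.lam A M) (.fn A B)
  | app {Γ Δ : List Ty} {A B : Ty} {M N : Tm Ω} :
      Deriv Γ M (.fn A B) → Deriv Δ N A →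
        Deriv (Δ ++ Γ) (.app (M.rename (· + Δ.length)) N) B
  | weak {Γ : List Ty} {B : Ty} {M : Tm Ω} (A : Ty) :
      Deriv Γ M B → Deriv (A :: Γ) (M.rename Nat.succ) B
  | exch {Γ Γ' : List Ty} {A : Ty} {M : Tm Ω} (p : Perm Γ Γ') :
      Deriv Γ M A → Deriv Γ' (M.rename p.ren) A
  | num (n : ℕ) : Deriv [] (.num n) .nat
  | op {Γ : List Ty} {M N : Tm Ω} (o : BinOp Ω) :
      Deriv Γ M .nat → Deriv Γ N .nat → Deriv Γ (.op o M N) .nat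
  | skip : Deriv [] .skip .comm
  | seq {Γ : List Ty} {B : Ty} {M N : Tm Ω} (hB : B = .comm ∨ B = .nat ∨ B = .var) :
      Deriv Γ M .comm → Deriv Γ N B → Deriv Γ (.seq M N) B
  | assign {Γ : List Ty} {M N : Tm Ω} :
      Deriv Γ M .var → Deriv Γ N .nat → Deriv Γ (.assign M N) .comm
  | deref {Γ : List Ty} {M : Tm Ω} :
      Deriv Γ M .var → Deriv Γ (.deref M) .nat
  | loop {Γ : List Ty} {M N : Tm Ω} :
      Deriv Γ M .nat → Deriv Γ N .comm → Deriv Γ (.loop M N) .comm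
  | ifz {Γ : List Ty} {B : Ty} {M N₁ N₂ : Tm Ω} (hB : B = .comm ∨ B = .nat ∨ B = .var) :
      Deriv Γ M .nat → Deriv Γ N₁ B → Deriv Γ N₂ B → Deriv Γ (.ifz M N₁ N₂) B
  | new {Γ : List Ty} {B : Ty} {M : Tm Ω} (hB : B = .comm ∨ B = .nat) :
      Deriv (.var :: Γ) M B → Deriv Γ (.new M) B

/-! ## Operational semantics -/

/-- `Eval δ σ M σ' V` is the judgement `σ, M ⇓ σ', V`. A store over the identifiers
`0, …, n - 1` is a list of `n` numbers. -/
inductive Eval {Ω : Type} (δ : Ω → ℕ → ℕ → ℕ) : List ℕ → Tm Ω → List ℕ → Tm Ω → Prop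
  | value {σ : List ℕ} {V : Tm Ω} : V.IsValue → Eval δ σ V σ V
  | app {σ σ' σ'' : List ℕ} {M N M' V : Tm Ω} {A : Ty} :
      Eval δ σ M σ' (.lam A M') → Eval δ σ' (M'.inst N) σ'' V → Eval δ σ (.app M N) σ'' V
  | op {σ σ' σ'' : List ℕ} {M₁ M₂ : Tm Ω} {n₁ n₂ : ℕ} {o : BinOp Ω} :
      Eval δ σ M₁ σ' (.num n₁) → Eval δ σ' M₂ σ'' (.num n₂) →
        Eval δ σ (.op o M₁ M₂) σ'' (.num (o.eval δ n₁ n₂))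
  | assign {σ σ' σ'' : List ℕ} {M N : Tm Ω} {n x : ℕ} :
      Eval δ σ N σ' (.num n) → Eval δ σ' M σ'' (.var x) → x < σ''.length →
        Eval δ σ (.assign M N) (σ''.set x n) .skip
  | deref {σ σ' : List ℕ} {M : Tm Ω} {x n : ℕ} :
      Eval δ σ M σ' (.var x) → σ'[x]? = some n → Eval δ σ (.deref M) σ' (.num n)
  | seq {σ σ' σ'' : List ℕ} {M N V : Tm Ω} :
      Eval δ σ M σ' .skip → Eval δ σ' N σ'' V → Eval δ σ (.seq M N) σ'' V
  | loop_stop {σ σ' : List ℕ} {M N : Tm Ω} {n : ℕ} :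
      Eval δ σ M σ' (.num n) → n ≠ 0 → Eval δ σ (.loop M N) σ' .skip
  | loop_step {σ σ' σ'' σ''' : List ℕ} {M N : Tm Ω} :
      Eval δ σ M σ' (.num 0) → Eval δ σ' N σ'' .skip → Eval δ σ'' (.loop M N) σ''' .skip →
        Eval δ σ (.loop M N) σ''' .skip
  | ifz_zero {σ σ' σ'' : List ℕ} {M N₁ N₂ V : Tm Ω} :
      Eval δ σ M σ' (.num 0) → Eval δ σ' N₁ σ'' V → Eval δ σ (.ifz M N₁ N₂) σ'' V
  | ifz_ne {σ σ' σ'' : List ℕ} {M N₁ N₂ V : Tm Ω} {n : ℕ} :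
      Eval δ σ M σ' (.num n) → n ≠ 0 → Eval δ σ' N₂ σ'' V → Eval δ σ (.ifz M N₁ N₂) σ'' V
  | new {σ σ' : List ℕ} {M V : Tm Ω} {n : ℕ} :
      Eval δ (0 :: σ) M (n :: σ') (V.rename Nat.succ) → Eval δ σ (.new M) σ' V

/-! ## Contextual equivalence -/

/-- `Ctx Ω Γ₀ A₀ Δ B` is the type of contexts `C[-]` with `Δ ⊢ C[-] : B`, given that the hole,
which may occur any number of times, satisfies `Γ₀ ⊢ [-] : A₀`. The binders of `C[-]` above a hole
bind identifiers in the term plugged into it. -/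
inductive Ctx (Ω : Type) (Γ₀ : List Ty) (A₀ : Ty) : List Ty → Ty → Type
  | hole : Ctx Ω Γ₀ A₀ Γ₀ A₀
  | var (A : Ty) : Ctx Ω Γ₀ A₀ [A] A
  | lam {Γ : List Ty} {A B : Ty} : Ctx Ω Γ₀ A₀ (A :: Γ) B → Ctx Ω Γ₀ A₀ Γ (.fn A B)
  | app {Γ Δ : List Ty} {A B : Ty} :
      Ctx Ω Γ₀ A₀ Γ (.fn A B) → Ctx Ω Γ₀ A₀ Δ A → Ctx Ω Γ₀ A₀ (Δ ++ Γ) B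
  | weak {Γ : List Ty} {B : Ty} (A : Ty) : Ctx Ω Γ₀ A₀ Γ B → Ctx Ω Γ₀ A₀ (A :: Γ) B
  | exch {Γ Γ' : List Ty} {A : Ty} (p : Perm Γ Γ') : Ctx Ω Γ₀ A₀ Γ A → Ctx Ω Γ₀ A₀ Γ' A
  | num (n : ℕ) : Ctx Ω Γ₀ A₀ [] .nat
  | op {Γ : List Ty} (o : BinOp Ω) :
      Ctx Ω Γ₀ A₀ Γ .nat → Ctx Ω Γ₀ A₀ Γ .nat → Ctx Ω Γ₀ A₀ Γ .nat
  | skip : Ctx Ω Γ₀ A₀ [] .comm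
  | seq {Γ : List Ty} {B : Ty} (hB : B = .comm ∨ B = .nat ∨ B = .var) :
      Ctx Ω Γ₀ A₀ Γ .comm → Ctx Ω Γ₀ A₀ Γ B → Ctx Ω Γ₀ A₀ Γ B
  | assign {Γ : List Ty} : Ctx Ω Γ₀ A₀ Γ .var → Ctx Ω Γ₀ A₀ Γ .nat → Ctx Ω Γ₀ A₀ Γ .comm
  | deref {Γ : List Ty} : Ctx Ω Γ₀ A₀ Γ .var → Ctx Ω Γ₀ A₀ Γ .nat
  | loop {Γ : List Ty} : Ctx Ω Γ₀ A₀ Γ .nat → Ctx Ω Γ₀ A₀ Γ .comm → Ctx Ω Γ₀ A₀ Γ .comm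
  | ifz {Γ : List Ty} {B : Ty} (hB : B = .comm ∨ B = .nat ∨ B = .var) :
      Ctx Ω Γ₀ A₀ Γ .nat → Ctx Ω Γ₀ A₀ Γ B → Ctx Ω Γ₀ A₀ Γ B → Ctx Ω Γ₀ A₀ Γ B
  | new {Γ : List Ty} {B : Ty} (hB : B = .comm ∨ B = .nat) :
      Ctx Ω Γ₀ A₀ (.var :: Γ) B → Ctx Ω Γ₀ A₀ Γ B

/-- `C.plug M` is the term `C[M]`. -/
def Ctx.plug {Ω : Type} {Γ₀ : List Ty} {A₀ : Ty} (M : Tm Ω) :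
    {Δ : List Ty} → {B : Ty} → Ctx Ω Γ₀ A₀ Δ B → Tm Ω
  | _, _, .hole => M
  | _, _, .var _ => .var 0
  | _, _, .lam (A := A) C => .lam A (C.plug M)
  | _, _, .app (Δ := Δ) C D => .app ((C.plug M).rename (· + Δ.length)) (D.plug M)
  | _, _, .weak _ C => (C.plug M).rename Nat.succ
  | _, _, .exch p C => (C.plug M).rename p.ren
  | _, _, .num n => .num n
  | _, _, .op o C D => .op o (C.plug M) (D.plug M)
  | _, _, .skip => .skip
  | _, _, .seq _ C D => .seq (C.plug M) (D.plug M)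
  | _, _, .assign C D => .assign (C.plug M) (D.plug M)
  | _, _, .deref C => .deref (C.plug M)
  | _, _, .loop C D => .loop (C.plug M) (D.plug M)
  | _, _, .ifz _ C D₁ D₂ => .ifz (C.plug M) (D₁.plug M) (D₂.plug M)
  | _, _, .new _ C => .new (C.plug M)

/-- `C[M]` is well-typed whenever `M` fits the hole. -/
def Ctx.plugDeriv {Ω : Type} {Γ₀ : List Ty} {A₀ : Ty} {M : Tm Ω} (d : Deriv Γ₀ M A₀) :
    {Δ : List Ty} → {B : Ty} → (C : Ctx Ω Γ₀ A₀ Δ B) → Deriv Δ (C.plug M) B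
  | _, _, .hole => d
  | _, _, .var A => .var A
  | _, _, .lam C => .lam (C.plugDeriv d)
  | _, _, .app C D => .app (C.plugDeriv d) (D.plugDeriv d)
  | _, _, .weak A C => .weak A (C.plugDeriv d)
  | _, _, .exch p C => .exch p (C.plugDeriv d)
  | _, _, .num n => .num n
  | _, _, .op o C D => .op o (C.plugDeriv d) (D.plugDeriv d)
  | _, _, .skip => .skip
  | _, _, .seq hB C D => .seq hB (C.plugDeriv d) (D.plugDeriv d)
  | _, _, .assign C D => .assign (C.plugDeriv d) (D.plugDeriv d)
  | _, _, .deref C => .deref (C.plugDeriv d)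
  | _, _, .loop C D => .loop (C.plugDeriv d) (D.plugDeriv d)
  | _, _, .ifz hB C D₁ D₂ => .ifz hB (C.plugDeriv d) (D₁.plugDeriv d) (D₂.plugDeriv d)
  | _, _, .new hB C => .new hB (C.plugDeriv d)

/-- Contextual equivalence of terms `Γ ⊢ M, N : A`. -/
def CtxEquiv {Ω : Type} (δ : Ω → ℕ → ℕ → ℕ) (Γ : List Ty) (A : Ty) (M N : Tm Ω) : Prop :=
  ∀ B : Ty, (B = .comm ∨ B = .nat) → ∀ (C : Ctx Ω Γ A [] B) (V : Tm Ω),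
    V.IsValue → Nonempty (Deriv [] V B) →
      (Eval δ [] (C.plug M) [] V ↔ Eval δ [] (C.plug N) [] V)

/-! ## The object-spaces model in `MonRel` -/

/-- Observable events at type `var`. -/
inductive VarEv : Type
  | read : ℕ → VarEv
  | write : ℕ → VarEv

/-- The alphabet of events of each type. -/
def Ev : Ty → Type
  | .nat => ℕ
  | .comm => Unit
  | .var => VarEv
  | .fn A B => FreeMonoid (Ev A) × Ev B

/-- The object interpreting a type: the free monoid over its alphabet. -/
def tyObj (A : Ty) : MonRel := MonRel.free (Ev A)

/-- The object interpreting a context: the tensor product of its types. -/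
def ctxObj : List Ty → MonRel
  | [] => MonRel.unit
  | A :: Γ => MonRel.tensor (ctxObj Γ) (tyObj A)

/-- `Trans n s n'`: a cell holding `n` can perform the events `s` and then holds `n'`. -/
inductive Trans : ℕ → List VarEv → ℕ → Prop
  | nil (n : ℕ) : Trans n [] n
  | read {n n' : ℕ} {s : List VarEv} : Trans n s n' → Trans n (.read n :: s) n'
  | write {n m n' : ℕ} {s : List VarEv} : Trans m s n' → Trans n (.write m :: s) n'

/-- Cell-traces: behaviours of a good variable initialised to zero. -/
def IsCellTrace (s : FreeMonoid VarEv) : Prop := ∃ n, Trans 0 (FreeMonoid.toList s) n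

/-- The symmetry map of a permutation of the context, as a homomorphism. -/
def Perm.hom : {Γ Γ' : List Ty} → Perm Γ Γ' → (ctxObj Γ →* ctxObj Γ')
  | _, _, .nil => MonoidHom.id _
  | _, _, .cons A p => MonoidHom.prodMap p.hom (MonoidHom.id (tyObj A))
  | _, _, .swap A B Γ =>
      let G : Type := ctxObj Γ
      let X : Type := tyObj A
      let Y : Type := tyObj B
      ((MonoidHom.prodMap (MonoidHom.fst G Y) (MonoidHom.id X)).prod
        ((MonoidHom.snd G Y).comp (MonoidHom.fst (G × Y) X)) :
          (G × Y) × X →* (G × X) × Y)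
  | _, _, .trans p q => q.hom.comp p.hom

/-- The canonical isomorphism `⟦Γ⟧ ⊗ ⟦Δ⟧ → ⟦Γ, Δ⟧` of monoids. -/
def joinHom (Γ : List Ty) : (Δ : List Ty) →
    (MonRel.tensor (ctxObj Γ) (ctxObj Δ) →* ctxObj (Δ ++ Γ))
  | [] => MonoidHom.fst (ctxObj Γ) (ctxObj [])
  | A :: Δ =>
      let G : Type := ctxObj Γ
      let D : Type := ctxObj Δ
      let X : Type := tyObj A
      (((joinHom Γ Δ).comp (MonoidHom.prodMap (MonoidHom.id G) (MonoidHom.fst D X))).prod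
        ((MonoidHom.snd D X).comp (MonoidHom.snd G (D × X))) :
          G × (D × X) →* ctxObj (Δ ++ Γ) × X)

/-- `MonRel` map for arithmetic: the tuples `(m₁ m₂, m₁ ⊙ m₂)`. -/
def opMap (f : ℕ → ℕ → ℕ) : MonRel.free (ℕ ⊕ ℕ) ⟶ tyObj .nat :=
  MonRel.ofTuples fun m : ℕ => {l : FreeMonoid (ℕ ⊕ ℕ) | ∃ m₁ m₂ : ℕ,
    m = f m₁ m₂ ∧ l = FreeMonoid.of (.inl m₁) * FreeMonoid.of (.inr m₂)}

/-- `MonRel` map for sequencing: the tuples `(* b, b)`. -/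
def seqMap (B : Ty) : MonRel.free (Unit ⊕ Ev B) ⟶ tyObj B :=
  MonRel.ofTuples fun b : Ev B => {l : FreeMonoid (Unit ⊕ Ev B) |
    l = FreeMonoid.of (.inl ()) * FreeMonoid.of (.inr b)}

/-- `MonRel` map for assignment: the tuples `(n write(n), *)`. -/
def assignMap : MonRel.free (ℕ ⊕ VarEv) ⟶ tyObj .comm :=
  MonRel.ofTuples fun _ : Unit => {l : FreeMonoid (ℕ ⊕ VarEv) | ∃ n : ℕ,
    l = FreeMonoid.of (.inl n) * FreeMonoid.of (.inr (.write n))}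

/-- `MonRel` map for dereferencing: the tuples `(read(n), n)`. -/
def derefMap : tyObj .var ⟶ tyObj .nat :=
  MonRel.ofTuples fun n : ℕ => {l : FreeMonoid VarEv | l = FreeMonoid.of (.read n)}

/-- `MonRel` map for loops: the tuples `(0 * 0 * ⋯ 0 * n, *)` with `n ≠ 0`. -/
def loopMap : MonRel.free (ℕ ⊕ Unit) ⟶ tyObj .comm :=
  MonRel.ofTuples fun _ : Unit => {l : FreeMonoid (ℕ ⊕ Unit) | ∃ k n : ℕ, n ≠ 0 ∧
    l = (FreeMonoid.of (.inl 0) * FreeMonoid.of (.inr ())) ^ k * FreeMonoid.of (.inl n)}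

/-- `MonRel` map for conditionals: the tuples `(0 b, b)` with `b` from the first branch and
`(n b, b)` with `n ≠ 0` and `b` from the second. -/
def ifzMap (B : Ty) : MonRel.free (ℕ ⊕ (Ev B ⊕ Ev B)) ⟶ tyObj B :=
  MonRel.ofTuples fun b : Ev B => {l : FreeMonoid (ℕ ⊕ (Ev B ⊕ Ev B)) |
    l = FreeMonoid.of (.inl 0) * FreeMonoid.of (.inr (.inl b)) ∨
      ∃ n : ℕ, n ≠ 0 ∧ l = FreeMonoid.of (.inl n) * FreeMonoid.of (.inr (.inr b))}

/-- `MonRel` map for local variables: the tuples `((s, b), b)` with `s` a cell-trace. -/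
def newMap (B : Ty) : tyObj (.fn .var B) ⟶ tyObj B :=
  MonRel.ofTuples fun b : Ev B => {l : FreeMonoid (FreeMonoid VarEv × Ev B) |
    ∃ s : FreeMonoid VarEv, IsCellTrace s ∧ l = FreeMonoid.of (s, b)}

/-- The denotation `⟦Γ ⊢ M : A⟧ : ⟦Γ⟧ ⟶ ⟦A⟧` in `MonRel`, by induction on the typing
derivation. -/
def den {Ω : Type} (δ : Ω → ℕ → ℕ → ℕ) :
    {Γ : List Ty} → {M : Tm Ω} → {A : Ty} → Deriv Γ M A → (ctxObj Γ ⟶ tyObj A)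
  | _, _, _, .var A => MonRel.sndProj MonRel.unit (tyObj A)
  | _, _, _, .lam d => MonRel.curry (den δ d)
  | _, _, _, .app (Γ := Γ) (Δ := Δ) (A := A) (B := B) d e =>
      MonRel.ofHom (joinHom Γ Δ) ≫ MonRel.tensorMap (den δ d) (den δ e) ≫
        MonRel.ev (tyObj A) (Ev B)
  | _, _, _, .weak (Γ := Γ) A d => MonRel.fstProj (ctxObj Γ) (tyObj A) ≫ den δ d
  | _, _, _, .exch p d => MonRel.ofHom p.hom ≫ den δ d
  | _, _, _, .num n => MonRel.ofTuples fun m : ℕ => {_u | m = n}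
  | _, _, _, .op o d e => MonRel.pair (den δ d) (den δ e) ≫ opMap (o.eval δ)
  | _, _, _, .skip => MonRel.ofTuples fun _ : Unit => Set.univ
  | _, _, _, .seq (B := B) _ d e => MonRel.pair (den δ d) (den δ e) ≫ seqMap B
  | _, _, _, .assign d e => MonRel.pair (den δ e) (den δ d) ≫ assignMap
  | _, _, _, .deref d => den δ d ≫ derefMap
  | _, _, _, .loop d e => MonRel.pair (den δ d) (den δ e) ≫ loopMap
  | _, _, _, .ifz (B := B) _ d e₁ e₂ =>
      MonRel.pair (den δ d) (MonRel.pair (den δ e₁) (den δ e₂)) ≫ ifzMap B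
  | _, _, _, .new (B := B) _ d => MonRel.curry (den δ d) ≫ newMap B

end SCI

/-!
Equality of denotations is compared with contextual equivalence in two steps.

*Adequacy.* A Kripke logical relation (`LogRel`) links terms in a store with their behaviours, which
are sets of families of cell traces. It keeps record of the set of cells that a term may use. An
affine application puts together a function and an argument that use disjoint sets of cells, so
that their traces commute, and this is what makes the componentwise concatenation in the model agree
with the order in which the store is actually accessed. The fundamental lemma `adequate` shows that
a closed term of ground type evaluates exactly as its denotation says (`obs_closed_iff`). Since
denotations are compositional, terms with equal denotations are contextually equivalent
(`ctxEquiv_of_den_eq`), and contextual equivalence becomes a statement about the denotations of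
closed programs (`ctxEquiv_iff`).

*Observation.* Conversely, contextual equivalence has to determine every event of the denotation,
and one may abstract all identifiers and consider closed terms. By induction on the type, every
event `b` has an observer, a closed term that terminates if its argument performs `b`, and every
sequence of events has a producer, a term with two local cells that performs these events one after
the other (`accepts_and_exists_isProducer`). One cell counts the events already performed. The
other holds data that reveal afterwards what has been done: a `write n` is prepared by storing
`n + 1` and confirmed by finding `n`. The observer of an event of a function type applies the
function to a producer for the argument. The producer of such events observes its own argument
first.

Observation cannot be exact. A cell prepared for `read n` contains `n` and may just as well be
overwritten with `n`. So an observer of `b` accepts all events above `b` in a certain order, `EvLe`,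
which on arguments of functions allows such a replacement. Exactness is recovered from determinacy.
Denotations are cliques for a coherence relation on events (`clique`), and distinct comparable
events are incoherent, whence no closed term has two distinct comparable events
(`eq_of_evLe_of_mem_sem`). If `M` and `N` are contextually equivalent and `b` is an event of `M`,
then observing `b` yields an event `b'` of `N` above `b`, and observing `b'` yields an event `b''`
of `M` above `b'`. Both `b` and `b''` are events of `M`, so `b = b''` by determinacy, and `b = b'`
by antisymmetry (`den_eq_of_ctxEquiv`).
-/

open scoped Pointwise

/-! ### Tuples of maps into free monoids -/

namespace MonRel

variable {X : MonRel} {C D : Type}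

theorem tuples_ofTuples (R : C → Set X) (c : C) : tuples (ofTuples R) c = R c :=
  FreeMonoid.lift_eval_of R c

theorem mem_tuples_comp_ofTuples {Y : MonRel} (f : X ⟶ Y) (R : C → Set Y) (c : C) (x : X) :
    x ∈ tuples (f ≫ ofTuples R) c ↔ ∃ y ∈ R c, x ∈ f.toFun y := by
  have h : x ∈ tuples (f ≫ ofTuples R) c ↔
      ∃ y ∈ FreeMonoid.lift R (FreeMonoid.of c), x ∈ f.toFun y := Iff.rfl
  rw [h, FreeMonoid.lift_eval_of]

theorem pair_toFun_inl (f : X ⟶ free C) (g : X ⟶ free D) (c : C) :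
    (pair f g).toFun (FreeMonoid.of (Sum.inl c)) = tuples f c :=
  FreeMonoid.lift_eval_of _ _

theorem pair_toFun_inr (f : X ⟶ free C) (g : X ⟶ free D) (d : D) :
    (pair f g).toFun (FreeMonoid.of (Sum.inr d)) = tuples g d :=
  FreeMonoid.lift_eval_of _ _

theorem mem_pair_inl_mul_inr (f : X ⟶ free C) (g : X ⟶ free D) (c : C) (d : D) (x : X) :
    x ∈ (pair f g).toFun (FreeMonoid.of (Sum.inl c) * FreeMonoid.of (Sum.inr d)) ↔
      ∃ y z : X, y ∈ tuples f c ∧ z ∈ tuples g d ∧ x = y * z := by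
  let F : FreeMonoid (C ⊕ D) →* Set X := (pair f g).toFun
  have h₁ : F (FreeMonoid.of (Sum.inl c)) = tuples f c := pair_toFun_inl f g c
  have h₂ : F (FreeMonoid.of (Sum.inr d)) = tuples g d := pair_toFun_inr f g d
  change x ∈ F (FreeMonoid.of (Sum.inl c) * FreeMonoid.of (Sum.inr d)) ↔ _
  rw [map_mul, h₁, h₂]
  exact ⟨fun ⟨y, hy, z, hz, h⟩ => ⟨y, z, hy, hz, h.symm⟩,
    fun ⟨y, z, hy, hz, h⟩ => ⟨y, hy, z, hz, h.symm⟩⟩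

theorem mem_pair_pow_mul_inl (f : X ⟶ free C) (g : X ⟶ free D) (c c' : C) (d : D) (k : ℕ)
    (x : X) :
    x ∈ (pair f g).toFun ((FreeMonoid.of (Sum.inl c) * FreeMonoid.of (Sum.inr d)) ^ k *
        FreeMonoid.of (Sum.inl c')) ↔
      ∃ y z : X, y ∈ (tuples f c * tuples g d) ^ k ∧ z ∈ tuples f c' ∧ x = y * z := by
  let F : FreeMonoid (C ⊕ D) →* Set X := (pair f g).toFun
  have h₁ (c) : F (FreeMonoid.of (Sum.inl c)) = tuples f c := pair_toFun_inl f g c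
  have h₂ : F (FreeMonoid.of (Sum.inr d)) = tuples g d := pair_toFun_inr f g d
  change x ∈ F ((FreeMonoid.of (Sum.inl c) * FreeMonoid.of (Sum.inr d)) ^ k *
    FreeMonoid.of (Sum.inl c')) ↔ _
  rw [map_mul, map_pow, map_mul, h₁, h₁, h₂]
  exact ⟨fun ⟨y, hy, z, hz, h⟩ => ⟨y, z, hy, hz, h.symm⟩,
    fun ⟨y, z, hy, hz, h⟩ => ⟨y, hy, z, hz, h.symm⟩⟩

/-- A map into a free monoid is determined by its set of tuples. -/
theorem hom_ext_tuples {f g : X ⟶ free C} (h : ∀ c, tuples f c = tuples g c) : f = g := by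
  apply Hom.ext
  exact FreeMonoid.hom_eq h

end MonRel

namespace SCI

/-! ### Membership in denotations -/

section

variable {Ω : Type} (δ : Ω → ℕ → ℕ → ℕ)

/-- The set of those `g` with `(g, b)` in the denotation of a derivation. -/
def sem {Γ : List Ty} {M : Tm Ω} {A : Ty} (d : Deriv Γ M A) (b : Ev A) : Set (ctxObj Γ) :=
  MonRel.tuples (den δ d) b

/-- The denotation of a derivation as a homomorphism: to a sequence `b₁ ⋯ bₖ` of events it assigns
the products `g₁ ⋯ gₖ` with `gᵢ ∈ sem δ d bᵢ`. -/
def semStar {Γ : List Ty} {M : Tm Ω} {A : Ty} (d : Deriv Γ M A) :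
    FreeMonoid (Ev A) →* Set (ctxObj Γ) :=
  (den δ d).toFun

variable {Γ Δ : List Ty} {A B : Ty} {M N N₁ N₂ : Tm Ω}

theorem semStar_of (d : Deriv Γ M A) (b : Ev A) : semStar δ d (FreeMonoid.of b) = sem δ d b := rfl

variable {δ}

theorem den_eq_iff {d : Deriv Γ M A} {e : Deriv Γ N A} :
    den δ d = den δ e ↔ ∀ b, sem δ d b = sem δ e b :=
  ⟨fun h b => by simp only [sem, h], fun h => MonRel.hom_ext_tuples h⟩

theorem mem_sem_var {a : Ev A} {g : ctxObj [A]} :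
    g ∈ sem δ (.var A : Deriv [A] (.var 0 : Tm Ω) A) a ↔ g = (1, FreeMonoid.of a) := Iff.rfl

theorem mem_sem_lam {d : Deriv (A :: Γ) M B} {g : ctxObj Γ} {l : FreeMonoid (Ev A)} {b : Ev B} :
    g ∈ sem δ (.lam d) (l, b) ↔ (g, l) ∈ sem δ d b := by
  have h : sem δ (.lam d) (l, b) = {x : ctxObj Γ | (x, l) ∈ sem δ d b} :=
    MonRel.tuples_ofTuples _ _
  rw [h]
  rfl

theorem mem_sem_app {d : Deriv Γ M (.fn A B)} {e : Deriv Δ N A} {g : ctxObj (Δ ++ Γ)} {b : Ev B} :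
    g ∈ sem δ (.app d e) b ↔ ∃ (l : FreeMonoid (Ev A)) (x : ctxObj Γ) (y : ctxObj Δ),
      x ∈ sem δ d (l, b) ∧ y ∈ semStar δ e l ∧ g = joinHom Γ Δ (x, y) := by
  constructor
  · rintro ⟨⟨x, y⟩, ⟨⟨w, l⟩, hw, hx, hy⟩, rfl⟩
    have hw' : ((w, l) : FreeMonoid (FreeMonoid (Ev A) × Ev B) × FreeMonoid (Ev A)) ∈
        FreeMonoid.lift (fun c : Ev B => ({p : FreeMonoid (FreeMonoid (Ev A) × Ev B) ×
          FreeMonoid (Ev A) | p.1 = FreeMonoid.of (p.2, c)} : Set _)) (FreeMonoid.of b) := hw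
    rw [FreeMonoid.lift_eval_of] at hw'
    obtain rfl : w = FreeMonoid.of (l, b) := hw'
    exact ⟨l, x, y, hx, hy, rfl⟩
  · rintro ⟨l, x, y, hx, hy, rfl⟩
    refine ⟨(x, y), ⟨(FreeMonoid.of (l, b), l), ?_, hx, hy⟩, rfl⟩
    change _ ∈ FreeMonoid.lift (fun c : Ev B => ({p : FreeMonoid (FreeMonoid (Ev A) × Ev B) ×
          FreeMonoid (Ev A) | p.1 = FreeMonoid.of (p.2, c)} : Set _)) (FreeMonoid.of b)
    rw [FreeMonoid.lift_eval_of]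
    rfl

theorem mem_sem_weak {d : Deriv Γ M B} {g : ctxObj (A :: Γ)} {b : Ev B} :
    g ∈ sem δ (.weak A d) b ↔ ∃ x ∈ sem δ d b, g = (x, 1) := Iff.rfl

theorem mem_sem_exch {Γ' : List Ty} {p : Perm Γ Γ'} {d : Deriv Γ M A} {g : ctxObj Γ'} {b : Ev A} :
    g ∈ sem δ (.exch p d) b ↔ ∃ x ∈ sem δ d b, g = p.hom x := Iff.rfl

theorem mem_sem_num {n m : ℕ} {g : ctxObj []} :
    g ∈ sem δ (.num n : Deriv [] (.num n : Tm Ω) .nat) m ↔ m = n := by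
  have h : sem δ (.num n : Deriv [] (.num n : Tm Ω) .nat) m = {_u | m = n} :=
    MonRel.tuples_ofTuples _ _
  rw [h]
  rfl

theorem mem_sem_skip {g : ctxObj []} {b : Ev .comm} :
    g ∈ sem δ (.skip : Deriv [] (.skip : Tm Ω) .comm) b := by
  have h : sem δ (.skip : Deriv [] (.skip : Tm Ω) .comm) b = Set.univ :=
    MonRel.tuples_ofTuples _ _
  rw [h]
  trivial

theorem mem_sem_op {o : BinOp Ω} {d : Deriv Γ M .nat} {e : Deriv Γ N .nat} {g : ctxObj Γ} {k : ℕ} :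
    g ∈ sem δ (.op o d e) k ↔ ∃ (m n : ℕ) (x y : ctxObj Γ), x ∈ sem δ d m ∧ y ∈ sem δ e n ∧
      g = x * y ∧ k = o.eval δ m n := by
  refine (MonRel.mem_tuples_comp_ofTuples _ _ _ _).trans ?_
  constructor
  · rintro ⟨_, ⟨m, n, rfl, rfl⟩, hg⟩
    obtain ⟨x, y, hx, hy, rfl⟩ := (MonRel.mem_pair_inl_mul_inr _ _ _ _ _).1 hg
    exact ⟨m, n, x, y, hx, hy, rfl, rfl⟩
  · rintro ⟨m, n, x, y, hx, hy, rfl, rfl⟩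
    exact ⟨_, ⟨m, n, rfl, rfl⟩, (MonRel.mem_pair_inl_mul_inr _ _ _ _ _).2 ⟨x, y, hx, hy, rfl⟩⟩

theorem mem_sem_seq {hB : B = .comm ∨ B = .nat ∨ B = .var} {d : Deriv Γ M .comm}
    {e : Deriv Γ N B} {g : ctxObj Γ} {b : Ev B} :
    g ∈ sem δ (.seq hB d e) b ↔ ∃ x y : ctxObj Γ, x ∈ sem δ d () ∧ y ∈ sem δ e b ∧ g = x * y := by
  refine (MonRel.mem_tuples_comp_ofTuples _ _ _ _).trans ?_
  constructor
  · rintro ⟨_, rfl, hg⟩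
    exact (MonRel.mem_pair_inl_mul_inr _ _ _ _ _).1 hg
  · intro h
    exact ⟨_, rfl, (MonRel.mem_pair_inl_mul_inr _ _ _ _ _).2 h⟩

theorem mem_sem_assign {d : Deriv Γ M .var} {e : Deriv Γ N .nat} {g : ctxObj Γ} {b : Ev .comm} :
    g ∈ sem δ (.assign d e) b ↔ ∃ (n : ℕ) (x y : ctxObj Γ), x ∈ sem δ e n ∧
      y ∈ sem δ d (VarEv.write n) ∧ g = x * y := by
  refine (MonRel.mem_tuples_comp_ofTuples _ _ _ _).trans ?_
  constructor
  · rintro ⟨_, ⟨n, rfl⟩, hg⟩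
    exact ⟨n, (MonRel.mem_pair_inl_mul_inr _ _ _ _ _).1 hg⟩
  · rintro ⟨n, h⟩
    exact ⟨_, ⟨n, rfl⟩, (MonRel.mem_pair_inl_mul_inr _ _ _ _ _).2 h⟩

theorem mem_sem_deref {d : Deriv Γ M .var} {g : ctxObj Γ} {n : ℕ} :
    g ∈ sem δ (.deref d) n ↔ g ∈ sem δ d (VarEv.read n) := by
  refine (MonRel.mem_tuples_comp_ofTuples _ _ _ _).trans ?_
  constructor
  · rintro ⟨_, rfl, hg⟩
    exact hg
  · intro hg
    exact ⟨_, rfl, hg⟩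

theorem mem_sem_loop {d : Deriv Γ M .nat} {e : Deriv Γ N .comm} {g : ctxObj Γ} {b : Ev .comm} :
    g ∈ sem δ (.loop d e) b ↔ ∃ (k n : ℕ) (x y : ctxObj Γ), n ≠ 0 ∧
      x ∈ (sem δ d (0 : ℕ) * sem δ e ()) ^ k ∧ y ∈ sem δ d n ∧ g = x * y := by
  refine (MonRel.mem_tuples_comp_ofTuples _ _ _ _).trans ?_
  constructor
  · rintro ⟨_, ⟨k, n, hn, rfl⟩, hg⟩
    obtain ⟨x, y, hx, hy, rfl⟩ := (MonRel.mem_pair_pow_mul_inl _ _ _ _ _ _ _).1 hg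
    exact ⟨k, n, x, y, hn, hx, hy, rfl⟩
  · rintro ⟨k, n, x, y, hn, hx, hy, rfl⟩
    exact ⟨_, ⟨k, n, hn, rfl⟩,
      (MonRel.mem_pair_pow_mul_inl _ _ _ _ _ _ _).2 ⟨x, y, hx, hy, rfl⟩⟩

theorem mem_sem_ifz {hB : B = .comm ∨ B = .nat ∨ B = .var} {d : Deriv Γ M .nat}
    {e₁ : Deriv Γ N₁ B} {e₂ : Deriv Γ N₂ B} {g : ctxObj Γ} {b : Ev B} :
    g ∈ sem δ (.ifz hB d e₁ e₂) b ↔ ∃ (n : ℕ) (x y : ctxObj Γ), x ∈ sem δ d n ∧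
      (n = 0 ∧ y ∈ sem δ e₁ b ∨ n ≠ 0 ∧ y ∈ sem δ e₂ b) ∧ g = x * y := by
  have h₁ := MonRel.pair_toFun_inl (den δ e₁) (den δ e₂) b
  have h₂ := MonRel.pair_toFun_inr (den δ e₁) (den δ e₂) b
  refine (MonRel.mem_tuples_comp_ofTuples _ _ _ _).trans ?_
  constructor
  · rintro ⟨_, rfl | ⟨n, hn, rfl⟩, hg⟩
    · obtain ⟨x, y, hx, hy, rfl⟩ := (MonRel.mem_pair_inl_mul_inr _ _ _ _ _).1 hg
      exact ⟨0, x, y, hx, .inl ⟨rfl, h₁.subset hy⟩, rfl⟩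
    · obtain ⟨x, y, hx, hy, rfl⟩ := (MonRel.mem_pair_inl_mul_inr _ _ _ _ _).1 hg
      exact ⟨n, x, y, hx, .inr ⟨hn, h₂.subset hy⟩, rfl⟩
  · rintro ⟨n, x, y, hx, ⟨rfl, hy⟩ | ⟨hn, hy⟩, rfl⟩
    · exact ⟨_, .inl rfl,
        (MonRel.mem_pair_inl_mul_inr _ _ _ _ _).2 ⟨x, y, hx, h₁.symm.subset hy, rfl⟩⟩
    · exact ⟨_, .inr ⟨n, hn, rfl⟩,
        (MonRel.mem_pair_inl_mul_inr _ _ _ _ _).2 ⟨x, y, hx, h₂.symm.subset hy, rfl⟩⟩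

theorem mem_sem_new {hB : B = .comm ∨ B = .nat} {d : Deriv (.var :: Γ) M B} {g : ctxObj Γ}
    {b : Ev B} :
    g ∈ sem δ (.new hB d) b ↔ ∃ s : FreeMonoid VarEv, IsCellTrace s ∧ (g, s) ∈ sem δ d b := by
  refine (MonRel.mem_tuples_comp_ofTuples _ _ _ _).trans ?_
  constructor
  · rintro ⟨_, ⟨s, hs, rfl⟩, hg⟩
    exact ⟨s, hs, mem_sem_lam.1 hg⟩
  · rintro ⟨s, hs, hg⟩
    exact ⟨_, ⟨s, hs, rfl⟩, mem_sem_lam.2 hg⟩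

end

/-! ### Renaming and substitution -/

section

namespace Tm

variable {Ω : Type}

/-- The substitution sending index `0` to `N` and index `i + 1` to `θ i`. -/
def consSub (N : Tm Ω) (θ : ℕ → Tm Ω) : ℕ → Tm Ω
  | 0 => N
  | i + 1 => θ i

theorem liftRen_comp (ρ ρ' : ℕ → ℕ) : liftRen ρ' ∘ liftRen ρ = liftRen (ρ' ∘ ρ) := by
  funext i; cases i <;> rfl

theorem rename_rename (M : Tm Ω) : ∀ ρ ρ' : ℕ → ℕ,
    (M.rename ρ).rename ρ' = M.rename (ρ' ∘ ρ) := by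
  induction M <;> intro ρ ρ' <;> simp_all [rename, liftRen_comp]

theorem liftRen_id : liftRen id = id := by
  funext i; cases i <;> rfl

theorem rename_id (M : Tm Ω) : M.rename id = M := by
  induction M <;> simp_all [rename, liftRen_id]

theorem liftSub_comp_liftRen (θ : ℕ → Tm Ω) (ρ : ℕ → ℕ) :
    liftSub θ ∘ liftRen ρ = liftSub (θ ∘ ρ) := by
  funext i; cases i <;> rfl

theorem subst_rename (M : Tm Ω) : ∀ (ρ : ℕ → ℕ) (θ : ℕ → Tm Ω),
    (M.rename ρ).subst θ = M.subst (θ ∘ ρ) := by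
  induction M <;> intro ρ θ <;> simp_all [rename, subst, liftSub_comp_liftRen]

theorem liftSub_rename (θ : ℕ → Tm Ω) (ρ : ℕ → ℕ) :
    (fun i => (liftSub θ i).rename (liftRen ρ)) = liftSub (fun i => (θ i).rename ρ) := by
  funext i
  cases i with
  | zero => rfl
  | succ i =>
    simp only [liftSub, rename_rename]
    rfl

theorem rename_subst (M : Tm Ω) : ∀ (θ : ℕ → Tm Ω) (ρ : ℕ → ℕ),
    (M.subst θ).rename ρ = M.subst (fun i => (θ i).rename ρ) := by
  induction M <;> intro θ ρ <;> simp_all [rename, subst, liftSub_rename]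

theorem liftSub_var : liftSub (var : ℕ → Tm Ω) = var := by
  funext i; cases i <;> rfl

theorem subst_var (M : Tm Ω) : M.subst var = M := by
  induction M <;> simp_all [subst, liftSub_var]

theorem liftSub_subst (θ η : ℕ → Tm Ω) :
    (fun i => (liftSub θ i).subst (liftSub η)) = liftSub (fun i => (θ i).subst η) := by
  funext i
  cases i with
  | zero => rfl
  | succ i =>
    simp only [liftSub, subst_rename, rename_subst]
    rfl

theorem subst_subst (M : Tm Ω) : ∀ θ η : ℕ → Tm Ω,
    (M.subst θ).subst η = M.subst (fun i => (θ i).subst η) := by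
  induction M <;> intro θ η <;> simp_all [subst, liftSub_subst]

theorem inst_liftSub (M N : Tm Ω) (θ : ℕ → Tm Ω) :
    (M.subst (liftSub θ)).inst N = M.subst (consSub N θ) := by
  rw [inst, subst_subst]
  congr 1
  funext i
  cases i with
  | zero => rfl
  | succ i =>
    simp only [liftSub, subst_rename]
    exact subst_var _

end Tm

/-! ### Traces of cells -/

theorem trans_nil_iff {n n' : ℕ} : Trans n [] n' ↔ n' = n := by
  constructor
  · rintro ⟨⟩; rfl
  · rintro rfl; exact .nil _

theorem trans_read_cons_iff {n k n' : ℕ} {s : List VarEv} :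
    Trans n (.read k :: s) n' ↔ k = n ∧ Trans n s n' := by
  constructor
  · rintro (_ | h | _); exact ⟨rfl, h⟩
  · rintro ⟨rfl, h⟩; exact .read h

theorem trans_write_cons_iff {n k n' : ℕ} {s : List VarEv} :
    Trans n (.write k :: s) n' ↔ Trans k s n' := by
  constructor
  · rintro (_ | _ | h); exact h
  · intro h; exact .write h

theorem trans_append_iff {s s' : List VarEv} : ∀ {n n'' : ℕ},
    Trans n (s ++ s') n'' ↔ ∃ n', Trans n s n' ∧ Trans n' s' n'' := by
  induction s with
  | nil => intro n n''; simp [trans_nil_iff]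
  | cons a s ih =>
    intro n n''
    cases a <;> simp [trans_read_cons_iff, trans_write_cons_iff, ih, and_assoc]

/-- A family of traces, one for each cell. Cells are numbered from the bottom of the store, so
that a cell keeps its number when further cells are allocated. -/
abbrev Traces : Type := ℕ → FreeMonoid VarEv

/-- `Run σ t σ'`: the store `σ` can perform the traces `t` and then is `σ'`. -/
def Run : List ℕ → Traces → List ℕ → Prop
  | [], _, [] => True
  | v :: σ, t, v' :: σ' => Trans v (FreeMonoid.toList (t σ.length)) v' ∧ Run σ t σ'
  | _, _, _ => False

theorem Run.length_eq : ∀ {σ σ' : List ℕ} {t : Traces}, Run σ t σ' → σ'.length = σ.length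
  | [], [], _, _ => rfl
  | _ :: _, _ :: _, _, h => congrArg (· + 1) h.2.length_eq

theorem run_one_iff : ∀ {σ σ' : List ℕ}, Run σ 1 σ' ↔ σ' = σ
  | [], [] => by simp [Run]
  | [], _ :: _ => by simp [Run]
  | _ :: _, [] => by simp [Run]
  | v :: σ, v' :: σ' => by simp [Run, run_one_iff, trans_nil_iff]

theorem run_mul_iff {t t' : Traces} : ∀ {σ σ'' : List ℕ},
    Run σ (t * t') σ'' ↔ ∃ σ', Run σ t σ' ∧ Run σ' t' σ''
  | [], [] => by
    constructor
    · intro _; exact ⟨[], trivial, trivial⟩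
    · intro _; trivial
  | [], _ :: _ => by
    constructor
    · intro h; exact h.elim
    · rintro ⟨_ | ⟨_, _⟩, h, h'⟩
      · exact h'
      · exact h
  | _ :: _, [] => by
    constructor
    · intro h; exact h.elim
    · rintro ⟨_ | ⟨_, _⟩, h, h'⟩
      · exact h
      · exact h'
  | v :: σ, v'' :: σ'' => by
    simp only [Run, Pi.mul_apply, FreeMonoid.toList_mul, trans_append_iff, run_mul_iff]
    constructor
    · rintro ⟨⟨v', h₁, h₂⟩, σ', h₃, h₄⟩
      exact ⟨v' :: σ', ⟨h₁, h₃⟩, by rwa [h₃.length_eq], h₄⟩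
    · rintro ⟨_ | ⟨v', σ'⟩, h, h'⟩
      · exact h.elim
      · refine ⟨⟨v', h.1, ?_⟩, σ', h.2, h'.2⟩
        rw [← h.2.length_eq]
        exact h'.1

theorem run_congr {t t' : Traces} : ∀ {σ σ' : List ℕ}, (∀ i < σ.length, t i = t' i) →
    (Run σ t σ' ↔ Run σ t' σ')
  | [], [], _ => Iff.rfl
  | [], _ :: _, _ => Iff.rfl
  | _ :: _, [], _ => Iff.rfl
  | v :: σ, v' :: σ', h => by
    simp only [Run]
    rw [h σ.length (by simp), run_congr (fun i hi => h i (by simp; omega))]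

theorem run_mulSingle_read_iff {i k : ℕ} : ∀ {σ σ' : List ℕ}, i < σ.length →
    (Run σ (Pi.mulSingle i (FreeMonoid.of (VarEv.read k))) σ' ↔
      σ[σ.length - 1 - i]? = some k ∧ σ' = σ)
  | v :: σ, [], _ => by simp [Run]
  | v :: σ, v' :: σ', h => by
    simp only [Run]
    by_cases hi : i = σ.length
    · subst hi
      rw [run_congr (t' := 1) (fun j hj => by simp [hj.ne])]
      simp only [Pi.mulSingle_eq_same, FreeMonoid.toList_of, trans_read_cons_iff, trans_nil_iff,
        run_one_iff]
      simp [eq_comm, and_assoc]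
    · have hi' : i < σ.length := by simp at h; omega
      rw [run_mulSingle_read_iff hi', Pi.mulSingle_eq_of_ne (Ne.symm hi)]
      have : (v :: σ).length - 1 - i = (σ.length - 1 - i) + 1 := by simp; omega
      rw [this, List.getElem?_cons_succ]
      simp only [FreeMonoid.toList_one, trans_nil_iff, List.cons.injEq]
      tauto

theorem run_mulSingle_write_iff {i k : ℕ} : ∀ {σ σ' : List ℕ}, i < σ.length →
    (Run σ (Pi.mulSingle i (FreeMonoid.of (VarEv.write k))) σ' ↔
      σ' = σ.set (σ.length - 1 - i) k)
  | v :: σ, [], h => by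
    have : [] ≠ (v :: σ).set ((v :: σ).length - 1 - i) k := by
      intro h
      simpa using congrArg List.length h
    simp only [Run, this]
  | v :: σ, v' :: σ', h => by
    simp only [Run]
    by_cases hi : i = σ.length
    · subst hi
      rw [run_congr (t' := 1) (fun j hj => by simp [hj.ne])]
      simp only [Pi.mulSingle_eq_same, FreeMonoid.toList_of, trans_write_cons_iff, trans_nil_iff,
        run_one_iff]
      simp
    · have hi' : i < σ.length := by simp at h; omega
      rw [run_mulSingle_write_iff hi', Pi.mulSingle_eq_of_ne (Ne.symm hi)]
      have : (v :: σ).length - 1 - i = (σ.length - 1 - i) + 1 := by simp; omega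
      rw [this, List.set_cons_succ]
      simp only [FreeMonoid.toList_one, trans_nil_iff, List.cons.injEq]

/-- The traces `t` involve only cells in `U`. -/
def SupportedOn (U : Set ℕ) (P : Set Traces) : Prop := ∀ t ∈ P, ∀ i ∉ U, t i = 1

theorem SupportedOn.mono {U V : Set ℕ} {P : Set Traces} (h : SupportedOn U P) (hUV : U ⊆ V) :
    SupportedOn V P := fun t ht i hi => h t ht i (fun hi' => hi (hUV hi'))

theorem SupportedOn.one {U : Set ℕ} : SupportedOn U 1 := by
  rintro t rfl i _
  rfl

theorem SupportedOn.mul {U : Set ℕ} {P Q : Set Traces} (hP : SupportedOn U P)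
    (hQ : SupportedOn U Q) : SupportedOn U (P * Q) := by
  rintro _ ⟨t, ht, t', ht', rfl⟩ i hi
  simp [hP t ht i hi, hQ t' ht' i hi]

theorem SupportedOn.lift {U : Set ℕ} {C : Type} {S : C → Set Traces}
    (h : ∀ c, SupportedOn U (S c)) (l : FreeMonoid C) : SupportedOn U (FreeMonoid.lift S l) := by
  induction l using FreeMonoid.inductionOn' with
  | one => simpa using SupportedOn.one
  | of_mul c l ih => rw [map_mul, FreeMonoid.lift_eval_of]; exact (h c).mul ih

/-- Behaviours on disjoint sets of cells commute. -/
theorem SupportedOn.mul_comm {U V : Set ℕ} {P Q : Set Traces} (hP : SupportedOn U P)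
    (hQ : SupportedOn V Q) (h : Disjoint U V) : P * Q = Q * P := by
  have key : ∀ t ∈ P, ∀ t' ∈ Q, t * t' = t' * t := by
    intro t ht t' ht'
    funext i
    by_cases hi : i ∈ U
    · simp [hQ t' ht' i (Set.disjoint_left.1 h hi)]
    · simp [hP t ht i hi]
  ext x
  constructor
  · rintro ⟨t, ht, t', ht', rfl⟩
    exact ⟨t', ht', t, ht, (key t ht t' ht').symm⟩
  · rintro ⟨t', ht', t, ht, rfl⟩
    exact ⟨t, ht, t', ht', key t ht t' ht'⟩

end

/-! ### Adequacy: the logical relation -/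

section

variable {Ω : Type} (δ : Ω → ℕ → ℕ → ℕ)

/-- `Done B b σ V σ'`: the value `V` of type `B` can perform the event `b`, changing the store from
`σ` to `σ'`. -/
def Done : (B : Ty) → Ev B → List ℕ → Tm Ω → List ℕ → Prop
  | .nat, k, σ, V, σ' => V = .num k ∧ σ' = σ
  | .comm, _, σ, V, σ' => V = .skip ∧ σ' = σ
  | .var, .read k, σ, V, σ' => ∃ x, V = .var x ∧ σ[x]? = some k ∧ σ' = σ
  | .var, .write k, σ, V, σ' => ∃ x, V = .var x ∧ x < σ.length ∧ σ' = σ.set x k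
  | .fn _ _, _, _, _, _ => False

/-- `Obs δ B b σ M σ'`: the term `M` of ground type `B` can be evaluated and then perform the
event `b`, which altogether changes the store from `σ` to `σ'`. -/
def Obs (B : Ty) (b : Ev B) (σ : List ℕ) (M : Tm Ω) (σ' : List ℕ) : Prop :=
  ∃ σ₁ V, Eval δ σ M σ₁ V ∧ Done B b σ₁ V σ'

/-- The behaviour of an application, in terms of those of the function and of its argument. -/
def applyRel {A B : Ty} (R : Ev (.fn A B) → Set Traces) (S : Ev A → Set Traces) :
    Ev B → Set Traces :=
  fun b => {t | ∃ l : FreeMonoid (Ev A), t ∈ R (l, b) * FreeMonoid.lift S l}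

/-- Agreement, at a ground type and in any store of at least `n` cells, of the operational
behaviour of `M` with the behaviour `R`. -/
def GroundRel (B : Ty) (n : ℕ) (M : Tm Ω) (R : Ev B → Set Traces) : Prop :=
  ∀ (m : ℕ) (σ : List ℕ), σ.length = n + m → ∀ (b : Ev B) (σ' : List ℕ),
    Obs δ B b σ (M.rename (· + m)) σ' ↔ ∃ t ∈ R b, Run σ t σ'

/-- The logical relation between terms over `n` cells, which access only those in `U`, and
behaviours on these cells. At function types the argument may use further cells, but none
of those in `U`. -/
def LogRel : (A : Ty) → ℕ → Set ℕ → Tm Ω → (Ev A → Set Traces) → Prop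
  | .nat, n, _, M, R => GroundRel δ .nat n M R
  | .comm, n, _, M, R => GroundRel δ .comm n M R
  | .var, n, _, M, R => GroundRel δ .var n M R
  | .fn A B, n, U, M, R => ∀ (m : ℕ) (V : Set ℕ) (N : Tm Ω) (S : Ev A → Set Traces),
      (∀ i ∈ V, i < n + m) → Disjoint U V → (∀ a, SupportedOn V (S a)) →
      LogRel A (n + m) V N S →
      LogRel B (n + m) (U ∪ V) (.app (M.rename (· + m)) N) (applyRel R S)

variable {δ}

theorem logRel_ground {B : Ty} (hB : B = .comm ∨ B = .nat ∨ B = .var) {n : ℕ} {U : Set ℕ}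
    {M : Tm Ω} {R : Ev B → Set Traces} : LogRel δ B n U M R ↔ GroundRel δ B n M R := by
  rcases hB with rfl | rfl | rfl <;> exact Iff.rfl

theorem rename_add_add (M : Tm Ω) (m m' : ℕ) :
    (M.rename (· + m)).rename (· + m') = M.rename (· + (m + m')) := by
  rw [Tm.rename_rename]
  congr 1
  funext i
  simp [add_assoc]

theorem rename_add_zero (M : Tm Ω) : M.rename (· + 0) = M := Tm.rename_id M

theorem GroundRel.world_mono {B : Ty} {n : ℕ} {M : Tm Ω} {R : Ev B → Set Traces}
    (h : GroundRel δ B n M R) (m : ℕ) : GroundRel δ B (n + m) (M.rename (· + m)) R := by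
  intro m' σ hσ b σ'
  rw [rename_add_add]
  exact h _ _ (by omega) _ _

theorem LogRel.world_mono : ∀ {A : Ty} {n : ℕ} {U : Set ℕ} {M : Tm Ω} {R : Ev A → Set Traces},
    LogRel δ A n U M R → ∀ m, LogRel δ A (n + m) U (M.rename (· + m)) R
  | .nat, _, _, _, _, h, m => GroundRel.world_mono h m
  | .comm, _, _, _, _, h, m => GroundRel.world_mono h m
  | .var, _, _, _, _, h, m => GroundRel.world_mono h m
  | .fn _ _, _, _, _, _, h, m => by
    intro m' V N S hV hUV hS hN
    have := h (m + m') V N S (by simpa [add_assoc] using hV) hUV hS (by simpa [add_assoc] using hN)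
    rw [rename_add_add]
    simpa [add_assoc] using this

theorem LogRel.support_mono : ∀ {A : Ty} {n : ℕ} {U U' : Set ℕ} {M : Tm Ω}
    {R : Ev A → Set Traces}, LogRel δ A n U M R → U ⊆ U' → LogRel δ A n U' M R
  | .nat, _, _, _, _, _, h, _ => h
  | .comm, _, _, _, _, _, h, _ => h
  | .var, _, _, _, _, _, h, _ => h
  | .fn _ _, _, _, _, _, _, h, hU => fun m V N S hV hUV hS hN =>
    (h m V N S hV (hUV.mono_left hU) hS hN).support_mono (Set.union_subset_union_left V hU)

/-- Terms with the same evaluations. -/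
def EvalEq (δ : Ω → ℕ → ℕ → ℕ) (M M' : Tm Ω) : Prop :=
  ∀ σ σ' V, Eval δ σ M σ' V ↔ Eval δ σ M' σ' V

theorem eval_app_iff {σ σ'' : List ℕ} {M N V : Tm Ω} : Eval δ σ (.app M N) σ'' V ↔
    ∃ σ' A M', Eval δ σ M σ' (.lam A M') ∧ Eval δ σ' (M'.inst N) σ'' V := by
  constructor
  · intro h
    cases h with
    | value h => exact h.elim
    | app h₁ h₂ => exact ⟨_, _, _, h₁, h₂⟩
  · rintro ⟨_, _, _, h₁, h₂⟩
    exact .app h₁ h₂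

theorem EvalEq.app {M M' : Tm Ω} (h : EvalEq δ M M') (N : Tm Ω) :
    EvalEq δ (.app M N) (.app M' N) := by
  intro σ σ' V
  simp only [eval_app_iff, h _ _ _]

theorem evalEq_beta (A : Ty) (M N : Tm Ω) : EvalEq δ (.app (.lam A M) N) (M.inst N) := by
  intro σ σ' V
  rw [eval_app_iff]
  constructor
  · rintro ⟨_, _, _, h₁, h₂⟩
    cases h₁
    exact h₂
  · intro h
    exact ⟨_, _, _, .value trivial, h⟩

theorem GroundRel.of_evalEq {B : Ty} {n : ℕ} {M M' : Tm Ω} {R : Ev B → Set Traces}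
    (h : GroundRel δ B n M' R)
    (hM : ∀ m : ℕ, EvalEq δ (M.rename (· + m)) (M'.rename (· + m))) : GroundRel δ B n M R := by
  intro m σ hσ b σ'
  rw [← h m σ hσ b σ']
  simp only [Obs, hM m _ _ _]

theorem LogRel.of_evalEq : ∀ {A : Ty} {n : ℕ} {U : Set ℕ} {M M' : Tm Ω} {R : Ev A → Set Traces},
    LogRel δ A n U M' R → (∀ m : ℕ, EvalEq δ (M.rename (· + m)) (M'.rename (· + m))) →
    LogRel δ A n U M R
  | .nat, _, _, _, _, _, h, hM => GroundRel.of_evalEq h hM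
  | .comm, _, _, _, _, _, h, hM => GroundRel.of_evalEq h hM
  | .var, _, _, _, _, _, h, hM => GroundRel.of_evalEq h hM
  | .fn _ _, _, _, _, _, _, h, hM => fun m V N S hV hUV hS hN =>
    (h m V N S hV hUV hS hN).of_evalEq fun m' => by
      simp only [Tm.rename, rename_add_add]
      exact (hM _).app _

variable (δ) in
/-- The logical relation for typing contexts: `θ` substitutes related terms, using disjoint sets of
cells inside `U`, for the identifiers in `Γ`, and `ρ` is their joint behaviour. -/
def EnvRel : (Γ : List Ty) → ℕ → Set ℕ → (ℕ → Tm Ω) → (ctxObj Γ → Set Traces) → Prop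
  | [], _, _, _, ρ => ∀ g, ρ g = 1
  | A :: Γ, n, U, θ, ρ => ∃ (U₁ U₂ : Set ℕ) (ρ' : ctxObj Γ → Set Traces) (S : Ev A → Set Traces),
      U₁ ⊆ U ∧ U₂ ⊆ U ∧ Disjoint U₁ U₂ ∧ (∀ a, SupportedOn U₂ (S a)) ∧
      LogRel δ A n U₂ (θ 0) S ∧ EnvRel Γ n U₁ (fun i => θ (i + 1)) ρ' ∧
      ∀ (g : ctxObj Γ) (l : FreeMonoid (Ev A)), ρ (g, l) = ρ' g * FreeMonoid.lift S l

theorem EnvRel.world_mono : ∀ {Γ : List Ty} {n : ℕ} {U : Set ℕ} {θ : ℕ → Tm Ω}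
    {ρ : ctxObj Γ → Set Traces}, EnvRel δ Γ n U θ ρ → ∀ m,
    EnvRel δ Γ (n + m) U (fun i => (θ i).rename (· + m)) ρ
  | [], _, _, _, _, h, _ => h
  | _ :: _, _, _, _, _, ⟨U₁, U₂, ρ', S, h₁, h₂, hd, hS, h0, hΓ, hρ⟩, m =>
    ⟨U₁, U₂, ρ', S, h₁, h₂, hd, hS, h0.world_mono m, hΓ.world_mono m, hρ⟩

theorem EnvRel.supportedOn : ∀ {Γ : List Ty} {n : ℕ} {U : Set ℕ} {θ : ℕ → Tm Ω}
    {ρ : ctxObj Γ → Set Traces}, EnvRel δ Γ n U θ ρ → ∀ g, SupportedOn U (ρ g)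
  | [], _, _, _, _, h, g => by
    rw [show _ = _ from h g]
    exact .one
  | _ :: _, _, _, _, _, ⟨_, _, _, _, h₁, h₂, _, hS, _, hΓ, hρ⟩, (g, l) =>
    (congrArg (SupportedOn _) (hρ g l)).mpr
      (((hΓ.supportedOn g).mono h₁).mul ((SupportedOn.lift hS l).mono h₂))

theorem EnvRel.map_one : ∀ {Γ : List Ty} {n : ℕ} {U : Set ℕ} {θ : ℕ → Tm Ω}
    {ρ : ctxObj Γ → Set Traces}, EnvRel δ Γ n U θ ρ → ρ 1 = 1
  | [], _, _, _, _, h => h _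
  | _ :: _, _, _, _, _, ⟨_, _, _, _, _, _, _, _, _, hΓ, hρ⟩ => by
    refine (hρ 1 1).trans ?_
    rw [hΓ.map_one, _root_.map_one, mul_one]

/-- Joint behaviours are multiplicative, because behaviours on disjoint sets of cells commute. -/
theorem EnvRel.map_mul : ∀ {Γ : List Ty} {n : ℕ} {U : Set ℕ} {θ : ℕ → Tm Ω}
    {ρ : ctxObj Γ → Set Traces}, EnvRel δ Γ n U θ ρ → ∀ g g', ρ (g * g') = ρ g * ρ g'
  | [], _, _, _, _, h, g, g' => by
    rw [show _ = _ from h g, show _ = _ from h g', show _ = _ from h (g * g'), one_mul]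
  | _ :: _, _, _, _, _, ⟨_, _, _, S, _, _, hd, hS, _, hΓ, hρ⟩, (g, l), (g', l') => by
    change FreeMonoid (Ev _) at l l'
    refine (hρ (g * g') (l * l')).trans
      (.trans ?_ (congrArg₂ (· * ·) (hρ g l) (hρ g' l')).symm)
    rw [hΓ.map_mul, _root_.map_mul, mul_assoc, mul_assoc,
      ← mul_assoc _ _ (FreeMonoid.lift S l'), ← mul_assoc _ _ (FreeMonoid.lift S l'),
      (hΓ.supportedOn g').mul_comm (SupportedOn.lift hS l) hd, mul_assoc, mul_assoc]

theorem EnvRel.perm {Γ Γ' : List Ty} (p : Perm Γ Γ') : ∀ {n : ℕ} {U : Set ℕ} {θ : ℕ → Tm Ω}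
    {ρ : ctxObj Γ' → Set Traces}, EnvRel δ Γ' n U θ ρ →
    EnvRel δ Γ n U (fun i => θ (p.ren i)) (fun g => ρ (p.hom g)) := by
  induction p with
  | nil => intro n U θ ρ h; exact h
  | cons A p ih =>
    rintro n U θ ρ ⟨U₁, U₂, ρ', S, h₁, h₂, hd, hS, h0, hΓ, hρ⟩
    exact ⟨U₁, U₂, _, S, h₁, h₂, hd, hS, h0, ih hΓ, fun g l => hρ _ _⟩
  | swap A B Γ =>
    rintro n U θ ρ ⟨U₁, U₂, ρ', S, h₁, h₂, hd, hS, h0,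
      ⟨V₁, V₂, ρ'', S', k₁, k₂, kd, kS, k0, kΓ, kρ⟩, hρ⟩
    refine ⟨V₁ ∪ U₂, V₂, fun g => ρ'' g.1 * FreeMonoid.lift S g.2, S',
      Set.union_subset (k₁.trans h₁) h₂, k₂.trans h₁, ?_, kS, k0, ?_, ?_⟩
    · exact Set.disjoint_union_left.2 ⟨kd, (hd.mono_left k₂).symm⟩
    · exact ⟨V₁, U₂, ρ'', S, Set.subset_union_left, Set.subset_union_right, hd.mono_left k₁, hS,
        h0, kΓ, fun g l => rfl⟩
    · rintro ⟨g, l⟩ l'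
      refine (hρ (g, l') l).trans ?_
      rw [kρ, mul_assoc, mul_assoc,
        (SupportedOn.lift kS l').mul_comm (SupportedOn.lift hS l) (hd.mono_left k₂)]
  | trans p q ihp ihq =>
    intro n U θ ρ h
    exact ihp (ihq h)

/-- The identifiers in `Γ` and those in `Δ` use disjoint sets of cells. -/
theorem EnvRel.join {Γ : List Ty} : ∀ {Δ : List Ty} {n : ℕ} {U : Set ℕ} {θ : ℕ → Tm Ω}
    {ρ : ctxObj (Δ ++ Γ) → Set Traces}, EnvRel δ (Δ ++ Γ) n U θ ρ →
    ∃ (U₁ U₂ : Set ℕ) (ρ₁ : ctxObj Γ → Set Traces) (ρ₂ : ctxObj Δ → Set Traces),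
      U₁ ⊆ U ∧ U₂ ⊆ U ∧ Disjoint U₁ U₂ ∧ EnvRel δ Γ n U₁ (fun i => θ (i + Δ.length)) ρ₁ ∧
      EnvRel δ Δ n U₂ θ ρ₂ ∧ ∀ x y, ρ (joinHom Γ Δ (x, y)) = ρ₁ x * ρ₂ y
  | [], _, U, _, ρ, h => ⟨U, ∅, ρ, fun _ => 1, subset_rfl, Set.empty_subset _,
      Set.disjoint_empty _, h, fun _ => rfl, fun x _ => (mul_one (ρ x)).symm⟩
  | A :: Δ, _, _, _, _, ⟨U₁, U₂, ρ', S, h₁, h₂, hd, hS, h0, hΓ, hρ⟩ => by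
    obtain ⟨V₁, V₂, ρ₁, ρ₂, k₁, k₂, kd, kΓ, kΔ, kρ⟩ := hΓ.join
    refine ⟨V₁, V₂ ∪ U₂, ρ₁, fun g => ρ₂ g.1 * FreeMonoid.lift S g.2, k₁.trans h₁,
      Set.union_subset (k₂.trans h₁) h₂,
      Set.disjoint_union_right.2 ⟨kd, hd.mono_left k₁⟩, kΓ, ?_, ?_⟩
    · exact ⟨V₂, U₂, ρ₂, S, Set.subset_union_left, Set.subset_union_right, hd.mono_left k₂, hS,
        h0, kΔ, fun g l => rfl⟩
    · rintro x ⟨y, l⟩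
      refine (hρ _ l).trans ?_
      have h := kρ x y
      rw [← mul_assoc]
      exact congrArg (· * FreeMonoid.lift S l) h

end

/-! ### Adequacy: the fundamental lemma -/

section

variable {Ω : Type} {δ : Ω → ℕ → ℕ → ℕ}

/-- The behaviour of a term, given that `ρ` is the joint behaviour of its identifiers. -/
def behaviour {Γ : List Ty} {M : Tm Ω} {A : Ty} (d : Deriv Γ M A) (ρ : ctxObj Γ → Set Traces) :
    Ev A → Set Traces :=
  fun b => {t | ∃ g ∈ sem δ d b, t ∈ ρ g}

/-- The store changes from `σ` to `σ'` when the identifiers, with joint behaviour `ρ`, perform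
the events `g`. -/
def RunCtx {Γ : List Ty} (ρ : ctxObj Γ → Set Traces) (g : ctxObj Γ) (σ σ' : List ℕ) : Prop :=
  ∃ t ∈ ρ g, Run σ t σ'

theorem RunCtx.length_eq {Γ : List Ty} {ρ : ctxObj Γ → Set Traces} {g : ctxObj Γ}
    {σ σ' : List ℕ} (h : RunCtx ρ g σ σ') : σ'.length = σ.length := by
  obtain ⟨t, _, h⟩ := h
  exact h.length_eq

theorem EnvRel.runCtx_one_iff {Γ : List Ty} {n : ℕ} {U : Set ℕ} {θ : ℕ → Tm Ω}
    {ρ : ctxObj Γ → Set Traces} (h : EnvRel δ Γ n U θ ρ) {σ σ' : List ℕ} :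
    RunCtx ρ 1 σ σ' ↔ σ' = σ := by
  simp [RunCtx, h.map_one, run_one_iff]

theorem EnvRel.runCtx_mul_iff {Γ : List Ty} {n : ℕ} {U : Set ℕ} {θ : ℕ → Tm Ω}
    {ρ : ctxObj Γ → Set Traces} (h : EnvRel δ Γ n U θ ρ) {σ σ'' : List ℕ} {x y : ctxObj Γ} :
    RunCtx ρ (x * y) σ σ'' ↔ ∃ σ', RunCtx ρ x σ σ' ∧ RunCtx ρ y σ' σ'' := by
  simp only [RunCtx, h.map_mul, Set.mem_mul]
  constructor
  · rintro ⟨_, ⟨t, ht, t', ht', rfl⟩, hr⟩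
    obtain ⟨σ', h₁, h₂⟩ := run_mul_iff.1 hr
    exact ⟨σ', ⟨t, ht, h₁⟩, t', ht', h₂⟩
  · rintro ⟨σ', ⟨t, ht, h₁⟩, t', ht', h₂⟩
    exact ⟨_, ⟨t, ht, t', ht', rfl⟩, run_mul_iff.2 ⟨σ', h₁, h₂⟩⟩

variable (δ) in
/-- Soundness and adequacy of a derivation for the operational semantics. -/
def Adequate {Γ : List Ty} {M : Tm Ω} {A : Ty} (d : Deriv Γ M A) : Prop :=
  ∀ (n : ℕ) (U : Set ℕ) (θ : ℕ → Tm Ω) (ρ : ctxObj Γ → Set Traces), (∀ i ∈ U, i < n) →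
    EnvRel δ Γ n U θ ρ → LogRel δ A n U (M.subst θ) (behaviour (δ := δ) d ρ)

variable {Γ Δ : List Ty} {A B : Ty} {M N N₁ N₂ : Tm Ω}

theorem Adequate.obs_iff {d : Deriv Γ M B} (hd : Adequate δ d)
    (hB : B = .comm ∨ B = .nat ∨ B = .var) {n : ℕ} {U : Set ℕ} {θ : ℕ → Tm Ω}
    {ρ : ctxObj Γ → Set Traces} (hU : ∀ i ∈ U, i < n) (hρ : EnvRel δ Γ n U θ ρ) {σ : List ℕ}
    (hσ : σ.length = n) {b : Ev B} {σ' : List ℕ} :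
    Obs δ B b σ (M.subst θ) σ' ↔ ∃ g ∈ sem δ d b, RunCtx ρ g σ σ' := by
  have h := (logRel_ground hB).1 (hd n U θ ρ hU hρ) 0 σ hσ b σ'
  rw [rename_add_zero] at h
  rw [h]
  simp only [behaviour, RunCtx]
  constructor
  · rintro ⟨t, ⟨g, hg, ht⟩, hr⟩
    exact ⟨g, hg, t, ht, hr⟩
  · rintro ⟨g, hg, t, ht, hr⟩
    exact ⟨t, ⟨g, hg, ht⟩, hr⟩

theorem adequate_of_obs_iff {d : Deriv Γ M B} (hB : B = .comm ∨ B = .nat ∨ B = .var)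
    (h : ∀ (n : ℕ) (U : Set ℕ) (θ : ℕ → Tm Ω) (ρ : ctxObj Γ → Set Traces), (∀ i ∈ U, i < n) →
      EnvRel δ Γ n U θ ρ → ∀ σ : List ℕ, σ.length = n → ∀ (b : Ev B) (σ' : List ℕ),
      Obs δ B b σ (M.subst θ) σ' ↔ ∃ g ∈ sem δ d b, RunCtx ρ g σ σ') :
    Adequate δ d := by
  intro n U θ ρ hU hρ
  refine (logRel_ground hB).2 fun m σ hσ b σ' => ?_
  rw [Tm.rename_subst, h (n + m) U _ ρ (fun i hi => Nat.lt_add_right m (hU i hi))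
    (hρ.world_mono m) σ hσ b σ']
  simp only [behaviour, RunCtx]
  constructor
  · rintro ⟨g, hg, t, ht, hr⟩
    exact ⟨t, ⟨g, hg, ht⟩, hr⟩
  · rintro ⟨t, ⟨g, hg, ht⟩, hr⟩
    exact ⟨g, hg, t, ht, hr⟩

theorem obs_nat_iff {k : ℕ} {σ σ' : List ℕ} :
    Obs δ .nat k σ M σ' ↔ Eval δ σ M σ' (.num k) := by
  constructor
  · rintro ⟨_, _, h, rfl, rfl⟩
    exact h
  · intro h
    exact ⟨_, _, h, rfl, rfl⟩

theorem obs_comm_iff {b : Ev .comm} {σ σ' : List ℕ} :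
    Obs δ .comm b σ M σ' ↔ Eval δ σ M σ' .skip := by
  constructor
  · rintro ⟨_, _, h, rfl, rfl⟩
    exact h
  · intro h
    exact ⟨_, _, h, rfl, rfl⟩

theorem obs_read_iff {k : ℕ} {σ σ' : List ℕ} :
    Obs δ .var (VarEv.read k) σ M σ' ↔ ∃ x, Eval δ σ M σ' (.var x) ∧ σ'[x]? = some k := by
  constructor
  · rintro ⟨_, _, h, x, rfl, hx, rfl⟩
    exact ⟨x, h, hx⟩
  · rintro ⟨x, h, hx⟩
    exact ⟨_, _, h, x, rfl, hx, rfl⟩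

theorem obs_write_iff {k : ℕ} {σ σ' : List ℕ} :
    Obs δ .var (VarEv.write k) σ M σ' ↔
      ∃ σ₁ x, Eval δ σ M σ₁ (.var x) ∧ x < σ₁.length ∧ σ' = σ₁.set x k := by
  constructor
  · rintro ⟨_, _, h, x, rfl, hx, rfl⟩
    exact ⟨_, x, h, hx, rfl⟩
  · rintro ⟨_, x, h, hx, rfl⟩
    exact ⟨_, _, h, x, rfl, hx, rfl⟩

theorem Adequate.var (A : Ty) : Adequate δ (.var A : Deriv [A] (.var 0 : Tm Ω) A) := by
  rintro n U θ ρ hU ⟨U₁, U₂, ρ', S, h₁, h₂, hd, hS, h0, hΓ, hρ⟩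
  have : behaviour (δ := δ) (.var A : Deriv [A] (.var 0 : Tm Ω) A) ρ = S := by
    funext b
    ext t
    have h : ρ ((1 : ctxObj []), FreeMonoid.of b) = S b := by
      refine (hρ 1 (FreeMonoid.of b)).trans ?_
      rw [hΓ.map_one, FreeMonoid.lift_eval_of, one_mul]
    constructor
    · rintro ⟨g, rfl, ht⟩
      exact h.subset ht
    · intro ht
      exact ⟨_, rfl, h.symm.subset ht⟩
  rw [this]
  exact h0.support_mono h₂

theorem Adequate.lam {d : Deriv (A :: Γ) M B} (hd : Adequate δ d) : Adequate δ (.lam d) := by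
  intro n U θ ρ hU hρ m V N S hV hUV hS hN
  have hE : EnvRel δ (A :: Γ) (n + m) (U ∪ V) (Tm.consSub N fun i => (θ i).rename (· + m))
      (fun g : ctxObj Γ × FreeMonoid (Ev A) => ρ g.1 * FreeMonoid.lift S g.2) :=
    ⟨U, V, ρ, S, Set.subset_union_left, Set.subset_union_right, hUV, hS, hN, hρ.world_mono m,
      fun _ _ => rfl⟩
  have h := hd (n + m) (U ∪ V) _ _
    (fun i hi => hi.elim (fun hi => Nat.lt_add_right m (hU i hi)) (hV i)) hE
  have hR : behaviour (δ := δ) d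
      (fun g : ctxObj Γ × FreeMonoid (Ev A) => ρ g.1 * FreeMonoid.lift S g.2) =
      applyRel (behaviour (δ := δ) (.lam d) ρ) S := by
    funext b
    ext t
    constructor
    · rintro ⟨⟨g, l⟩, hg, t₁, ht₁, t₂, ht₂, rfl⟩
      exact ⟨l, t₁, ⟨g, mem_sem_lam.2 hg, ht₁⟩, t₂, ht₂, rfl⟩
    · rintro ⟨l, t₁, ⟨g, hg, ht₁⟩, t₂, ht₂, rfl⟩
      exact ⟨(g, l), mem_sem_lam.1 hg, t₁, ht₁, t₂, ht₂, rfl⟩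
  rw [hR] at h
  refine h.of_evalEq fun m' => ?_
  rw [Tm.rename_subst, ← Tm.inst_liftSub]
  have := evalEq_beta (δ := δ) A
    (M.subst (Tm.liftSub fun i => ((θ i).rename (· + m)).rename (· + m'))) (N.rename (· + m'))
  rw [Tm.inst_liftSub] at this
  rw [Tm.inst_liftSub, Tm.rename_subst]
  convert this using 2
  · change Tm.app (Tm.rename _ (Tm.subst _ (Tm.lam A M))) _ = _
    rw [Tm.rename_subst]
    rfl
  · funext i
    cases i <;> rfl

theorem EnvRel.lift_behaviour {n : ℕ} {U : Set ℕ} {θ : ℕ → Tm Ω} {ρ : ctxObj Γ → Set Traces}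
    (hρ : EnvRel δ Γ n U θ ρ) (d : Deriv Γ M A) (l : FreeMonoid (Ev A)) (t : Traces) :
    t ∈ FreeMonoid.lift (behaviour (δ := δ) d ρ) l ↔ ∃ g ∈ semStar δ d l, t ∈ ρ g := by
  induction l using FreeMonoid.inductionOn' generalizing t with
  | one =>
    rw [_root_.map_one, _root_.map_one]
    simp only [Set.mem_one, exists_eq_left, hρ.map_one]
  | of_mul c l ih =>
    rw [_root_.map_mul, _root_.map_mul, FreeMonoid.lift_eval_of]
    constructor
    · rintro ⟨t₁, ⟨g, hg, ht₁⟩, t₂, ht₂, rfl⟩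
      obtain ⟨g', hg', ht₂⟩ := (ih t₂).1 ht₂
      refine ⟨_, ⟨g, hg, g', hg', rfl⟩, ?_⟩
      exact (hρ.map_mul g g').symm.subset ⟨t₁, ht₁, t₂, ht₂, rfl⟩
    · rintro ⟨_, ⟨g, hg, g', hg', rfl⟩, ht⟩
      obtain ⟨t₁, ht₁, t₂, ht₂, rfl⟩ := (hρ.map_mul g g').subset ht
      exact ⟨t₁, ⟨g, hg, ht₁⟩, t₂, (ih t₂).2 ⟨g', hg', ht₂⟩, rfl⟩

theorem Adequate.app {d : Deriv Γ M (.fn A B)} {e : Deriv Δ N A} (hd : Adequate δ d)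
    (he : Adequate δ e) : Adequate δ (.app d e) := by
  intro n U θ ρ hU hρ
  obtain ⟨U₁, U₂, ρ₁, ρ₂, h₁, h₂, hdisj, hΓ, hΔ, hjoin⟩ := hρ.join
  have hN := he n U₂ θ ρ₂ (fun i hi => hU i (h₂ hi)) hΔ
  have h := hd n U₁ _ ρ₁ (fun i hi => hU i (h₁ hi)) hΓ 0 U₂ (N.subst θ)
    (behaviour (δ := δ) e ρ₂)
    (fun i hi => hU i (h₂ hi)) hdisj
    (fun a t ⟨g, _, ht⟩ => hΔ.supportedOn g t ht) hN
  have hR : behaviour (δ := δ) (.app d e) ρ =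
      applyRel (behaviour (δ := δ) d ρ₁) (behaviour (δ := δ) e ρ₂) := by
    funext b
    ext t
    constructor
    · rintro ⟨g, hg, ht⟩
      obtain ⟨l, x, y, hx, hy, rfl⟩ := mem_sem_app.1 hg
      obtain ⟨t₁, ht₁, t₂, ht₂, rfl⟩ := (hjoin x y).subset ht
      exact ⟨l, t₁, ⟨x, hx, ht₁⟩, t₂, (hΔ.lift_behaviour e l t₂).2 ⟨y, hy, ht₂⟩, rfl⟩
    · rintro ⟨l, t₁, ⟨x, hx, ht₁⟩, t₂, ht₂, rfl⟩
      obtain ⟨y, hy, ht₂⟩ := (hΔ.lift_behaviour e l t₂).1 ht₂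
      exact ⟨_, mem_sem_app.2 ⟨l, x, y, hx, hy, rfl⟩,
        (hjoin x y).symm.subset ⟨t₁, ht₁, t₂, ht₂, rfl⟩⟩
  rw [hR]
  rw [rename_add_zero] at h
  have hM : (Tm.app (M.rename (· + Δ.length)) N).subst θ =
      .app (M.subst fun i => θ (i + Δ.length)) (N.subst θ) := by
    rw [Tm.subst, Tm.subst_rename]
    rfl
  rw [hM]
  exact h.support_mono (Set.union_subset h₁ h₂)

theorem Adequate.weak {d : Deriv Γ M B} (hd : Adequate δ d) : Adequate δ (.weak A d) := by
  rintro n U θ ρ hU ⟨U₁, U₂, ρ', S, h₁, h₂, hdisj, hS, h0, hΓ, hρ⟩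
  have h := hd n U₁ _ ρ' (fun i hi => hU i (h₁ hi)) hΓ
  have hR : behaviour (δ := δ) (.weak A d) ρ = behaviour (δ := δ) d ρ' := by
    have h1 : ∀ x : ctxObj Γ, ρ (x, 1) = ρ' x := fun x => by
      refine (hρ x 1).trans ?_
      rw [_root_.map_one, mul_one]
    funext b
    ext t
    constructor
    · rintro ⟨g, hg, ht⟩
      obtain ⟨x, hx, rfl⟩ := mem_sem_weak.1 hg
      exact ⟨x, hx, (h1 x).subset ht⟩
    · rintro ⟨x, hx, ht⟩
      exact ⟨_, mem_sem_weak.2 ⟨x, hx, rfl⟩, (h1 x).symm.subset ht⟩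
  rw [hR, Tm.subst_rename]
  exact h.support_mono h₁

theorem Adequate.exch {Γ' : List Ty} {p : Perm Γ Γ'} {d : Deriv Γ M A} (hd : Adequate δ d) :
    Adequate δ (.exch p d) := by
  intro n U θ ρ hU hρ
  have h := hd n U _ _ hU (hρ.perm p)
  have hR : behaviour (δ := δ) (.exch p d) ρ =
      behaviour (δ := δ) d (fun g => ρ (p.hom g)) := by
    funext b
    ext t
    constructor
    · rintro ⟨g, hg, ht⟩
      obtain ⟨x, hx, rfl⟩ := mem_sem_exch.1 hg
      exact ⟨x, hx, ht⟩
    · rintro ⟨x, hx, ht⟩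
      exact ⟨_, mem_sem_exch.2 ⟨x, hx, rfl⟩, ht⟩
  rw [hR, Tm.subst_rename]
  exact h

theorem Adequate.num (k : ℕ) : Adequate δ (.num k : Deriv [] (.num k : Tm Ω) .nat) := by
  refine adequate_of_obs_iff (.inr (.inl rfl)) fun n U θ ρ hU hρ σ hσ b σ' => ?_
  refine obs_nat_iff.trans ?_
  constructor
  · intro h
    cases h
    exact ⟨1, mem_sem_num.2 rfl, hρ.runCtx_one_iff.2 rfl⟩
  · rintro ⟨g, hg, hr⟩
    obtain rfl := mem_sem_num.1 hg
    obtain rfl := hρ.runCtx_one_iff.1 hr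
    exact .value trivial

theorem Adequate.skip : Adequate δ (.skip : Deriv [] (.skip : Tm Ω) .comm) := by
  refine adequate_of_obs_iff (.inl rfl) fun n U θ ρ hU hρ σ hσ b σ' => ?_
  refine obs_comm_iff.trans ?_
  constructor
  · intro h
    cases h
    exact ⟨1, mem_sem_skip, hρ.runCtx_one_iff.2 rfl⟩
  · rintro ⟨g, hg, hr⟩
    obtain rfl := hρ.runCtx_one_iff.1 hr
    exact .value trivial

theorem Adequate.op {o : BinOp Ω} {d : Deriv Γ M .nat} {e : Deriv Γ N .nat} (hd : Adequate δ d)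
    (he : Adequate δ e) : Adequate δ (.op o d e) := by
  refine adequate_of_obs_iff (.inr (.inl rfl)) fun n U θ ρ hU hρ σ hσ b σ' => ?_
  refine obs_nat_iff.trans ?_
  constructor
  · intro h
    cases h with
    | op h₁ h₂ =>
      obtain ⟨x, hx, hr⟩ := (hd.obs_iff (.inr (.inl rfl)) hU hρ hσ).1 (obs_nat_iff.2 h₁)
      obtain ⟨y, hy, hr'⟩ := (he.obs_iff (.inr (.inl rfl)) hU hρ (hr.length_eq.trans hσ)).1
        (obs_nat_iff.2 h₂)
      exact ⟨x * y, mem_sem_op.2 ⟨_, _, x, y, hx, hy, rfl, rfl⟩,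
        hρ.runCtx_mul_iff.2 ⟨_, hr, hr'⟩⟩
  · rintro ⟨g, hg, hr⟩
    obtain ⟨m, n, x, y, hx, hy, rfl, rfl⟩ := mem_sem_op.1 hg
    obtain ⟨σ₁, h₁, h₂⟩ := hρ.runCtx_mul_iff.1 hr
    exact .op (obs_nat_iff.1 ((hd.obs_iff (.inr (.inl rfl)) hU hρ hσ).2 ⟨x, hx, h₁⟩))
      (obs_nat_iff.1 ((he.obs_iff (.inr (.inl rfl)) hU hρ (h₁.length_eq.trans hσ)).2 ⟨y, hy, h₂⟩))

theorem Adequate.seq {hB : B = .comm ∨ B = .nat ∨ B = .var} {d : Deriv Γ M .comm}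
    {e : Deriv Γ N B} (hd : Adequate δ d) (he : Adequate δ e) : Adequate δ (.seq hB d e) := by
  refine adequate_of_obs_iff hB fun n U θ ρ hU hρ σ hσ b σ' => ?_
  constructor
  · rintro ⟨σ₂, V, h, hV⟩
    cases h with
    | value h => exact h.elim
    | seq h₁ h₂ =>
      obtain ⟨x, hx, hr⟩ := (hd.obs_iff (b := ()) (.inl rfl) hU hρ hσ).1 (obs_comm_iff.2 h₁)
      obtain ⟨y, hy, hr'⟩ := (he.obs_iff hB hU hρ (hr.length_eq.trans hσ)).1 ⟨_, _, h₂, hV⟩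
      exact ⟨x * y, mem_sem_seq.2 ⟨x, y, hx, hy, rfl⟩, hρ.runCtx_mul_iff.2 ⟨_, hr, hr'⟩⟩
  · rintro ⟨g, hg, hr⟩
    obtain ⟨x, y, hx, hy, rfl⟩ := mem_sem_seq.1 hg
    obtain ⟨σ₁, h₁, h₂⟩ := hρ.runCtx_mul_iff.1 hr
    obtain ⟨σ₂, V, h, hV⟩ := (he.obs_iff hB hU hρ (h₁.length_eq.trans hσ)).2 ⟨y, hy, h₂⟩
    exact ⟨σ₂, V, .seq (obs_comm_iff.1 ((hd.obs_iff (.inl rfl) hU hρ hσ).2 ⟨x, hx, h₁⟩)) h, hV⟩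

theorem Adequate.assign {d : Deriv Γ M .var} {e : Deriv Γ N .nat} (hd : Adequate δ d)
    (he : Adequate δ e) : Adequate δ (.assign d e) := by
  refine adequate_of_obs_iff (.inl rfl) fun n U θ ρ hU hρ σ hσ b σ' => ?_
  refine obs_comm_iff.trans ?_
  constructor
  · intro h
    cases h with
    | assign h₁ h₂ hx =>
      obtain ⟨x, hx, hr⟩ := (he.obs_iff (.inr (.inl rfl)) hU hρ hσ).1 (obs_nat_iff.2 h₁)
      obtain ⟨y, hy, hr'⟩ := (hd.obs_iff (.inr (.inr rfl)) hU hρ (hr.length_eq.trans hσ)).1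
        (obs_write_iff.2 ⟨_, _, h₂, by assumption, rfl⟩)
      exact ⟨x * y, mem_sem_assign.2 ⟨_, x, y, hx, hy, rfl⟩, hρ.runCtx_mul_iff.2 ⟨_, hr, hr'⟩⟩
  · rintro ⟨g, hg, hr⟩
    obtain ⟨n, x, y, hx, hy, rfl⟩ := mem_sem_assign.1 hg
    obtain ⟨σ₁, h₁, h₂⟩ := hρ.runCtx_mul_iff.1 hr
    obtain ⟨σ₂, i, h, hi, rfl⟩ := obs_write_iff.1
      ((hd.obs_iff (.inr (.inr rfl)) hU hρ (h₁.length_eq.trans hσ)).2 ⟨y, hy, h₂⟩)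
    exact .assign (obs_nat_iff.1 ((he.obs_iff (.inr (.inl rfl)) hU hρ hσ).2 ⟨x, hx, h₁⟩)) h hi

theorem Adequate.deref {d : Deriv Γ M .var} (hd : Adequate δ d) : Adequate δ (.deref d) := by
  refine adequate_of_obs_iff (.inr (.inl rfl)) fun n U θ ρ hU hρ σ hσ b σ' => ?_
  refine obs_nat_iff.trans ?_
  constructor
  · intro h
    cases h with
    | deref h₁ hx =>
      obtain ⟨x, hx, hr⟩ := (hd.obs_iff (.inr (.inr rfl)) hU hρ hσ).1 (obs_read_iff.2 ⟨_, h₁, hx⟩)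
      exact ⟨x, mem_sem_deref.2 hx, hr⟩
  · rintro ⟨g, hg, hr⟩
    obtain ⟨x, h, hx⟩ := obs_read_iff.1
      ((hd.obs_iff (.inr (.inr rfl)) hU hρ hσ).2 ⟨g, mem_sem_deref.1 hg, hr⟩)
    exact .deref h hx

theorem Adequate.ifz {hB : B = .comm ∨ B = .nat ∨ B = .var} {d : Deriv Γ M .nat}
    {e₁ : Deriv Γ N₁ B} {e₂ : Deriv Γ N₂ B} (hd : Adequate δ d) (he₁ : Adequate δ e₁)
    (he₂ : Adequate δ e₂) : Adequate δ (.ifz hB d e₁ e₂) := by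
  refine adequate_of_obs_iff hB fun n U θ ρ hU hρ σ hσ b σ' => ?_
  constructor
  · rintro ⟨σ₂, V, h, hV⟩
    cases h with
    | value h => exact h.elim
    | ifz_zero h₁ h₂ =>
      obtain ⟨x, hx, hr⟩ := (hd.obs_iff (.inr (.inl rfl)) hU hρ hσ).1 (obs_nat_iff.2 h₁)
      obtain ⟨y, hy, hr'⟩ := (he₁.obs_iff hB hU hρ (hr.length_eq.trans hσ)).1 ⟨_, _, h₂, hV⟩
      exact ⟨x * y, mem_sem_ifz.2 ⟨_, x, y, hx, .inl ⟨rfl, hy⟩, rfl⟩,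
        hρ.runCtx_mul_iff.2 ⟨_, hr, hr'⟩⟩
    | ifz_ne h₁ hn h₂ =>
      obtain ⟨x, hx, hr⟩ := (hd.obs_iff (.inr (.inl rfl)) hU hρ hσ).1 (obs_nat_iff.2 h₁)
      obtain ⟨y, hy, hr'⟩ := (he₂.obs_iff hB hU hρ (hr.length_eq.trans hσ)).1 ⟨_, _, h₂, hV⟩
      exact ⟨x * y, mem_sem_ifz.2 ⟨_, x, y, hx, .inr ⟨hn, hy⟩, rfl⟩,
        hρ.runCtx_mul_iff.2 ⟨_, hr, hr'⟩⟩
  · rintro ⟨g, hg, hr⟩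
    obtain ⟨n, x, y, hx, hy, rfl⟩ := mem_sem_ifz.1 hg
    obtain ⟨σ₁, h₁, h₂⟩ := hρ.runCtx_mul_iff.1 hr
    have hM := obs_nat_iff.1 ((hd.obs_iff (.inr (.inl rfl)) hU hρ hσ).2 ⟨x, hx, h₁⟩)
    obtain ⟨rfl, hy⟩ | ⟨hn, hy⟩ := hy
    · obtain ⟨σ₂, V, h, hV⟩ := (he₁.obs_iff hB hU hρ (h₁.length_eq.trans hσ)).2 ⟨y, hy, h₂⟩
      exact ⟨σ₂, V, .ifz_zero hM h, hV⟩
    · obtain ⟨σ₂, V, h, hV⟩ := (he₂.obs_iff hB hU hρ (h₁.length_eq.trans hσ)).2 ⟨y, hy, h₂⟩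
      exact ⟨σ₂, V, .ifz_ne hM hn h, hV⟩

theorem Adequate.loop {d : Deriv Γ M .nat} {e : Deriv Γ N .comm} (hd : Adequate δ d)
    (he : Adequate δ e) : Adequate δ (.loop d e) := by
  refine adequate_of_obs_iff (.inl rfl) fun n U θ ρ hU hρ σ hσ b σ' => ?_
  refine obs_comm_iff.trans ?_
  constructor
  · intro h
    -- Induction on the evaluation, whose repeated part evaluates the loop again.
    generalize hP : (Tm.loop M N).subst θ = P at h
    generalize hV : (Tm.skip : Tm Ω) = V at h
    induction h with
    | value hv => subst hP; exact hv.elim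
    | app | op | assign | deref | seq | ifz_zero | ifz_ne | new => cases hP
    | loop_stop h₁ hn =>
      cases hP
      obtain ⟨x, hx, hr⟩ := (hd.obs_iff (.inr (.inl rfl)) hU hρ hσ).1 (obs_nat_iff.2 h₁)
      exact ⟨x, mem_sem_loop.2 ⟨0, _, 1, x, hn, by simp, hx, (one_mul x).symm⟩, hr⟩
    | loop_step h₁ h₂ _ _ _ ih =>
      cases hP
      obtain ⟨x, hx, hr⟩ := (hd.obs_iff (.inr (.inl rfl)) hU hρ hσ).1 (obs_nat_iff.2 h₁)
      have hσ₁ := hr.length_eq.trans hσ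
      obtain ⟨y, hy, hr'⟩ := (he.obs_iff (b := ()) (.inl rfl) hU hρ hσ₁).1 (obs_comm_iff.2 h₂)
      obtain ⟨g, hg, hr''⟩ := ih (hr'.length_eq.trans hσ₁) rfl rfl
      obtain ⟨k, m, z, w, hm, hz, hw, rfl⟩ := mem_sem_loop.1 hg
      refine ⟨x * y * (z * w), mem_sem_loop.2 ⟨k + 1, m, x * y * z, w, hm, ?_, hw,
        (mul_assoc _ _ _).symm⟩, hρ.runCtx_mul_iff.2 ⟨_, hρ.runCtx_mul_iff.2 ⟨_, hr, hr'⟩, hr''⟩⟩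
      rw [pow_succ']
      exact ⟨_, ⟨x, hx, y, hy, rfl⟩, z, hz, rfl⟩
  · rintro ⟨g, hg, hr⟩
    obtain ⟨k, m, z, w, hm, hz, hw, rfl⟩ := mem_sem_loop.1 hg
    obtain ⟨σ₃, h₃, h₄⟩ := hρ.runCtx_mul_iff.1 hr
    clear hg hr
    induction k generalizing σ z with
    | zero =>
      obtain rfl : z = 1 := by simpa using hz
      obtain rfl := hρ.runCtx_one_iff.1 h₃
      have h₁ := obs_nat_iff.1 ((hd.obs_iff (.inr (.inl rfl)) hU hρ hσ).2 ⟨w, hw, h₄⟩)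
      exact Eval.loop_stop h₁ hm
    | succ k ih =>
      rw [pow_succ'] at hz
      obtain ⟨_, ⟨x, hx, y, hy, rfl⟩, z, hz, rfl⟩ := hz
      obtain ⟨σ₂, h₂, h₃⟩ := hρ.runCtx_mul_iff.1 h₃
      obtain ⟨σ₁, h₁, h₂⟩ := hρ.runCtx_mul_iff.1 h₂
      have hσ₁ := h₁.length_eq.trans hσ
      refine .loop_step (obs_nat_iff.1 ((hd.obs_iff (.inr (.inl rfl)) hU hρ hσ).2 ⟨x, hx, h₁⟩))
        (obs_comm_iff.1 ((he.obs_iff (b := ()) (.inl rfl) hU hρ hσ₁).2 ⟨y, hy, h₂⟩)) ?_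
      exact ih σ₂ (h₂.length_eq.trans hσ₁) z hz h₃

/-- A fresh cell behaves as the identifier of type `var` that refers to it. -/
theorem groundRel_cell (n : ℕ) : GroundRel δ .var (n + 1) (Tm.var 0 : Tm Ω)
    (fun e => {Pi.mulSingle n (FreeMonoid.of e)}) := by
  intro m σ hσ b σ'
  have hn : n < σ.length := by omega
  have hi : σ.length - 1 - n = m := by omega
  have hm : m < σ.length := by omega
  simp only [Set.mem_singleton_iff, exists_eq_left, Tm.rename, Nat.zero_add]
  cases b with
  | read k =>
    refine obs_read_iff.trans ((run_mulSingle_read_iff hn).trans ?_).symm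
    rw [hi]
    constructor
    · rintro ⟨h, rfl⟩
      exact ⟨m, .value trivial, h⟩
    · rintro ⟨x, h, hx⟩
      cases h
      exact ⟨hx, rfl⟩
  | write k =>
    refine obs_write_iff.trans ((run_mulSingle_write_iff hn).trans ?_).symm
    rw [hi]
    constructor
    · rintro rfl
      exact ⟨σ, m, .value trivial, hm, rfl⟩
    · rintro ⟨σ₁, x, h, hx, rfl⟩
      cases h
      rfl

theorem lift_mulSingle (n : ℕ) (l : FreeMonoid VarEv) :
    FreeMonoid.lift (fun e => ({Pi.mulSingle n (FreeMonoid.of e)} : Set Traces)) l =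
      {Pi.mulSingle n l} := by
  induction l using FreeMonoid.inductionOn' with
  | one => simpa using Set.singleton_one.symm
  | of_mul e l ih =>
    rw [map_mul, FreeMonoid.lift_eval_of, ih, Set.singleton_mul_singleton, Pi.mulSingle_mul]

/-- Results of ground type are closed, so that they survive the removal of the local cell. -/
theorem obs_new_iff (hB : B = .comm ∨ B = .nat) {b : Ev B} {σ σ' : List ℕ} :
    Obs δ B b σ (.new M) σ' ↔ ∃ k, Obs δ B b (0 :: σ) M (k :: σ') := by
  have key : ∀ V : Tm Ω, (V = .skip ∨ ∃ n, V = .num n) → ∀ σ',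
      Eval δ σ (.new M) σ' V ↔ ∃ k, Eval δ (0 :: σ) M (k :: σ') V := by
    intro V hV σ'
    constructor
    · intro h
      cases h with
      | value h => exact h.elim
      | new h => rcases hV with rfl | ⟨n, rfl⟩ <;> exact ⟨_, h⟩
    · rintro ⟨k, h⟩
      rcases hV with rfl | ⟨n, rfl⟩ <;> exact .new (n := k) h
  rcases hB with rfl | rfl
  · simp only [obs_comm_iff, key _ (.inl rfl)]
  · refine obs_nat_iff.trans ((key _ (.inr ⟨b, rfl⟩) _).trans ?_)
    exact exists_congr fun k => obs_nat_iff.symm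

theorem Adequate.new {hB : B = .comm ∨ B = .nat} {d : Deriv (.var :: Γ) M B}
    (hd : Adequate δ d) : Adequate δ (.new hB d) := by
  have hB' : B = .comm ∨ B = .nat ∨ B = .var := hB.imp_right .inl
  refine adequate_of_obs_iff hB' fun n U θ ρ hU hρ σ hσ b σ' => ?_
  have hdisj : Disjoint U {n} := Set.disjoint_singleton_right.2 fun h => (hU n h).false
  have hE : EnvRel δ (.var :: Γ) (n + 1) (U ∪ {n}) (Tm.liftSub θ)
      (fun g : ctxObj Γ × FreeMonoid VarEv => ρ g.1 * FreeMonoid.lift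
        (fun e => ({Pi.mulSingle n (FreeMonoid.of e)} : Set Traces)) g.2) := by
    refine ⟨U, {n}, ρ, _, Set.subset_union_left, Set.subset_union_right, hdisj, ?_,
      groundRel_cell n, hρ.world_mono 1, fun _ _ => rfl⟩
    rintro a _ rfl i hi
    exact Pi.mulSingle_eq_of_ne hi _
  have hU' : ∀ i ∈ U ∪ {n}, i < n + 1 := by
    rintro i (hi | rfl)
    · exact Nat.lt_succ_of_lt (hU i hi)
    · exact Nat.lt_succ_self _
  have hσ' : (0 :: σ).length = n + 1 := by simp [hσ]
  refine (obs_new_iff hB).trans ?_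
  -- The new cell lies outside `U`, so its trace is `s` and the other cells have the traces of `g`.
  have hrun : ∀ (g : ctxObj Γ) (s : FreeMonoid VarEv) (k : ℕ),
      RunCtx (Γ := .var :: Γ) (fun g : ctxObj Γ × FreeMonoid VarEv => ρ g.1 * FreeMonoid.lift
        (fun e => ({Pi.mulSingle n (FreeMonoid.of e)} : Set Traces)) g.2) (g, s)
        (0 :: σ) (k :: σ') ↔ Trans 0 (FreeMonoid.toList s) k ∧ RunCtx ρ g σ σ' := by
    intro g s k
    have h1 : ∀ t ∈ ρ g, (Run (0 :: σ) (t * Pi.mulSingle n s) (k :: σ') ↔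
        Trans 0 (FreeMonoid.toList s) k ∧ Run σ t σ') := by
      intro t ht
      have h2 : t n = 1 := hρ.supportedOn g t ht n (Set.disjoint_singleton_right.1 hdisj)
      have h3 : ∀ i < σ.length, (t * Pi.mulSingle n s : Traces) i = t i := fun i hi => by
        simp [Pi.mulSingle_eq_of_ne (M := fun _ : ℕ => FreeMonoid VarEv) (by omega : i ≠ n)]
      simp only [Run, hσ]
      rw [run_congr h3]
      simp [h2]
    constructor
    · rintro ⟨_, ⟨t, ht, t', ht', rfl⟩, h⟩
      obtain rfl : t' = Pi.mulSingle n s := (lift_mulSingle n s).subset ht'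
      exact ⟨((h1 t ht).1 h).1, t, ht, ((h1 t ht).1 h).2⟩
    · rintro ⟨hk, t, ht, h⟩
      exact ⟨_, ⟨t, ht, _, (lift_mulSingle n s).symm.subset rfl, rfl⟩, (h1 t ht).2 ⟨hk, h⟩⟩
  constructor
  · rintro ⟨k, h⟩
    obtain ⟨⟨g, s⟩, hg, hr⟩ := (hd.obs_iff hB' hU' hE hσ').1 h
    obtain ⟨hk, hr⟩ := (hrun g s k).1 hr
    exact ⟨g, mem_sem_new.2 ⟨s, ⟨k, hk⟩, hg⟩, hr⟩
  · rintro ⟨g, hg, hr⟩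
    obtain ⟨s, ⟨k, hk⟩, hg⟩ := mem_sem_new.1 hg
    exact ⟨k, (hd.obs_iff hB' hU' hE hσ').2 ⟨(g, s), hg, (hrun g s k).2 ⟨hk, hr⟩⟩⟩

/-- The fundamental lemma of the logical relation. -/
theorem adequate (d : Deriv Γ M A) : Adequate δ d := by
  induction d with
  | var A => exact .var A
  | lam _ ih => exact .lam ih
  | app _ _ ih₁ ih₂ => exact .app ih₁ ih₂
  | weak _ _ ih => exact .weak ih
  | exch _ _ ih => exact .exch ih
  | num n => exact .num n
  | op _ _ _ ih₁ ih₂ => exact .op ih₁ ih₂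
  | skip => exact .skip
  | seq _ _ _ ih₁ ih₂ => exact .seq ih₁ ih₂
  | assign _ _ ih₁ ih₂ => exact .assign ih₁ ih₂
  | deref _ ih => exact .deref ih
  | loop _ _ ih₁ ih₂ => exact .loop ih₁ ih₂
  | ifz _ _ _ _ ih ih₁ ih₂ => exact .ifz ih ih₁ ih₂
  | new _ _ ih => exact .new ih

/-- A closed term of ground type evaluates exactly as its denotation says. -/
theorem obs_closed_iff (hB : B = .comm ∨ B = .nat) (d : Deriv [] M B) (b : Ev B) :
    Obs δ B b [] M [] ↔ 1 ∈ sem δ d b := by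
  have hE : EnvRel δ [] 0 ∅ Tm.var (fun _ => 1) := fun _ => rfl
  have h := (adequate (δ := δ) d).obs_iff (hB.imp_right .inl) (by simp) hE (σ := []) rfl
    (b := b) (σ' := [])
  rw [Tm.subst_var] at h
  refine h.trans ⟨fun ⟨g, hg, _⟩ => hg, fun hg => ⟨1, hg, hE.runCtx_one_iff.2 rfl⟩⟩

end

/-! ### Contextual equivalence in terms of denotations -/

section

variable {Ω : Type} {δ : Ω → ℕ → ℕ → ℕ} {Γ Δ : List Ty} {A B : Ty} {M N : Tm Ω}

/-- A typable value has the type that its form dictates, and an identifier lies in the typing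
context, here of length `n`. -/
def ValueShape : Tm Ω → Ty → ℕ → Prop
  | .num _, A, _ => A = .nat
  | .skip, A, _ => A = .comm
  | .lam _ _, A, _ => ∃ B C, A = .fn B C
  | .var i, _, n => i < n
  | _, _, _ => True

theorem ValueShape.rename {A : Ty} {n n' : ℕ} {ρ : ℕ → ℕ} (hρ : ∀ i < n, ρ i < n') :
    ∀ {M : Tm Ω}, ValueShape M A n → ValueShape (M.rename ρ) A n'
  | .num _, h => h
  | .skip, h => h
  | .lam _ _, h => h
  | .var _, h => hρ _ h
  | .op _ _ _, _ => trivial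
  | .seq _ _, _ => trivial
  | .assign _ _, _ => trivial
  | .deref _, _ => trivial
  | .loop _ _, _ => trivial
  | .ifz _ _ _, _ => trivial
  | .app _ _, _ => trivial
  | .new _, _ => trivial

theorem Perm.ren_lt {Γ Γ' : List Ty} (p : Perm Γ Γ') : ∀ i < Γ.length, p.ren i < Γ'.length := by
  induction p with
  | nil => simp
  | cons A p ih =>
    rintro (_ | i) hi
    · simp [ren, liftRen]
    · simpa [ren, liftRen] using ih i (by simpa using hi)
  | swap A B Γ => rintro (_ | _ | i) hi <;> simp_all [ren]
  | trans p q ihp ihq => exact fun i hi => ihq _ (ihp i hi)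

theorem Deriv.valueShape (d : Deriv Γ M A) : ValueShape M A Γ.length := by
  induction d with
  | var A => exact Nat.zero_lt_one
  | lam _ _ => exact ⟨_, _, rfl⟩
  | weak _ _ ih => exact ih.rename (by simp)
  | exch p _ ih => exact ih.rename p.ren_lt
  | num n => rfl
  | skip => rfl
  | _ => trivial

/-- The closed values of ground type are the numerals and `skip`, so that adequacy expresses
contextual equivalence by means of denotations. -/
theorem ctxEquiv_iff (d : Deriv Γ M A) (e : Deriv Γ N A) :
    CtxEquiv δ Γ A M N ↔ ∀ B : Ty, (B = .comm ∨ B = .nat) → ∀ (C : Ctx Ω Γ A [] B) (b : Ev B),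
      1 ∈ sem δ (C.plugDeriv d) b ↔ 1 ∈ sem δ (C.plugDeriv e) b := by
  constructor
  · intro h B hB C b
    rw [← obs_closed_iff hB, ← obs_closed_iff hB]
    rcases hB with rfl | rfl
    · rw [obs_comm_iff, obs_comm_iff]
      exact h _ (.inl rfl) C _ trivial ⟨.skip⟩
    · exact obs_nat_iff.trans
        ((h _ (.inr rfl) C (.num b) trivial ⟨.num b⟩).trans obs_nat_iff.symm)
  · rintro h B hB C V hV ⟨v⟩
    have hs := v.valueShape
    cases V with
    | num k =>
      obtain rfl : B = .nat := hs
      exact obs_nat_iff.symm.trans ((obs_closed_iff hB (C.plugDeriv d) k).trans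
        ((h _ hB C k).trans ((obs_closed_iff hB (C.plugDeriv e) k).symm.trans obs_nat_iff)))
    | skip =>
      obtain rfl : B = .comm := hs
      exact obs_comm_iff.symm.trans ((obs_closed_iff hB (C.plugDeriv d) ()).trans
        ((h _ hB C ()).trans ((obs_closed_iff hB (C.plugDeriv e) ()).symm.trans obs_comm_iff)))
    | lam _ _ =>
      obtain ⟨_, _, rfl⟩ := hs
      rcases hB with hB | hB <;> cases hB
    | var i => exact absurd hs (Nat.not_lt_zero i)
    | _ => exact hV.elim

/-- The denotation of a filled context depends on the denotation only of the term in the hole. -/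
theorem den_plugDeriv_congr {d : Deriv Γ M A} {e : Deriv Γ N A} (h : den δ d = den δ e)
    (C : Ctx Ω Γ A Δ B) : den δ (C.plugDeriv d) = den δ (C.plugDeriv e) := by
  induction C <;> first | exact h | (simp only [Ctx.plugDeriv, den, *] <;> rfl)

theorem ctxEquiv_of_den_eq {d : Deriv Γ M A} {e : Deriv Γ N A} (h : den δ d = den δ e) :
    CtxEquiv δ Γ A M N :=
  (ctxEquiv_iff d e).2 fun B _ C b => by
    rw [sem, sem, den_plugDeriv_congr h C]

/-- Every term is a context without holes. -/
theorem exists_ctx_of_deriv (Γ₀ : List Ty) (A₀ : Ty) (d : Deriv Γ M A) :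
    ∃ C : Ctx Ω Γ₀ A₀ Γ A, ∀ {N : Tm Ω} (e : Deriv Γ₀ N A₀), den δ (C.plugDeriv e) = den δ d := by
  induction d with
  | var A => exact ⟨.var A, fun _ => rfl⟩
  | lam _ ih =>
    obtain ⟨C, hC⟩ := ih
    exact ⟨.lam C, fun e => congrArg MonRel.curry (hC e)⟩
  | app _ _ ih₁ ih₂ =>
    obtain ⟨C, hC⟩ := ih₁
    obtain ⟨D, hD⟩ := ih₂
    exact ⟨.app C D, fun e => by simp only [Ctx.plugDeriv, den, hC e, hD e]⟩
  | weak A _ ih =>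
    obtain ⟨C, hC⟩ := ih
    exact ⟨.weak A C, fun e => by simp only [Ctx.plugDeriv, den, hC e]⟩
  | exch p _ ih =>
    obtain ⟨C, hC⟩ := ih
    exact ⟨.exch p C, fun e => by simp only [Ctx.plugDeriv, den, hC e]⟩
  | num n => exact ⟨.num n, fun _ => rfl⟩
  | op o _ _ ih₁ ih₂ =>
    obtain ⟨C, hC⟩ := ih₁
    obtain ⟨D, hD⟩ := ih₂
    exact ⟨.op o C D, fun e => by simp only [Ctx.plugDeriv, den, hC e, hD e]⟩
  | skip => exact ⟨.skip, fun _ => rfl⟩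
  | seq hB _ _ ih₁ ih₂ =>
    obtain ⟨C, hC⟩ := ih₁
    obtain ⟨D, hD⟩ := ih₂
    exact ⟨.seq hB C D, fun e => by simp only [Ctx.plugDeriv, den, hC e, hD e]⟩
  | assign _ _ ih₁ ih₂ =>
    obtain ⟨C, hC⟩ := ih₁
    obtain ⟨D, hD⟩ := ih₂
    exact ⟨.assign C D, fun e => by simp only [Ctx.plugDeriv, den, hC e, hD e]⟩
  | deref _ ih =>
    obtain ⟨C, hC⟩ := ih
    exact ⟨.deref C, fun e => by simp only [Ctx.plugDeriv, den, hC e]⟩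
  | loop _ _ ih₁ ih₂ =>
    obtain ⟨C, hC⟩ := ih₁
    obtain ⟨D, hD⟩ := ih₂
    exact ⟨.loop C D, fun e => by simp only [Ctx.plugDeriv, den, hC e, hD e]⟩
  | ifz hB _ _ _ ih ih₁ ih₂ =>
    obtain ⟨C, hC⟩ := ih
    obtain ⟨D₁, hD₁⟩ := ih₁
    obtain ⟨D₂, hD₂⟩ := ih₂
    exact ⟨.ifz hB C D₁ D₂, fun e => by simp only [Ctx.plugDeriv, den, hC e, hD₁ e, hD₂ e]⟩
  | new hB _ ih =>
    obtain ⟨C, hC⟩ := ih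
    exact ⟨.new hB C, fun e => by simp only [Ctx.plugDeriv, den, hC e]⟩

/-- Abstracting all identifiers of a context loses no information about its denotation. -/
theorem exists_closed_ctx (Γ₀ : List Ty) (A₀ : Ty) : ∀ {Δ : List Ty} {B : Ty}
    (C : Ctx Ω Γ₀ A₀ Δ B), ∃ (B' : Ty) (C' : Ctx Ω Γ₀ A₀ [] B'),
      ∀ {M N : Tm Ω} (d : Deriv Γ₀ M A₀) (e : Deriv Γ₀ N A₀),
        den δ (C'.plugDeriv d) = den δ (C'.plugDeriv e) →
          den δ (C.plugDeriv d) = den δ (C.plugDeriv e)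
  | [], B, C => ⟨B, C, fun _ _ h => h⟩
  | A :: Δ, B, C => by
    obtain ⟨B', C', h⟩ := exists_closed_ctx Γ₀ A₀ (.lam C)
    refine ⟨B', C', fun d e hde => ?_⟩
    have h' := den_eq_iff.1 (h d e hde)
    refine den_eq_iff.2 fun b => ?_
    ext ⟨g, l⟩
    have h'' := Set.ext_iff.1 (h' (l, b)) g
    exact mem_sem_lam.symm.trans (h''.trans mem_sem_lam)

/-! ### Coherence -/

/-- Coherence of sequences: at the first difference, if any, the entries are coherent. -/
def SeqCoh {C : Type} (c : C → C → Prop) : List C → List C → Prop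
  | a :: s, a' :: s' => c a a' ∧ (a = a' → SeqCoh c s s')
  | _, _ => True

theorem SeqCoh.of_append {C : Type} {c : C → C → Prop} : ∀ {s s' t t' : List C},
    SeqCoh c (s ++ t) (s' ++ t') → SeqCoh c s s'
  | [], _, _, _, _ => trivial
  | _ :: _, [], _, _, _ => trivial
  | _ :: _, _ :: _, _, _, h => ⟨h.1, fun ha => (h.2 ha).of_append⟩

theorem SeqCoh.of_append_left {C : Type} {c : C → C → Prop} : ∀ {s t t' : List C},
    SeqCoh c (s ++ t) (s ++ t') → SeqCoh c t t'
  | [], _, _, h => h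
  | _ :: _, _, _, h => (h.2 rfl).of_append_left

/-- Coherence of events: the two events may both be performed by a deterministic object. Answers
to a question must agree, whereas the environment may choose what to write, and whether to read
or to write. -/
def Coh : (A : Ty) → Ev A → Ev A → Prop
  | .nat, m, n => (show ℕ from m) = n
  | .comm, _, _ => True
  | .var, .read m, .read n => m = n
  | .var, _, _ => True
  | .fn A B, p, q => SeqCoh (Coh A) (FreeMonoid.toList p.1) (FreeMonoid.toList q.1) →
      Coh B p.2 q.2 ∧ (p.2 = q.2 → p.1 = q.1)

theorem SeqCoh.refl {C : Type} {c : C → C → Prop} (hc : ∀ a, c a a) : ∀ s : List C, SeqCoh c s s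
  | [] => trivial
  | a :: s => ⟨hc a, fun _ => SeqCoh.refl hc s⟩

theorem Coh.refl : ∀ (A : Ty) (a : Ev A), Coh A a a
  | .nat, _ => rfl
  | .comm, _ => trivial
  | .var, .read _ => rfl
  | .var, .write _ => trivial
  | .fn _ B, p => fun _ => ⟨Coh.refl B p.2, fun _ => rfl⟩

/-- Componentwise coherence of the events of the identifiers in a typing context. -/
def CtxCoh : (Γ : List Ty) → ctxObj Γ → ctxObj Γ → Prop
  | [], _, _ => True
  | A :: Γ, g, g' => CtxCoh Γ g.1 g'.1 ∧
      SeqCoh (Coh A) (FreeMonoid.toList g.2) (FreeMonoid.toList g'.2)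

theorem CtxCoh.of_mul : ∀ {Γ : List Ty} {x x' y y' : ctxObj Γ},
    CtxCoh Γ (x * y) (x' * y') → CtxCoh Γ x x'
  | [], _, _, _, _, _ => trivial
  | _ :: _, _, _, _, _, h => ⟨CtxCoh.of_mul h.1, SeqCoh.of_append h.2⟩

theorem CtxCoh.of_mul_left : ∀ {Γ : List Ty} {x y y' : ctxObj Γ},
    CtxCoh Γ (x * y) (x * y') → CtxCoh Γ y y'
  | [], _, _, _, _ => trivial
  | _ :: _, _, _, _, h => ⟨CtxCoh.of_mul_left h.1, SeqCoh.of_append_left h.2⟩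

theorem CtxCoh.of_perm {Γ Γ' : List Ty} (p : Perm Γ Γ') : ∀ {x x' : ctxObj Γ},
    CtxCoh Γ' (p.hom x) (p.hom x') → CtxCoh Γ x x' := by
  induction p with
  | nil => exact fun h => h
  | cons A p ih => exact fun h => ⟨ih h.1, h.2⟩
  | swap A B Γ => exact fun h => ⟨⟨h.1.1, h.2⟩, h.1.2⟩
  | trans p q ihp ihq => exact fun h => ihp (ihq h)

theorem CtxCoh.of_join {Γ : List Ty} : ∀ {Δ : List Ty} {x x' : ctxObj Γ} {y y' : ctxObj Δ},
    CtxCoh (Δ ++ Γ) (joinHom Γ Δ (x, y)) (joinHom Γ Δ (x', y')) → CtxCoh Γ x x' ∧ CtxCoh Δ y y'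
  | [], _, _, _, _, h => ⟨h, trivial⟩
  | _ :: _, _, _, _, _, h => ⟨(CtxCoh.of_join h.1).1, (CtxCoh.of_join h.1).2, h.2⟩

/-- Two traces of a cell that start with the same contents are coherent. -/
theorem Trans.seqCoh {n n₁ : ℕ} {s : List VarEv} (h : Trans n s n₁) : ∀ {n₂ : ℕ}
    {s' : List VarEv}, Trans n s' n₂ → SeqCoh (Coh .var) s s' := by
  induction h with
  | nil => intro _ _ _; trivial
  | read h ih =>
    rintro _ _ (_ | h' | h')
    · trivial
    · exact ⟨rfl, fun _ => ih h'⟩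
    · exact ⟨trivial, fun h => VarEv.noConfusion h⟩
  | write h ih =>
    rintro _ _ (_ | h' | h')
    · trivial
    · exact ⟨trivial, fun h => VarEv.noConfusion h⟩
    · refine ⟨trivial, fun h => ?_⟩
      cases h
      exact ih h'

variable (δ) in
/-- Denotations are cliques: coherent events of the identifiers lead to coherent results, and
are equal if the results are. -/
def Clique (d : Deriv Γ M A) : Prop :=
  ∀ ⦃g g' : ctxObj Γ⦄ ⦃b b' : Ev A⦄, g ∈ sem δ d b → g' ∈ sem δ d b' → CtxCoh Γ g g' →
    Coh A b b' ∧ (b = b' → g = g')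

theorem Clique.semStar {d : Deriv Γ M A} (hd : Clique δ d) : ∀ (l l' : List (Ev A))
    {g g' : ctxObj Γ}, g ∈ semStar δ d (FreeMonoid.ofList l) →
    g' ∈ SCI.semStar δ d (FreeMonoid.ofList l') → CtxCoh Γ g g' →
    SeqCoh (Coh A) l l' ∧ (l = l' → g = g')
  | [], [], g, g', hg, hg', _ => by
    rw [FreeMonoid.ofList_nil, map_one, Set.mem_one] at hg hg'
    exact ⟨trivial, fun _ => hg.trans hg'.symm⟩
  | [], _ :: _, _, _, _, _, _ => ⟨trivial, fun h => List.noConfusion rfl (heq_of_eq h)⟩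
  | _ :: _, [], _, _, _, _, _ => ⟨trivial, fun h => List.noConfusion rfl (heq_of_eq h)⟩
  | a :: l, a' :: l', g, g', hg, hg', h => by
    rw [FreeMonoid.ofList_cons, map_mul] at hg hg'
    obtain ⟨x, hx, y, hy, rfl⟩ := hg
    obtain ⟨x', hx', y', hy', rfl⟩ := hg'
    have h₁ := hd hx hx' h.of_mul
    have h₂ : a = a' → _ := fun ha => by
      obtain rfl := h₁.2 ha
      exact hd.semStar l l' hy hy' h.of_mul_left
    refine ⟨⟨h₁.1, fun ha => (h₂ ha).1⟩, fun hl => ?_⟩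
    obtain ⟨ha, hl⟩ := List.cons.inj hl
    exact congrArg₂ _ (h₁.2 ha) ((h₂ ha).2 hl)

/-- Determinacy of terms: two runs of a term differ only after its environment has answered
differently. -/
theorem clique (d : Deriv Γ M A) : Clique δ d := by
  induction d with
  | var A =>
    rintro _ _ b b' rfl rfl h
    exact ⟨h.2.1, fun hb => by rw [hb]⟩
  | lam _ ih =>
    rintro g g' ⟨s, b⟩ ⟨s', b'⟩ hg hg' h
    have key : SeqCoh _ _ _ → _ := fun hs => ih (mem_sem_lam.1 hg) (mem_sem_lam.1 hg') ⟨h, hs⟩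
    refine ⟨fun hs => ⟨(key hs).1, fun hb => congrArg Prod.snd ((key hs).2 hb)⟩, fun hb => ?_⟩
    obtain ⟨rfl, rfl⟩ := Prod.mk.inj hb
    exact congrArg Prod.fst ((key (SeqCoh.refl (Coh.refl _) _)).2 rfl)
  | app _ _ ih₁ ih₂ =>
    intro g g' b b' hg hg' h
    obtain ⟨l, x, y, hx, hy, rfl⟩ := mem_sem_app.1 hg
    obtain ⟨l', x', y', hx', hy', rfl⟩ := mem_sem_app.1 hg'
    obtain ⟨hΓ, hΔ⟩ := h.of_join
    have h₁ := ih₁ hx hx' hΓ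
    have h₂ := ih₂.semStar _ _ hy hy' hΔ
    have h₃ := h₁.1 h₂.1
    refine ⟨h₃.1, fun hb => ?_⟩
    obtain rfl := hb
    obtain rfl := h₃.2 rfl
    rw [h₁.2 rfl, h₂.2 rfl]
  | weak A _ ih =>
    rintro g g' b b' hg hg' h
    obtain ⟨x, hx, rfl⟩ := mem_sem_weak.1 hg
    obtain ⟨x', hx', rfl⟩ := mem_sem_weak.1 hg'
    have h₁ := ih hx hx' h.1
    exact ⟨h₁.1, fun hb => by rw [h₁.2 hb]⟩
  | exch p _ ih =>
    rintro g g' b b' hg hg' h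
    obtain ⟨x, hx, rfl⟩ := mem_sem_exch.1 hg
    obtain ⟨x', hx', rfl⟩ := mem_sem_exch.1 hg'
    have h₁ := ih hx hx' (CtxCoh.of_perm p h)
    exact ⟨h₁.1, fun hb => by rw [h₁.2 hb]⟩
  | num n =>
    intro g g' b b' hg hg' h
    exact ⟨(mem_sem_num.1 hg).trans (mem_sem_num.1 hg').symm, fun _ => rfl⟩
  | op o _ _ ih₁ ih₂ =>
    intro g g' b b' hg hg' h
    obtain ⟨m, n, x, y, hx, hy, rfl, rfl⟩ := mem_sem_op.1 hg
    obtain ⟨m', n', x', y', hx', hy', rfl, rfl⟩ := mem_sem_op.1 hg'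
    have h₁ := ih₁ hx hx' h.of_mul
    obtain rfl : m = m' := h₁.1
    obtain rfl := h₁.2 rfl
    have h₂ := ih₂ hy hy' h.of_mul_left
    obtain rfl : n = n' := h₂.1
    obtain rfl := h₂.2 rfl
    exact ⟨rfl, fun _ => rfl⟩
  | skip => exact fun _ _ _ _ _ _ _ => ⟨trivial, fun _ => rfl⟩
  | seq hB _ _ ih₁ ih₂ =>
    intro g g' b b' hg hg' h
    obtain ⟨x, y, hx, hy, rfl⟩ := mem_sem_seq.1 hg
    obtain ⟨x', y', hx', hy', rfl⟩ := mem_sem_seq.1 hg'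
    obtain rfl := (ih₁ hx hx' h.of_mul).2 rfl
    have h₂ := ih₂ hy hy' h.of_mul_left
    exact ⟨h₂.1, fun hb => by rw [h₂.2 hb]⟩
  | assign _ _ ih₁ ih₂ =>
    intro g g' b b' hg hg' h
    obtain ⟨n, x, y, hx, hy, rfl⟩ := mem_sem_assign.1 hg
    obtain ⟨n', x', y', hx', hy', rfl⟩ := mem_sem_assign.1 hg'
    have h₁ := ih₂ hx hx' h.of_mul
    obtain rfl : n = n' := h₁.1
    obtain rfl := h₁.2 rfl
    have h₂ := ih₁ hy hy' h.of_mul_left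
    exact ⟨trivial, fun _ => by rw [h₂.2 rfl]⟩
  | deref _ ih =>
    intro g g' b b' hg hg' h
    have h₁ := ih (mem_sem_deref.1 hg) (mem_sem_deref.1 hg') h
    exact ⟨h₁.1, fun hb => h₁.2 (by rw [hb])⟩
  | loop _ _ ih₁ ih₂ =>
    intro g g' b b' hg hg' h
    refine ⟨trivial, fun _ => ?_⟩
    obtain ⟨k, n, x, y, hn, hx, hy, rfl⟩ := mem_sem_loop.1 hg
    obtain ⟨k', n', x', y', hn', hx', hy', rfl⟩ := mem_sem_loop.1 hg'
    clear hg hg'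
    induction k generalizing k' x x' with
    | zero =>
      obtain rfl : x = 1 := by simpa using hx
      cases k' with
      | zero =>
        obtain rfl : x' = 1 := by simpa using hx'
        have h₁ := ih₁ hy hy' h.of_mul_left
        obtain rfl : n = n' := h₁.1
        rw [h₁.2 rfl]
      | succ k' =>
        rw [pow_succ'] at hx'
        obtain ⟨_, ⟨p', hp', q', hq', rfl⟩, z', hz', rfl⟩ := hx'
        simp only [one_mul, mul_assoc] at h
        rw [← mul_one y] at h
        exact absurd (ih₁ hy hp' h.of_mul).1 hn
    | succ k ih =>
      rw [pow_succ'] at hx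
      obtain ⟨_, ⟨p, hp, q, hq, rfl⟩, z, hz, rfl⟩ := hx
      cases k' with
      | zero =>
        obtain rfl : x' = 1 := by simpa using hx'
        simp only [one_mul, mul_assoc] at h
        rw [← mul_one y'] at h
        exact absurd (ih₁ hp hy' h.of_mul).1.symm hn'
      | succ k' =>
        rw [pow_succ'] at hx'
        obtain ⟨_, ⟨p', hp', q', hq', rfl⟩, z', hz', rfl⟩ := hx'
        simp only [mul_assoc] at h ⊢
        obtain rfl := (ih₁ hp hp' h.of_mul).2 rfl
        have h' := h.of_mul_left
        obtain rfl := (ih₂ hq hq' h'.of_mul).2 rfl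
        rw [ih z hz k' z' hz' h'.of_mul_left]
  | ifz hB _ _ _ ih ih₁ ih₂ =>
    intro g g' b b' hg hg' h
    obtain ⟨n, x, y, hx, hy, rfl⟩ := mem_sem_ifz.1 hg
    obtain ⟨n', x', y', hx', hy', rfl⟩ := mem_sem_ifz.1 hg'
    have h₁ := ih hx hx' h.of_mul
    obtain rfl : n = n' := h₁.1
    obtain rfl := h₁.2 rfl
    obtain ⟨hn, hy⟩ | ⟨hn, hy⟩ := hy <;> obtain ⟨hn', hy'⟩ | ⟨hn', hy'⟩ := hy'
    · have h₂ := ih₁ hy hy' h.of_mul_left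
      exact ⟨h₂.1, fun hb => by rw [h₂.2 hb]⟩
    · exact absurd hn hn'
    · exact absurd hn' hn
    · have h₂ := ih₂ hy hy' h.of_mul_left
      exact ⟨h₂.1, fun hb => by rw [h₂.2 hb]⟩
  | new hB _ ih =>
    intro g g' b b' hg hg' h
    obtain ⟨s, ⟨n, hs⟩, hg⟩ := mem_sem_new.1 hg
    obtain ⟨s', ⟨n', hs'⟩, hg'⟩ := mem_sem_new.1 hg'
    have h₁ := ih hg hg' ⟨h, hs.seqCoh hs'⟩
    exact ⟨h₁.1, fun hb => congrArg Prod.fst (h₁.2 hb)⟩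

end

/-! ### The order of approximate observation -/

section

variable {Ω : Type} {δ : Ω → ℕ → ℕ → ℕ} {Γ Δ : List Ty} {A B : Ty} {M N : Tm Ω}

/-- `EvLe A false a a'`: the observer constructed for `a` also accepts `a'`.
`EvLe A true a a'`: the object constructed so as to perform `a` can perform `a'` instead. The
latter happens at type `var`, since writing `n` to a cell that holds `n` already cannot be
distinguished from reading it. The two roles are exchanged in the argument of a function. -/
def EvLe : (A : Ty) → Bool → Ev A → Ev A → Prop
  | .nat, _, m, n => (show ℕ from m) = n
  | .comm, _, _, _ => True
  | .var, p, a, a' => a = a' ∨ p = true ∧ ∃ n, a = .read n ∧ a' = .write n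
  | .fn A B, p, q, q' => List.Forall₂ (EvLe A !p) (FreeMonoid.toList q.1) (FreeMonoid.toList q'.1) ∧
      EvLe B p q.2 q'.2

theorem forall₂_antisymm {C : Type} {r : C → C → Prop} (hr : ∀ a b, r a b → r b a → a = b)
    {s t : List C} (h : List.Forall₂ r s t) : List.Forall₂ r t s → s = t := by
  induction h with
  | nil => exact fun _ => rfl
  | cons hab _ ih =>
    rintro (_ | ⟨hba, h⟩)
    rw [hr _ _ hab hba, ih h]

theorem forall₂_trans {C : Type} {r : C → C → Prop} (hr : ∀ a b c, r a b → r b c → r a c)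
    {s t : List C} (h : List.Forall₂ r s t) : ∀ {u}, List.Forall₂ r t u → List.Forall₂ r s u := by
  induction h with
  | nil => exact fun h => h
  | cons hab _ ih =>
    rintro _ (_ | ⟨hbc, h⟩)
    exact .cons (hr _ _ _ hab hbc) (ih h)

theorem EvLe.refl : ∀ (A : Ty) (p : Bool) (a : Ev A), EvLe A p a a
  | .nat, _, _ => rfl
  | .comm, _, _ => trivial
  | .var, _, _ => .inl rfl
  | .fn A B, p, q => ⟨List.forall₂_same.2 fun a _ => EvLe.refl A _ a, EvLe.refl B p q.2⟩

theorem EvLe.trans : ∀ {A : Ty} {p : Bool} {a b c : Ev A}, EvLe A p a b → EvLe A p b c →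
    EvLe A p a c
  | .nat, _, _, _, _, h, h' => Eq.trans h h'
  | .comm, _, _, _, _, _, _ => True.intro
  | .var, _, _, _, _, h, h' => by
    rcases h with rfl | ⟨hp, n, rfl, rfl⟩
    · exact h'
    · rcases h' with rfl | ⟨_, _, h, _⟩
      · exact .inr ⟨hp, n, rfl, rfl⟩
      · cases h
  | .fn _ _, _, _, _, _, h, h' => ⟨forall₂_trans (fun _ _ _ => EvLe.trans) h.1 h'.1,
      EvLe.trans h.2 h'.2⟩

theorem EvLe.antisymm : ∀ {A : Ty} {p : Bool} {a b : Ev A}, EvLe A p a b → EvLe A p b a → a = b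
  | .nat, _, _, _, h, _ => h
  | .comm, _, _, _, _, _ => rfl
  | .var, _, _, _, h, h' => by
    rcases h with rfl | ⟨_, n, rfl, rfl⟩
    · rfl
    · rcases h' with h | ⟨_, _, h, _⟩ <;> cases h
  | .fn _ _, _, _, _, h, h' =>
    Prod.ext (forall₂_antisymm (fun _ _ => EvLe.antisymm) h.1 h'.1) (EvLe.antisymm h.2 h'.2)

theorem seqCoh_of_forall₂ {C : Type} {r c : C → C → Prop} (hr : ∀ a b, r a b → c a b)
    {s t : List C} (h : List.Forall₂ r s t) : SeqCoh c s t := by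
  induction h with
  | nil => trivial
  | cons hab _ ih => exact ⟨hr _ _ hab, fun _ => ih⟩

theorem eq_of_forall₂_of_seqCoh {C : Type} {r c : C → C → Prop}
    (hr : ∀ a b, r a b → c a b → a = b) {s t : List C} (h : List.Forall₂ r s t) :
    SeqCoh c s t → s = t := by
  induction h with
  | nil => exact fun _ => rfl
  | cons hab _ ih =>
    rintro ⟨h₁, h₂⟩
    obtain rfl := hr _ _ hab h₁
    rw [ih (h₂ rfl)]

/-- An event that the environment substitutes is coherent with the original one, whereas an event
accepted in place of a coherent one is the same event. -/
theorem EvLe.coh : ∀ {A : Ty}, (∀ {a b : Ev A}, EvLe A true a b → Coh A a b) ∧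
    ∀ {a b : Ev A}, EvLe A false a b → Coh A a b → a = b
  | .nat => ⟨fun h => h, fun h _ => h⟩
  | .comm => ⟨fun _ => trivial, fun _ _ => rfl⟩
  | .var => by
    refine ⟨?_, ?_⟩
    · rintro a b (rfl | ⟨_, n, rfl, rfl⟩)
      · exact Coh.refl .var a
      · trivial
    · rintro a b (rfl | ⟨h, _⟩) _
      · rfl
      · cases h
  | .fn A B => by
    have hA := EvLe.coh (A := A)
    have hB := EvLe.coh (A := B)
    refine ⟨fun h hs => ⟨hB.1 h.2, fun _ => ?_⟩, fun h hc => ?_⟩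
    · exact eq_of_forall₂_of_seqCoh (fun _ _ => hA.2) h.1 hs
    · have h₁ := hc (seqCoh_of_forall₂ (fun _ _ => hA.1) h.1)
      have h₂ := hB.2 h.2 h₁.1
      exact Prod.ext (h₁.2 h₂) h₂

/-- Distinct events of a closed term are never related by the order of observation. -/
theorem eq_of_evLe_of_mem_sem {d : Deriv [] M A} {a b : Ev A} (ha : 1 ∈ sem δ d a)
    (hb : 1 ∈ sem δ d b) (h : EvLe A false a b) : a = b :=
  EvLe.coh.2 h (clique d ha hb trivial).1

/-! ### Stateful terms -/

/-- The state of the two cells to which the terms constructed below have access: a counter and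
a cell for data. -/
abbrev State : Type := ℕ × ℕ

/-- The events `t` of the two cells change their state from `σ` to `σ'`. The counter is the
identifier with index `0`. -/
def CellTrans (t : ctxObj [.var, .var]) (σ σ' : State) : Prop :=
  Trans σ.1 (FreeMonoid.toList t.2) σ'.1 ∧ Trans σ.2 (FreeMonoid.toList t.1.2) σ'.2

theorem cellTrans_one_iff {σ σ' : State} : CellTrans 1 σ σ' ↔ σ' = σ := by
  have h : CellTrans 1 σ σ' ↔ Trans σ.1 [] σ'.1 ∧ Trans σ.2 [] σ'.2 := Iff.rfl
  rw [h, trans_nil_iff, trans_nil_iff, Prod.ext_iff]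

theorem cellTrans_mul_iff {t t' : ctxObj [.var, .var]} {σ σ'' : State} :
    CellTrans (t * t') σ σ'' ↔ ∃ σ', CellTrans t σ σ' ∧ CellTrans t' σ' σ'' := by
  constructor
  · rintro ⟨h, h'⟩
    obtain ⟨c, h₁, h₂⟩ := trans_append_iff.1 h
    obtain ⟨x, h₃, h₄⟩ := trans_append_iff.1 h'
    exact ⟨(c, x), ⟨h₁, h₃⟩, h₂, h₄⟩
  · rintro ⟨⟨c, x⟩, ⟨h₁, h₃⟩, h₂, h₄⟩
    exact ⟨trans_append_iff.2 ⟨c, h₁, h₂⟩, trans_append_iff.2 ⟨x, h₃, h₄⟩⟩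

theorem joinHom_surjective : ∀ {Δ : List Ty} (g : ctxObj (Δ ++ Γ)), ∃ x y, joinHom Γ Δ (x, y) = g
  | [], g => ⟨g, 1, rfl⟩
  | _ :: _, (g, l) => by
    obtain ⟨x, y, h⟩ := joinHom_surjective g
    exact ⟨x, (y, l), congrArg (·, l) h⟩

theorem joinHom_injective : ∀ {Δ : List Ty} {x x' : ctxObj Γ} {y y' : ctxObj Δ},
    joinHom Γ Δ (x, y) = joinHom Γ Δ (x', y') → x = x' ∧ y = y'
  | [], _, _, _, _, h => ⟨h, rfl⟩
  | _ :: _, _, _, (_, _), (_, _), h => by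
    obtain ⟨h₁, h₂⟩ := Prod.mk.inj h
    obtain ⟨rfl, rfl⟩ := joinHom_injective h₁
    exact ⟨rfl, congrArg (Prod.mk _) h₂⟩

theorem joinHom_mul (x x' : ctxObj Γ) (y y' : ctxObj Δ) :
    joinHom Γ Δ (x * x', y * y') = joinHom Γ Δ (x, y) * joinHom Γ Δ (x', y') :=
  (joinHom Γ Δ).map_mul (x, y) (x', y')

/-- The state transitions, along with the events `θ` of the identifiers in `Θ`, that the events in
`P` bring about. -/
def StateRel {Θ : List Ty} (P : Set (ctxObj (Θ ++ [.var, .var]))) (θ : ctxObj Θ) (σ σ' : State) :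
    Prop :=
  ∃ t, joinHom [.var, .var] Θ (t, θ) ∈ P ∧ CellTrans t σ σ'

variable {Θ : List Ty}

theorem stateRel_mul_iff {P Q : Set (ctxObj (Θ ++ [.var, .var]))} {θ : ctxObj Θ} {σ σ'' : State} :
    StateRel (P * Q) θ σ σ'' ↔ ∃ θ₁ θ₂ σ', θ = θ₁ * θ₂ ∧ StateRel P θ₁ σ σ' ∧
      StateRel Q θ₂ σ' σ'' := by
  constructor
  · rintro ⟨t, ⟨g₁, hg₁, g₂, hg₂, hg⟩, ht⟩
    obtain ⟨t₁, θ₁, rfl⟩ := joinHom_surjective g₁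
    obtain ⟨t₂, θ₂, rfl⟩ := joinHom_surjective g₂
    obtain ⟨rfl, rfl⟩ := joinHom_injective ((joinHom_mul _ _ _ _).trans hg)
    obtain ⟨σ', h₁, h₂⟩ := cellTrans_mul_iff.1 ht
    exact ⟨θ₁, θ₂, σ', rfl, ⟨t₁, hg₁, h₁⟩, t₂, hg₂, h₂⟩
  · rintro ⟨θ₁, θ₂, σ', rfl, ⟨t₁, hg₁, h₁⟩, t₂, hg₂, h₂⟩
    exact ⟨t₁ * t₂, ⟨_, hg₁, _, hg₂, (joinHom_mul _ _ _ _).symm⟩, cellTrans_mul_iff.2 ⟨σ', h₁, h₂⟩⟩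

theorem stateRel_congr {P Q : Set (ctxObj (Θ ++ [.var, .var]))} (h : ∀ g, g ∈ P ↔ g ∈ Q)
    {θ : ctxObj Θ} {σ σ' : State} : StateRel P θ σ σ' ↔ StateRel Q θ σ σ' := by
  rw [Set.ext h]

variable (δ) in
/-- Some term over the identifiers in `Θ` and the two cells has the behaviour `Q`. -/
def Defines (A : Ty) (Θ : List Ty) (Q : ctxObj Θ → Ev A → State → State → Prop) : Prop :=
  ∃ (M : Tm Ω) (d : Deriv (Θ ++ [.var, .var]) M A), ∀ θ b σ σ',
    StateRel (sem δ d b) θ σ σ' ↔ Q θ b σ σ'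

theorem Defines.congr {Q Q' : ctxObj Θ → Ev A → State → State → Prop} (h : Defines δ A Θ Q)
    (hQ : ∀ θ b σ σ', Q θ b σ σ' ↔ Q' θ b σ σ') : Defines δ A Θ Q' := by
  obtain ⟨M, d, hd⟩ := h
  exact ⟨M, d, fun θ b σ σ' => (hd θ b σ σ').trans (hQ θ b σ σ')⟩

theorem Defines.weak {Q : ctxObj Θ → Ev A → State → State → Prop} (h : Defines δ A Θ Q) (B : Ty) :
    Defines δ A (B :: Θ) fun θ b σ σ' => θ.2 = 1 ∧ Q θ.1 b σ σ' := by
  obtain ⟨M, d, hd⟩ := h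
  refine ⟨_, .weak B d, ?_⟩
  rintro ⟨θ, l⟩ b σ σ'
  refine Iff.trans ?_ (and_congr_right fun _ => hd θ b σ σ')
  constructor
  · rintro ⟨t, ht, hσ⟩
    obtain ⟨x, hx, h⟩ := mem_sem_weak.1 ht
    obtain rfl : joinHom _ _ (t, θ) = x := congrArg Prod.fst h
    exact ⟨congrArg Prod.snd h, t, hx, hσ⟩
  · rintro ⟨h, t, ht, hσ⟩
    refine ⟨t, mem_sem_weak.2 ⟨_, ht, ?_⟩, hσ⟩
    exact congrArg (Prod.mk _) h

/-- Terms that do not use the identifiers in `Θ`. -/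
theorem Defines.weaken {Q : Ev A → State → State → Prop}
    (h : Defines δ A [] fun _ b σ σ' => Q b σ σ') :
    ∀ Θ, Defines δ A Θ fun θ b σ σ' => θ = 1 ∧ Q b σ σ'
  | [] => h.congr fun _ _ _ _ => ⟨fun h => ⟨rfl, h⟩, fun h => h.2⟩
  | B :: Θ => ((h.weaken Θ).weak B).congr fun _ _ _ _ =>
      ⟨fun h => ⟨Prod.ext h.2.1 h.1, h.2.2⟩, fun h => ⟨congrArg Prod.snd h.1,
        congrArg Prod.fst h.1, h.2⟩⟩

theorem Defines.lam {Q : ctxObj (A :: Θ) → Ev B → State → State → Prop}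
    (h : Defines δ B (A :: Θ) Q) :
    Defines δ (.fn A B) Θ fun θ b σ σ' => Q (θ, b.1) b.2 σ σ' := by
  obtain ⟨M, d, hd⟩ := h
  refine ⟨_, .lam d, ?_⟩
  rintro θ ⟨l, b⟩ σ σ'
  refine Iff.trans ?_ (hd (θ, l) b σ σ')
  exact ⟨fun ⟨t, ht, hσ⟩ => ⟨t, mem_sem_lam.1 ht, hσ⟩, fun ⟨t, ht, hσ⟩ => ⟨t, mem_sem_lam.2 ht, hσ⟩⟩

theorem Defines.seq (hB : B = .comm ∨ B = .nat ∨ B = .var)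
    {P : ctxObj Θ → Ev .comm → State → State → Prop}
    {Q : ctxObj Θ → Ev B → State → State → Prop} (h : Defines δ .comm Θ P) (h' : Defines δ B Θ Q) :
    Defines δ B Θ fun θ b σ σ'' => ∃ θ₁ θ₂ σ', θ = θ₁ * θ₂ ∧ P θ₁ () σ σ' ∧ Q θ₂ b σ' σ'' := by
  obtain ⟨M, d, hd⟩ := h
  obtain ⟨N, e, he⟩ := h'
  refine ⟨_, .seq hB d e, fun θ b σ σ'' => ?_⟩
  constructor
  · rintro ⟨t, ht, hσ⟩
    obtain ⟨x, y, hx, hy, h⟩ := mem_sem_seq.1 ht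
    obtain ⟨θ₁, θ₂, σ', hθ, h₁, h₂⟩ := stateRel_mul_iff.1 ⟨t, ⟨x, hx, y, hy, h.symm⟩, hσ⟩
    exact ⟨θ₁, θ₂, σ', hθ, (hd _ _ _ _).1 h₁, (he _ _ _ _).1 h₂⟩
  · rintro ⟨θ₁, θ₂, σ', hθ, h₁, h₂⟩
    obtain ⟨t, ⟨x, hx, y, hy, h⟩, hσ⟩ := stateRel_mul_iff.2
      ⟨θ₁, θ₂, σ', hθ, (hd _ _ _ _).2 h₁, (he _ _ _ _).2 h₂⟩
    exact ⟨t, mem_sem_seq.2 ⟨x, y, hx, hy, h.symm⟩, hσ⟩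

theorem Defines.assign {P : ctxObj Θ → Ev .var → State → State → Prop}
    {Q : ctxObj Θ → Ev .nat → State → State → Prop} (h : Defines δ .var Θ P)
    (h' : Defines δ .nat Θ Q) :
    Defines δ .comm Θ fun θ _ σ σ'' => ∃ (n : ℕ) (θ₁ θ₂ : ctxObj Θ) (σ' : State), θ = θ₁ * θ₂ ∧
      Q θ₁ n σ σ' ∧ P θ₂ (VarEv.write n) σ' σ'' := by
  obtain ⟨M, d, hd⟩ := h
  obtain ⟨N, e, he⟩ := h'
  refine ⟨_, .assign d e, fun θ b σ σ'' => ?_⟩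
  constructor
  · rintro ⟨t, ht, hσ⟩
    obtain ⟨n, x, y, hx, hy, h⟩ := mem_sem_assign.1 ht
    obtain ⟨θ₁, θ₂, σ', hθ, h₁, h₂⟩ := stateRel_mul_iff.1 ⟨t, ⟨x, hx, y, hy, h.symm⟩, hσ⟩
    exact ⟨n, θ₁, θ₂, σ', hθ, (he _ _ _ _).1 h₁, (hd _ _ _ _).1 h₂⟩
  · rintro ⟨n, θ₁, θ₂, σ', hθ, h₁, h₂⟩
    obtain ⟨t, ⟨x, hx, y, hy, h⟩, hσ⟩ := stateRel_mul_iff.2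
      ⟨θ₁, θ₂, σ', hθ, (he _ _ _ _).2 h₁, (hd _ _ _ _).2 h₂⟩
    exact ⟨t, mem_sem_assign.2 ⟨n, x, y, hx, hy, h.symm⟩, hσ⟩

theorem Defines.deref {P : ctxObj Θ → Ev .var → State → State → Prop} (h : Defines δ .var Θ P) :
    Defines δ .nat Θ fun θ n σ σ' => P θ (VarEv.read n) σ σ' := by
  obtain ⟨M, d, hd⟩ := h
  refine ⟨_, .deref d, fun θ b σ σ'' => ?_⟩
  exact (stateRel_congr fun g => mem_sem_deref).trans (hd _ _ _ _)

variable (δ) in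
/-- Some term evaluates `f`, a function of the state, without side effects. -/
def DefinesPure (Θ : List Ty) (f : State → ℕ) : Prop :=
  Defines δ .nat Θ fun θ (n : ℕ) σ σ' => θ = 1 ∧ n = f σ ∧ σ' = σ

theorem DefinesPure.op {f f' : State → ℕ} (o : BinOp Ω) (h : DefinesPure δ Θ f)
    (h' : DefinesPure δ Θ f') : DefinesPure δ Θ fun σ => o.eval δ (f σ) (f' σ) := by
  obtain ⟨M, d, hd⟩ := h
  obtain ⟨N, e, he⟩ := h'
  refine ⟨_, .op o d e, fun θ b σ σ'' => ?_⟩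
  constructor
  · rintro ⟨t, ht, hσ⟩
    obtain ⟨m, n, x, y, hx, hy, h, rfl⟩ := mem_sem_op.1 ht
    obtain ⟨θ₁, θ₂, σ', rfl, h₁, h₂⟩ := stateRel_mul_iff.1 ⟨t, ⟨x, hx, y, hy, h.symm⟩, hσ⟩
    obtain ⟨rfl, rfl, rfl⟩ := (hd _ _ _ _).1 h₁
    obtain ⟨rfl, rfl, rfl⟩ := (he _ _ _ _).1 h₂
    exact ⟨one_mul 1, rfl, rfl⟩
  · rintro ⟨rfl, rfl, rfl⟩
    obtain ⟨t, ⟨x, hx, y, hy, h⟩, hσ⟩ := stateRel_mul_iff.2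
      ⟨1, 1, σ'', (one_mul 1).symm, (hd _ _ _ _).2 ⟨rfl, rfl, rfl⟩,
        (he _ _ _ _).2 ⟨rfl, rfl, rfl⟩⟩
    exact ⟨t, mem_sem_op.2 ⟨_, _, x, y, hx, hy, h.symm, rfl⟩, hσ⟩

theorem Defines.ifz (hB : B = .comm ∨ B = .nat ∨ B = .var) {f : State → ℕ}
    {P Q : ctxObj Θ → Ev B → State → State → Prop} (h : DefinesPure δ Θ f)
    (h₁ : Defines δ B Θ P) (h₂ : Defines δ B Θ Q) :
    Defines δ B Θ fun θ b σ σ' => f σ = 0 ∧ P θ b σ σ' ∨ f σ ≠ 0 ∧ Q θ b σ σ' := by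
  obtain ⟨M, d, hd⟩ := h
  obtain ⟨N₁, e₁, he₁⟩ := h₁
  obtain ⟨N₂, e₂, he₂⟩ := h₂
  refine ⟨_, .ifz hB d e₁ e₂, fun θ b σ σ'' => ?_⟩
  constructor
  · rintro ⟨t, ht, hσ⟩
    obtain ⟨n, x, y, hx, ⟨hn, hy⟩ | ⟨hn, hy⟩, h⟩ := mem_sem_ifz.1 ht <;>
      obtain ⟨θ₁, θ₂, σ', rfl, k₁, k₂⟩ := stateRel_mul_iff.1 ⟨t, ⟨x, hx, y, hy, h.symm⟩, hσ⟩ <;>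
      obtain ⟨rfl, rfl, rfl⟩ := (hd _ _ _ _).1 k₁ <;> rw [one_mul]
    · exact .inl ⟨hn, (he₁ _ _ _ _).1 k₂⟩
    · exact .inr ⟨hn, (he₂ _ _ _ _).1 k₂⟩
  · rintro (⟨hf, h⟩ | ⟨hf, h⟩)
    · obtain ⟨t, ⟨x, hx, y, hy, h⟩, hσ⟩ := stateRel_mul_iff.2
        ⟨1, θ, σ, (one_mul θ).symm, (hd _ _ _ _).2 ⟨rfl, rfl, rfl⟩, (he₁ _ _ _ _).2 h⟩
      exact ⟨t, mem_sem_ifz.2 ⟨_, x, y, hx, .inl ⟨hf, hy⟩, h.symm⟩, hσ⟩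
    · obtain ⟨t, ⟨x, hx, y, hy, h⟩, hσ⟩ := stateRel_mul_iff.2
        ⟨1, θ, σ, (one_mul θ).symm, (hd _ _ _ _).2 ⟨rfl, rfl, rfl⟩, (he₂ _ _ _ _).2 h⟩
      exact ⟨t, mem_sem_ifz.2 ⟨_, x, y, hx, .inr ⟨hf, hy⟩, h.symm⟩, hσ⟩

/-- Closed terms can be used in any typing context. -/
theorem exists_deriv_weaken (d : Deriv [] M A) : ∀ Γ : List Ty, ∃ (M' : Tm Ω) (d' : Deriv Γ M' A),
    ∀ g b, g ∈ sem δ d' b ↔ g = 1 ∧ 1 ∈ sem δ d b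
  | [] => ⟨M, d, fun g b => ⟨fun h => ⟨rfl, h⟩, fun h => h.2⟩⟩
  | B :: Γ => by
    obtain ⟨M', d', hd'⟩ := exists_deriv_weaken d Γ
    refine ⟨_, .weak B d', fun g b => ?_⟩
    constructor
    · rintro ⟨x, hx, rfl⟩
      obtain ⟨rfl, h⟩ := (hd' x b).1 hx
      exact ⟨rfl, h⟩
    · rintro ⟨rfl, h⟩
      exact ⟨1, (hd' 1 b).2 ⟨rfl, h⟩, rfl⟩

theorem Defines.of_closed (d : Deriv [] M A) (Θ : List Ty) :
    Defines δ A Θ fun θ b σ σ' => θ = 1 ∧ 1 ∈ sem δ d b ∧ σ' = σ := by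
  refine Defines.weaken (Q := fun b σ σ' => 1 ∈ sem δ d b ∧ σ' = σ) ?_ Θ
  obtain ⟨M', d', hd'⟩ := exists_deriv_weaken (δ := δ) d [.var, .var]
  refine ⟨M', d', fun θ b σ σ' => ?_⟩
  constructor
  · rintro ⟨t, ht, hσ⟩
    obtain ⟨h, h'⟩ := (hd' _ _).1 ht
    obtain rfl : t = 1 := h
    exact ⟨h', cellTrans_one_iff.1 hσ⟩
  · rintro ⟨h, h'⟩
    exact ⟨1, (hd' _ _).2 ⟨rfl, h⟩, cellTrans_one_iff.2 h'⟩

theorem Defines.skip (Θ : List Ty) : Defines δ .comm Θ fun θ _ σ σ' => θ = 1 ∧ σ' = σ :=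
  (Defines.of_closed (.skip : Deriv [] (.skip : Tm Ω) .comm) Θ).congr fun _ _ _ _ =>
    ⟨fun h => ⟨h.1, h.2.2⟩, fun h => ⟨h.1, mem_sem_skip, h.2⟩⟩

/-- Divergence: the loop goes on as long as its test is `0`. -/
theorem Defines.diverge (Θ : List Ty) : Defines δ .comm Θ fun _ _ _ _ => False := by
  refine (Defines.of_closed (.loop (.num 0) .skip :
    Deriv [] (.loop (.num 0) .skip : Tm Ω) .comm) Θ).congr fun _ _ _ _ => ?_
  refine ⟨fun ⟨_, h, _⟩ => ?_, False.elim⟩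
  obtain ⟨_, n, _, y, hn, _, hy, _⟩ := mem_sem_loop.1 h
  exact hn (mem_sem_num.1 hy)

theorem DefinesPure.num (Θ : List Ty) (k : ℕ) : DefinesPure δ Θ fun _ => k :=
  (Defines.of_closed (.num k : Deriv [] (.num k : Tm Ω) .nat) Θ).congr fun _ _ _ _ =>
    ⟨fun h => ⟨h.1, mem_sem_num.1 h.2.1, h.2.2⟩, fun h => ⟨h.1, mem_sem_num.2 h.2.1, h.2.2⟩⟩

/-- The event `e` changes the contents of a cell from `n` to `n'`. -/
def VarStep (e : VarEv) (n n' : ℕ) : Prop :=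
  e = .read n ∧ n' = n ∨ e = .write n'

theorem trans_singleton_iff {e : VarEv} {n n' : ℕ} : Trans n [e] n' ↔ VarStep e n n' := by
  cases e <;> simp [trans_read_cons_iff, trans_write_cons_iff, trans_nil_iff, VarStep, eq_comm]

theorem varStep_read_iff {k n n' : ℕ} : VarStep (.read k) n n' ↔ k = n ∧ n' = n := by
  simp [VarStep]

theorem Defines.counter (Θ : List Ty) :
    Defines δ .var Θ fun θ e σ σ' => θ = 1 ∧ VarStep e σ.1 σ'.1 ∧ σ'.2 = σ.2 := by
  refine Defines.weaken (Q := fun (e : VarEv) (σ σ' : State) => VarStep e σ.1 σ'.1 ∧ σ'.2 = σ.2)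
    ⟨_, .exch (.swap .var .var []) (.weak .var (.var .var)), fun θ e σ σ' => ?_⟩ Θ
  refine Iff.trans ?_ (and_congr trans_singleton_iff trans_nil_iff)
  constructor
  · rintro ⟨t, ht, hσ⟩
    obtain ⟨x, ⟨y, rfl, rfl⟩, h⟩ := mem_sem_exch.1 ht
    obtain rfl : t = ((1, 1), FreeMonoid.of e) := h
    exact hσ
  · intro hσ
    exact ⟨((1, 1), FreeMonoid.of e), mem_sem_exch.2 ⟨_, ⟨_, rfl, rfl⟩, rfl⟩, hσ⟩

theorem Defines.data (Θ : List Ty) :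
    Defines δ .var Θ fun θ e σ σ' => θ = 1 ∧ VarStep e σ.2 σ'.2 ∧ σ'.1 = σ.1 := by
  refine Defines.weaken (Q := fun (e : VarEv) (σ σ' : State) => VarStep e σ.2 σ'.2 ∧ σ'.1 = σ.1)
    ⟨_, .weak .var (.var .var), fun θ e σ σ' => ?_⟩ Θ
  refine Iff.trans ?_ (and_congr trans_singleton_iff trans_nil_iff)
  constructor
  · rintro ⟨t, ⟨y, rfl, h⟩, hσ⟩
    obtain rfl : t = ((1, FreeMonoid.of e), 1) := h
    exact ⟨hσ.2, hσ.1⟩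
  · intro hσ
    exact ⟨((1, FreeMonoid.of e), 1), ⟨_, rfl, rfl⟩, hσ.2, hσ.1⟩

theorem DefinesPure.counter (Θ : List Ty) : DefinesPure δ Θ fun σ => σ.1 :=
  (Defines.counter Θ).deref.congr fun θ n σ σ' => by
    constructor
    · rintro ⟨hθ, h, h₃⟩
      obtain ⟨h₁, h₂⟩ := varStep_read_iff.1 h
      exact ⟨hθ, h₁, Prod.ext h₂ h₃⟩
    · rintro ⟨hθ, h, rfl⟩
      exact ⟨hθ, varStep_read_iff.2 ⟨h, rfl⟩, rfl⟩

theorem DefinesPure.data (Θ : List Ty) : DefinesPure δ Θ fun σ => σ.2 :=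
  (Defines.data Θ).deref.congr fun θ n σ σ' => by
    constructor
    · rintro ⟨hθ, h, h₃⟩
      obtain ⟨h₁, h₂⟩ := varStep_read_iff.1 h
      exact ⟨hθ, h₁, Prod.ext h₃ h₂⟩
    · rintro ⟨hθ, h, rfl⟩
      exact ⟨hθ, varStep_read_iff.2 ⟨h, rfl⟩, rfl⟩

/-- Equality tests, by means of addition and truncated subtraction. -/
theorem Defines.ifEq (hB : B = .comm ∨ B = .nat ∨ B = .var) {f f' : State → ℕ}
    {P Q : ctxObj Θ → Ev B → State → State → Prop} (h : DefinesPure δ Θ f)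
    (h' : DefinesPure δ Θ f') (h₁ : Defines δ B Θ P) (h₂ : Defines δ B Θ Q) :
    Defines δ B Θ fun θ b σ σ' => f σ = f' σ ∧ P θ b σ σ' ∨ f σ ≠ f' σ ∧ Q θ b σ σ' := by
  refine (Defines.ifz hB (.op .add (.op .sub h h') (.op .sub h' h)) h₁ h₂).congr
    fun θ b σ σ' => ?_
  have : (f σ - f' σ) + (f' σ - f σ) = 0 ↔ f σ = f' σ := by omega
  simp only [BinOp.eval, this, ne_eq]

/-- Conditionals without a second branch. -/
theorem Defines.guard {f f' : State → ℕ} {P : ctxObj Θ → Ev .comm → State → State → Prop}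
    (h : DefinesPure δ Θ f) (h' : DefinesPure δ Θ f') (h₁ : Defines δ .comm Θ P) :
    Defines δ .comm Θ fun θ b σ σ' => f σ = f' σ ∧ P θ b σ σ' :=
  (Defines.ifEq (.inl rfl) h h' h₁ (.diverge Θ)).congr fun _ _ _ _ => by simp

/-- Dispatching on the counter. -/
theorem Defines.dispatch {Q : ℕ → ctxObj Θ → State → State → Prop} : ∀ k : ℕ,
    (∀ i < k, Defines δ .comm Θ fun θ _ σ σ' => Q i θ σ σ') →
    Defines δ .comm Θ fun θ _ σ σ' => σ.1 < k ∧ Q σ.1 θ σ σ'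
  | 0, _ => (Defines.diverge Θ).congr fun _ _ _ _ => by simp
  | k + 1, h => by
    refine (Defines.ifEq (.inl rfl) (.counter Θ) (.num Θ k) (h k (Nat.lt_succ_self k))
      (Defines.dispatch k fun i hi => h i (Nat.lt_succ_of_lt hi))).congr fun θ b σ σ' => ?_
    constructor
    · rintro (⟨hk, h⟩ | ⟨hk, h, h'⟩)
      · exact ⟨by omega, hk ▸ h⟩
      · exact ⟨by omega, h'⟩
    · rintro ⟨hk, h⟩
      by_cases hk' : σ.1 = k
      · exact .inl ⟨hk', hk' ▸ h⟩
      · exact .inr ⟨hk', by omega, h⟩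

theorem Defines.set (Θ : List Ty) (c x : ℕ) :
    Defines δ .comm Θ fun θ _ _ σ' => θ = 1 ∧ σ' = (c, x) := by
  refine (Defines.seq (.inl rfl) (Defines.assign (.counter Θ) (DefinesPure.num Θ c))
    (Defines.assign (.data Θ) (DefinesPure.num Θ x))).congr fun θ _ σ σ' => ?_
  constructor
  · rintro ⟨_, _, σ₁, rfl, ⟨n, _, _, σ₂, rfl, ⟨rfl, rfl, rfl⟩, rfl, h | h, _⟩,
      m, _, _, σ₃, rfl, ⟨rfl, rfl, rfl⟩, rfl, h' | h', h''⟩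
    · cases h.1
    · cases h.1
    · cases h'.1
    · cases h
      cases h'
      exact ⟨by simp, Prod.ext h'' rfl⟩
  · rintro ⟨rfl, rfl⟩
    exact ⟨1, 1, (c, σ.2), (one_mul 1).symm, ⟨c, 1, 1, σ, (one_mul 1).symm, ⟨rfl, rfl, rfl⟩, rfl,
      .inr rfl, rfl⟩, x, 1, 1, _, (one_mul 1).symm, ⟨rfl, rfl, rfl⟩, rfl, .inr rfl, rfl⟩

end

/-! ### Observers -/

section

variable {Ω : Type} {δ : Ω → ℕ → ℕ → ℕ} {Γ Δ Θ : List Ty} {A B : Ty} {M N : Tm Ω}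

variable (δ) in
/-- Some closed term of type `A ⊸ comm` terminates exactly for those sequences `l` of events of its
argument that satisfy `P`. -/
def Accepts (A : Ty) (P : FreeMonoid (Ev A) → Prop) : Prop :=
  ∃ (M : Tm Ω) (d : Deriv [] M (.fn A .comm)), ∀ l, 1 ∈ sem δ d (l, ()) ↔ P l

theorem Accepts.congr {P P' : FreeMonoid (Ev A) → Prop} (h : Accepts δ A P)
    (hP : ∀ l, P l ↔ P' l) : Accepts δ A P' := by
  obtain ⟨M, d, hd⟩ := h
  exact ⟨M, d, fun l => (hd l).trans (hP l)⟩

/-- The two cells can be made local. -/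
theorem Accepts.of_defines {Q : ctxObj [A] → Ev .comm → State → State → Prop}
    (h : Defines δ .comm [A] Q) :
    Accepts δ A fun l => ∃ σ', Q ((1 : ctxObj []), l) () (0, 0) σ' := by
  obtain ⟨M, d, hd⟩ := h
  refine ⟨_, .lam (.new (.inl rfl) (.new (.inl rfl)
    (.exch (.trans (.swap A .var [.var]) (.cons .var (.swap A .var []))) d))), fun l => ?_⟩
  refine Iff.trans ?_ (exists_congr fun σ' => hd _ _ _ _)
  refine mem_sem_lam.trans (mem_sem_new.trans ?_)
  constructor
  · rintro ⟨s, ⟨x', hx⟩, h⟩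
    obtain ⟨s', ⟨c', hc⟩, h⟩ := mem_sem_new.1 h
    obtain ⟨⟨⟨⟨u, x⟩, c⟩, l'⟩, hg, h⟩ := mem_sem_exch.1 h
    obtain ⟨h, rfl⟩ := Prod.mk.inj h
    obtain ⟨h, rfl⟩ := Prod.mk.inj h
    obtain ⟨h, rfl⟩ := Prod.mk.inj h
    exact ⟨(c', x'), ((u, s), s'), hg, hc, hx⟩
  · rintro ⟨⟨c', x'⟩, ⟨⟨u, x⟩, c⟩, hg, hc, hx⟩
    exact ⟨x, ⟨x', hx⟩, mem_sem_new.2 ⟨c, ⟨c', hc⟩, mem_sem_exch.2 ⟨_, hg, rfl⟩⟩⟩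

theorem mem_semStar_var {l : FreeMonoid (Ev A)} : ∀ {g : ctxObj [A]},
    g ∈ semStar δ (.var A : Deriv [A] (.var 0 : Tm Ω) A) l ↔ g = ((1 : ctxObj []), l) := by
  induction l using FreeMonoid.inductionOn' with
  | one =>
    intro g
    rw [map_one]
    exact Iff.rfl
  | of_mul a l ih =>
    intro g
    rw [map_mul, semStar_of]
    constructor
    · rintro ⟨x, hx, y, hy, rfl⟩
      obtain rfl := mem_sem_var.1 hx
      obtain rfl := ih.1 hy
      rfl
    · rintro rfl
      exact ⟨_, mem_sem_var.2 rfl, _, ih.2 rfl, rfl⟩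

/-- A closed function can be applied to an identifier. -/
theorem Defines.app_var (d : Deriv [] M (.fn A B)) (Θ : List Ty) :
    Defines δ B (A :: Θ) fun θ b σ σ' => θ.1 = 1 ∧ 1 ∈ sem δ d (θ.2, b) ∧ σ' = σ := by
  obtain ⟨M', d', hd'⟩ := exists_deriv_weaken (δ := δ) d (Θ ++ [.var, .var])
  refine ⟨_, Deriv.app (Γ := Θ ++ [.var, .var]) (Δ := [A]) d' (.var A), ?_⟩
  rintro ⟨θ, l⟩ b σ σ'
  constructor
  · rintro ⟨t, ht, hσ⟩
    obtain ⟨l', x, y, hx, hy, h⟩ := mem_sem_app.1 ht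
    obtain rfl := mem_semStar_var.1 hy
    obtain ⟨rfl, hx₂⟩ := (hd' _ _).1 hx
    obtain ⟨h₁, h₂⟩ := Prod.mk.inj h
    obtain rfl : l = l' := h₂
    obtain ⟨rfl, rfl⟩ := joinHom_injective (h₁.trans (map_one (joinHom [.var, .var] Θ)).symm)
    exact ⟨rfl, hx₂, cellTrans_one_iff.1 hσ⟩
  · rintro ⟨h, hx, hσ⟩
    obtain rfl : θ = 1 := h
    refine ⟨1, mem_sem_app.2 ⟨l, 1, _, (hd' _ _).2 ⟨rfl, hx⟩, mem_semStar_var.2 rfl, ?_⟩,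
      cellTrans_one_iff.2 hσ⟩
    exact congrArg (·, l) (map_one (joinHom [.var, .var] Θ))

theorem Defines.ident (A : Ty) (Θ : List Ty) :
    Defines δ A (A :: Θ) fun θ b σ σ' => θ.1 = 1 ∧ θ.2 = FreeMonoid.of b ∧ σ' = σ :=
  (Defines.app_var (.lam (.var A) : Deriv [] (.lam A (.var 0) : Tm Ω) _) Θ).congr
    fun θ b σ σ' => by
      refine and_congr_right fun _ => and_congr_left fun _ => ?_
      refine mem_sem_lam.trans (mem_sem_var.trans ?_)
      exact ⟨fun h => congrArg Prod.snd h, fun h => congrArg (Prod.mk _) h⟩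

theorem Defines.of_accepts {P : FreeMonoid (Ev A) → Prop} (h : Accepts δ A P) (Θ : List Ty) :
    Defines δ .comm (A :: Θ) fun θ _ σ σ' => θ.1 = 1 ∧ P θ.2 ∧ σ' = σ := by
  obtain ⟨M, d, hd⟩ := h
  exact (Defines.app_var d Θ).congr fun θ _ σ σ' =>
    and_congr_right fun _ => and_congr_left fun _ => hd θ.2

/-- Observers of single events yield observers of sequences of events. -/
theorem Defines.observe {r : Ev A → Ev A → Prop}
    (h : ∀ a, Accepts δ A fun l => ∃ a', l = FreeMonoid.of a' ∧ r a a') (Θ : List Ty) :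
    ∀ u : List (Ev A), Defines δ .comm (A :: Θ) fun θ _ σ σ' =>
      θ.1 = 1 ∧ List.Forall₂ r u (FreeMonoid.toList θ.2) ∧ σ' = σ
  | [] => (Defines.skip (A :: Θ)).congr fun θ _ σ σ' => by
    rw [List.forall₂_nil_left_iff, ← and_assoc]
    exact and_congr_left fun _ => Prod.ext_iff
  | a :: u => by
    refine ((Defines.of_accepts (h a) Θ).seq (.inl rfl) (Defines.observe h Θ u)).congr
      fun θ _ σ σ' => ?_
    constructor
    · rintro ⟨⟨θ₁, l₁⟩, ⟨θ₂, l₂⟩, σ₁, rfl, ⟨h₁, ⟨a', h₂, haa'⟩, rfl⟩, h₃, h₄, rfl⟩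
      obtain rfl : θ₁ = 1 := h₁
      obtain rfl : θ₂ = 1 := h₃
      obtain rfl : l₁ = FreeMonoid.of a' := h₂
      exact ⟨one_mul 1, .cons haa' h₄, rfl⟩
    · obtain ⟨θ, l⟩ := θ
      rintro ⟨h₁, h₂, rfl⟩
      obtain rfl : θ = 1 := h₁
      obtain ⟨a', l', haa', hl', hl⟩ := List.forall₂_cons_left_iff.1 h₂
      refine ⟨(1, FreeMonoid.of a'), (1, FreeMonoid.ofList l'), σ', ?_,
        ⟨rfl, ⟨a', rfl, haa'⟩, rfl⟩, rfl, hl', rfl⟩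
      exact Prod.ext (one_mul 1).symm hl

/-- An observer of numbers: store the number, then compare. -/
theorem Accepts.of_value {V : FreeMonoid (Ev A) → ℕ → Prop}
    (h : Defines δ .nat [A] fun θ (n : ℕ) σ σ' => θ.1 = 1 ∧ V θ.2 n ∧ σ' = σ) (k : ℕ) :
    Accepts δ A fun l => V l k := by
  refine (Accepts.of_defines (((Defines.data [A]).assign h).seq (.inl rfl)
    (.guard (.data [A]) (.num [A] k) (.skip [A])))).congr fun l => ?_
  constructor
  · rintro ⟨σ', θ₁, θ₂, σ₁, hl, ⟨n, θ₃, θ₄, σ₂, rfl, ⟨_, hV, rfl⟩, rfl, hw, _⟩, hk, rfl, _⟩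
    have hn : σ₁.2 = n := by
      rcases hw with ⟨hw, _⟩ | hw <;> cases hw
      rfl
    obtain rfl : l = θ₃.2 := congrArg Prod.snd (hl.trans ((mul_one (θ₃ * 1)).trans (mul_one θ₃)))
    rwa [← hk, hn]
  · intro hV
    exact ⟨(0, k), (1, l), 1, (0, k), (mul_one (M := ctxObj [A]) (1, l)).symm,
      ⟨k, (1, l), 1, (0, 0), (mul_one (M := ctxObj [A]) (1, l)).symm, ⟨rfl, hV, rfl⟩, rfl,
        .inr rfl, rfl⟩, rfl, rfl, rfl⟩

theorem accepts_nat (k : ℕ) :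
    Accepts δ .nat fun l => ∃ k', l = FreeMonoid.of k' ∧ EvLe .nat false k k' :=
  (Accepts.of_value (V := fun l n => l = FreeMonoid.of (show Ev .nat from n)) 
    (Defines.ident .nat []) k).congr
    fun _ => ⟨fun h => ⟨k, h, rfl⟩, fun ⟨_, h, hk⟩ => hk ▸ h⟩

theorem accepts_comm (b : Ev .comm) :
    Accepts δ .comm fun l => ∃ b', l = FreeMonoid.of b' ∧ EvLe .comm false b b' :=
  (Accepts.of_defines (Defines.ident .comm [])).congr fun _ =>
    ⟨fun ⟨_, _, h, _⟩ => ⟨(), h, trivial⟩, fun ⟨_, h, _⟩ => ⟨_, rfl, h, rfl⟩⟩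

theorem accepts_var (e : VarEv) :
    Accepts δ .var fun l => ∃ e', l = FreeMonoid.of e' ∧ EvLe .var false e e' := by
  have key : ∀ e' : VarEv, EvLe .var false e e' ↔ e = e' := fun e' =>
    ⟨fun h => h.elim id fun h => absurd h.1 Bool.false_ne_true, .inl⟩
  refine Accepts.congr (A := .var) (P := fun l => l = FreeMonoid.of (show Ev .var from e)) ?_
    fun l => ⟨fun h => ⟨e, h, (key e).2 rfl⟩, fun ⟨e', h, he⟩ => by rwa [← (key e').1 he] at h⟩
  cases e with
  | read k =>
    exact Accepts.of_value (V := fun l n => l = FreeMonoid.of (show Ev .var from VarEv.read n))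
      (Defines.ident .var []).deref k
  | write k =>
    refine (Accepts.of_defines
      ((Defines.ident .var []).assign (DefinesPure.num _ k))).congr fun l => ?_
    constructor
    · rintro ⟨σ', n, θ₁, θ₂, σ₁, h, ⟨rfl, rfl, rfl⟩, _, hl, _⟩
      exact (congrArg Prod.snd h).trans ((one_mul (θ₂.2 : FreeMonoid VarEv)).trans hl)
    · rintro rfl
      exact ⟨(0, 0), k, 1, (1, FreeMonoid.of (VarEv.write k)), (0, 0),
        (one_mul (M := ctxObj [.var]) (1, FreeMonoid.of (VarEv.write k))).symm,
        ⟨rfl, rfl, rfl⟩, rfl, rfl, rfl⟩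

/-! ### Producers of sequences of events -/

/-- A term of type `A` that produces the events in `s` one after the other, up to the order of
observation. The counter holds the number of events produced, and `w i` are the data left by the
first `i` events, which are checked before the next event. The term runs a given command with
behaviour `Acc i` on the identifiers in `Θ` before it produces the event with number `i`. -/
def IsProducer (δ : Ω → ℕ → ℕ → ℕ) (A : Ty) (s : List (Ev A)) (w : ℕ → ℕ) : Prop :=
  ∀ (Θ : List Ty) (Acc : ℕ → ctxObj Θ → Prop),
    (Defines δ .comm Θ fun θ _ σ σ' => σ.1 < s.length ∧ Acc σ.1 θ ∧ σ' = σ) →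
    ∃ Q : ctxObj Θ → Ev A → State → State → Prop, Defines δ A Θ Q ∧
      (∀ θ b σ σ', Q θ b σ σ' → σ.2 = w σ.1) ∧
      ∀ θ b σ σ', Q θ b σ σ' ∧ σ'.2 = w σ'.1 ↔ ∃ a, s[σ.1]? = some a ∧ EvLe A true a b ∧
        Acc σ.1 θ ∧ σ.2 = w σ.1 ∧ σ' = (σ.1 + 1, w (σ.1 + 1))

/-- Producers at a ground type. The cell for data is set to `init a` before the result with
behaviour `R` is returned, and holds `left a` if `a` is what then happens. -/
theorem exists_isProducer_ground (hB : B = .comm ∨ B = .nat ∨ B = .var) (init left : Ev B → ℕ)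
    (R : Ev B → State → State → Prop)
    (hR : ∀ Θ, Defines δ B Θ fun θ b σ σ' => θ = 1 ∧ R b σ σ')
    (hR₁ : ∀ b σ σ', R b σ σ' → σ'.1 = σ.1)
    (hR₂ : ∀ a b c, R b (c, init a) (c, left a) ↔ EvLe B true a b) (s : List (Ev B)) :
    ∃ w, w 0 = 0 ∧ IsProducer δ B s w := by
  let w : ℕ → ℕ := fun i => i.casesOn 0 fun j => (s[j]?.map left).getD 0
  have hw : ∀ i a, s[i]? = some a → w (i + 1) = left a := fun i a h => by
    simp [w, h]
  refine ⟨w, rfl, fun Θ Acc hD => ?_⟩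
  have hstep := Defines.dispatch (δ := δ) (Θ := Θ)
    (Q := fun i θ σ σ' => σ.2 = w i ∧ θ = 1 ∧ σ' = (i + 1, (s[i]?.map init).getD 0)) s.length
    fun i _ => .guard (.data Θ) (.num Θ (w i)) (.set Θ _ _)
  refine ⟨_, hD.seq hB (hstep.seq hB (hR Θ)), ?_, ?_⟩
  · rintro θ b σ σ' ⟨_, _, σ₁, _, ⟨_, _, rfl⟩, _, _, _, _, ⟨_, h, _⟩, _⟩
    exact h
  · intro θ b σ σ'
    constructor
    · rintro ⟨⟨_, _, σ₁, rfl, ⟨hlt, hA, rfl⟩, _, _, σ₂, rfl, ⟨_, hx, rfl, rfl⟩, rfl, hr⟩, hσ'⟩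
      have ha := List.getElem?_eq_getElem hlt
      have h₁ : σ'.1 = σ₁.1 + 1 := hR₁ _ _ _ hr
      rw [h₁, hw _ _ ha] at hσ'
      rw [ha] at hr
      obtain ⟨c, x⟩ := σ'
      obtain rfl : c = σ₁.1 + 1 := h₁
      obtain rfl : x = _ := hσ'
      refine ⟨_, ha, (hR₂ _ _ _).1 hr, ?_, hx, by rw [hw _ _ ha]⟩
      rwa [mul_one, mul_one]
    · rintro ⟨a, ha, hab, hA, hx, rfl⟩
      have hlt : σ.1 < s.length := (List.getElem?_eq_some_iff.1 ha).1
      refine ⟨⟨θ, 1, σ, (mul_one θ).symm, ⟨hlt, hA, rfl⟩, 1, 1, _, (one_mul 1).symm,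
        ⟨hlt, hx, rfl, rfl⟩, rfl, ?_⟩, rfl⟩
      rw [hw _ _ ha, ha]
      exact (hR₂ _ _ _).2 hab

theorem exists_isProducer_nat (s : List (Ev .nat)) : ∃ w, w 0 = 0 ∧ IsProducer δ .nat s w :=
  exists_isProducer_ground (.inr (.inl rfl)) (fun n => n) (fun n => n)
    (fun (n : ℕ) σ σ' => n = σ.2 ∧ σ' = σ) (fun Θ => DefinesPure.data Θ)
    (fun _ _ _ h => congrArg Prod.fst h.2)
    (fun _ _ _ => ⟨fun h => h.1.symm, fun h => ⟨h.symm, rfl⟩⟩) s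

theorem exists_isProducer_comm (s : List (Ev .comm)) : ∃ w, w 0 = 0 ∧ IsProducer δ .comm s w :=
  exists_isProducer_ground (.inl rfl) (fun _ => 0) (fun _ => 0)
    (fun _ σ σ' => σ' = σ) (fun Θ => Defines.skip Θ)
    (fun _ _ _ h => congrArg Prod.fst h) (fun _ _ _ => ⟨fun _ => trivial, fun _ => rfl⟩) s

theorem exists_isProducer_var (s : List (Ev .var)) : ∃ w, w 0 = 0 ∧ IsProducer δ .var s w := by
  -- An event `write n` is prepared by storing a number other than `n`, so that a failure to write
  -- is detected.
  refine exists_isProducer_ground (.inr (.inr rfl))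
    (fun e : VarEv => match e with | .read n => n | .write n => n + 1)
    (fun e : VarEv => match e with | .read n => n | .write n => n)
    (fun e σ σ' => VarStep e σ.2 σ'.2 ∧ σ'.1 = σ.1) (fun Θ => Defines.data Θ)
    (fun _ _ _ h => h.2) ?_ s
  rintro (n | n) b c
  · refine ⟨?_, ?_⟩
    · rintro ⟨⟨h, _⟩ | h, _⟩
      · exact .inl h.symm
      · exact .inr ⟨rfl, n, rfl, h⟩
    · rintro (rfl | ⟨_, m, h, rfl⟩)
      · exact ⟨.inl ⟨rfl, rfl⟩, rfl⟩
      · cases h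
        exact ⟨.inr rfl, rfl⟩
  · refine ⟨?_, ?_⟩
    · rintro ⟨⟨_, h⟩ | h, _⟩
      · exact absurd h (Nat.succ_ne_self n).symm
      · exact .inl h.symm
    · rintro (rfl | ⟨_, m, h, rfl⟩)
      · exact ⟨.inr rfl, rfl⟩
      · cases h

/-- A producer at type `A ⊸ B` observes its argument, in the way required by the current event,
before it produces the next event at type `B`. -/
theorem exists_isProducer_fn
    (hA : ∀ a, Accepts δ A fun l => ∃ a', l = FreeMonoid.of a' ∧ EvLe A false a a')
    (hB : ∀ s, ∃ w, w 0 = 0 ∧ IsProducer δ B s w) (s : List (Ev (.fn A B))) :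
    ∃ w, w 0 = 0 ∧ IsProducer δ (.fn A B) s w := by
  obtain ⟨w, hw, h⟩ := hB (s.map fun p => p.2)
  refine ⟨w, hw, fun Θ Acc hD => ?_⟩
  have htest := Defines.dispatch (δ := δ) (Θ := A :: Θ)
    (Q := fun i θ σ σ' => θ.1 = 1 ∧ (∃ p, s[i]? = some p ∧
      List.Forall₂ (EvLe A false) (FreeMonoid.toList p.1) (FreeMonoid.toList θ.2)) ∧ σ' = σ)
    s.length fun i hi => (Defines.observe hA Θ (FreeMonoid.toList s[i].1)).congr fun θ _ σ σ' => by
      rw [List.getElem?_eq_getElem hi]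
      simp
  obtain ⟨Q, hQ, hQ₁, hQ₂⟩ := h (A :: Θ)
    (fun i θ => Acc i θ.1 ∧ ∃ p, s[i]? = some p ∧
      List.Forall₂ (EvLe A false) (FreeMonoid.toList p.1) (FreeMonoid.toList θ.2)) (by
    refine ((hD.weak A).seq (.inl rfl) htest).congr ?_
    rintro ⟨θ, l⟩ _ σ σ'
    constructor
    · rintro ⟨⟨θ₁, l₁⟩, ⟨θ₂, l₂⟩, σ₁, h, ⟨h₁, hlt, hA, rfl⟩, _, h₂, hp, rfl⟩
      obtain rfl : l₁ = 1 := h₁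
      obtain rfl : θ₂ = 1 := h₂
      obtain rfl : θ = θ₁ := (congrArg Prod.fst h).trans (mul_one θ₁)
      obtain rfl : l = l₂ := (congrArg Prod.snd h).trans (one_mul l₂)
      exact ⟨hlt.trans_eq (List.length_map _).symm, ⟨hA, hp⟩, rfl⟩
    · rintro ⟨hlt, ⟨hA, hp⟩, rfl⟩
      have hlt' : σ'.1 < s.length := hlt.trans_eq (List.length_map _)
      exact ⟨(θ, 1), (1, l), σ', Prod.ext (mul_one θ).symm (one_mul l).symm,
        ⟨rfl, hlt', hA, rfl⟩, hlt', rfl, hp, rfl⟩)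
  refine ⟨_, hQ.lam, fun θ b σ σ' h => hQ₁ _ _ _ _ h, fun θ b σ σ' => ?_⟩
  refine (hQ₂ (θ, b.1) b.2 σ σ').trans ?_
  constructor
  · rintro ⟨a, ha, hab, ⟨hA, p, hp, hl⟩, hx, hσ'⟩
    rw [List.getElem?_map, hp] at ha
    obtain rfl : p.2 = a := by simpa using ha
    exact ⟨p, hp, ⟨hl, hab⟩, hA, hx, hσ'⟩
  · rintro ⟨p, hp, ⟨hl, hab⟩, hA, hx, hσ'⟩
    exact ⟨p.2, by rw [List.getElem?_map, hp]; rfl, hab, ⟨hA, p, hp, hl⟩, hx, hσ'⟩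

/-- In a full run, which ends with the expected state, a producer has produced all of its events. -/
theorem producer_run_iff {s : List (Ev A)} {w : ℕ → ℕ} {Q : ctxObj [] → Ev A → State → State → Prop}
    {d : Deriv [.var, .var] M A}
    (hd : ∀ θ b σ σ', StateRel (Θ := []) (sem δ d b) θ σ σ' ↔ Q θ b σ σ')
    (hQ₁ : ∀ θ b σ σ', Q θ b σ σ' → σ.2 = w σ.1)
    (hQ₂ : ∀ θ b σ σ', Q θ b σ σ' ∧ σ'.2 = w σ'.1 ↔ ∃ a, s[σ.1]? = some a ∧ EvLe A true a b ∧
        True ∧ σ.2 = w σ.1 ∧ σ' = (σ.1 + 1, w (σ.1 + 1))) : ∀ (l : List (Ev A)) (i : ℕ),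
    i ≤ s.length → ((∃ t ∈ semStar δ d (FreeMonoid.ofList l),
      CellTrans t (i, w i) (s.length, w s.length)) ↔ List.Forall₂ (EvLe A true) (s.drop i) l)
  | [], i, hi => by
    rw [FreeMonoid.ofList_nil, map_one, List.forall₂_nil_right_iff, List.drop_eq_nil_iff]
    constructor
    · rintro ⟨t, rfl, ht⟩
      exact (congrArg Prod.fst (cellTrans_one_iff.1 ht)).le
    · intro h
      obtain rfl := le_antisymm hi h
      exact ⟨1, rfl, cellTrans_one_iff.2 rfl⟩
  | b :: l, i, hi => by
    rw [FreeMonoid.ofList_cons, map_mul, semStar_of]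
    constructor
    · rintro ⟨_, ⟨x, hx, y, hy, rfl⟩, ht⟩
      obtain ⟨σ', h₁, h₂⟩ := cellTrans_mul_iff.1 ht
      have h₃ := (hd 1 _ _ _).1 ⟨x, hx, h₁⟩
      -- The data left by an event are checked before the next event or at the end of the run.
      have h₄ : σ'.2 = w σ'.1 := by
        cases l with
        | nil =>
          rw [FreeMonoid.ofList_nil, map_one] at hy
          obtain rfl : y = 1 := hy
          rw [← cellTrans_one_iff.1 h₂]
        | cons b' l =>
          rw [FreeMonoid.ofList_cons, map_mul, semStar_of] at hy
          obtain ⟨x', hx', y', _, rfl⟩ := hy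
          obtain ⟨σ'', h₅, _⟩ := cellTrans_mul_iff.1 h₂
          exact hQ₁ _ _ _ _ ((hd 1 _ _ _).1 ⟨x', hx', h₅⟩)
      obtain ⟨a, ha, hab, _, _, rfl⟩ := (hQ₂ _ _ _ _).1 ⟨h₃, h₄⟩
      obtain ⟨hlt, rfl⟩ := List.getElem?_eq_some_iff.1 ha
      rw [List.drop_eq_getElem_cons hlt]
      exact .cons hab ((producer_run_iff hd hQ₁ hQ₂ l (i + 1) hlt).1 ⟨y, hy, h₂⟩)
    · intro h
      have hlt : i < s.length := by
        by_contra hlt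
        rw [List.drop_eq_nil_iff.2 (not_lt.1 hlt)] at h
        cases h
      rw [List.drop_eq_getElem_cons hlt] at h
      obtain ⟨hab, h⟩ := List.forall₂_cons.1 h
      obtain ⟨y, hy, h₂⟩ := (producer_run_iff hd hQ₁ hQ₂ l (i + 1) hlt).2 h
      obtain ⟨x, hx, h₁⟩ := (hd 1 b _ _).2
        ((hQ₂ 1 b (i, w i) (i + 1, w (i + 1))).2
          ⟨_, List.getElem?_eq_getElem hlt, hab, trivial, rfl, rfl⟩).1
      exact ⟨_, ⟨x, hx, y, hy, rfl⟩, cellTrans_mul_iff.2 ⟨_, h₁, h₂⟩⟩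

/-- The observer of `(s, b)` applies its argument to a producer of `s`, observes the result as
required by `b`, and checks that all of `s` has been produced. -/
theorem accepts_fn
    (hA : ∀ s, ∃ w, w 0 = 0 ∧ IsProducer δ A s w)
    (hB : ∀ b, Accepts δ B fun l => ∃ b', l = FreeMonoid.of b' ∧ EvLe B false b b')
    (p : Ev (.fn A B)) :
    Accepts δ (.fn A B) fun l => ∃ p', l = FreeMonoid.of p' ∧ EvLe (.fn A B) false p p' := by
  obtain ⟨s, b⟩ := p
  change FreeMonoid (Ev A) at s
  obtain ⟨w, hw, hP⟩ := hA (FreeMonoid.toList s)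
  obtain ⟨Q, ⟨P, dP, hdP⟩, hQ₁, hQ₂⟩ := hP [] (fun _ _ => True)
    ((Defines.dispatch (Q := fun _ θ σ σ' => θ = 1 ∧ σ' = σ) _ fun _ _ => Defines.skip []).congr
      fun _ _ _ _ => ⟨fun h => ⟨h.1, trivial, h.2.2⟩, fun h => ⟨h.1, rfl, h.2.2⟩⟩)
  obtain ⟨T, dT, hdT⟩ := hB b
  -- The argument, applied to the producer, is handed to the observer of `b`.
  have happ : Defines δ .comm [.fn A B] fun θ _ σ σ' => ∃ (l : FreeMonoid (Ev A)) (b' : Ev B),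
      EvLe B false b b' ∧ θ = ((1 : ctxObj []), FreeMonoid.of (show Ev (.fn A B) from (l, b'))) ∧
      ∃ t ∈ semStar δ (Γ := [.var, .var]) dP l, CellTrans t σ σ' := by
    let e : Deriv [.var, .var, .fn A B] _ B := .app (Δ := [.var, .var]) (.var (.fn A B)) dP
    let f : Deriv [.var, .var, .fn A B] _ .comm := .app (Δ := [.var, .var, .fn A B]) dT e
    refine ⟨_, .exch (Γ := [.var, .var, .fn A B])
      (.trans (.cons .var (.swap .var (.fn A B) [])) (.swap .var (.fn A B) [.var])) f,
      fun θ u σ σ' => ?_⟩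
    constructor
    · rintro ⟨t, ht, hσ⟩
      obtain ⟨x, hx, h⟩ := mem_sem_exch.1 ht
      obtain ⟨L, g, y, hg, hy, rfl⟩ := mem_sem_app.1 hx
      obtain ⟨b', rfl, hb⟩ := (hdT L).1 hg
      obtain ⟨l, x', t', hx', ht', rfl⟩ := mem_sem_app.1
        ((Set.ext_iff.1 (semStar_of δ e b') y).1 hy)
      obtain rfl := mem_sem_var.1 hx'
      obtain ⟨h₁, h₂⟩ := Prod.mk.inj h
      obtain rfl : t = t' := h₁
      exact ⟨l, b', hb, Prod.ext rfl h₂, t, ht', hσ⟩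
    · rintro ⟨l, b', hb, rfl, t, ht, hσ⟩
      refine ⟨t, mem_sem_exch.2 ⟨_, mem_sem_app.2 ⟨FreeMonoid.of b', 1, _, (hdT _).2 ⟨b', rfl, hb⟩,
        (Set.ext_iff.1 (semStar_of δ e b') _).2
          (mem_sem_app.2 ⟨l, _, t, mem_sem_var.2 rfl, ht, rfl⟩), rfl⟩, rfl⟩, hσ⟩
  have hrun := producer_run_iff hdP hQ₁ hQ₂
  refine (Accepts.of_defines (happ.seq (.inl rfl) (.guard (.counter _) (.num _ s.length)
    (.guard (.data _) (.num _ (w s.length)) (.skip _))))).congr fun l => ?_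
  constructor
  · rintro ⟨σ', θ₁, θ₂, σ₁, h, ⟨l', b', hb, rfl, hr⟩, hc, hx, rfl, _⟩
    refine ⟨(l', b'), congrArg Prod.snd (h.trans (mul_one _)), ?_, hb⟩
    refine (hrun (FreeMonoid.toList l') 0 (Nat.zero_le _)).1 ?_
    obtain rfl : σ₁ = (s.length, w s.length) := Prod.ext hc hx
    rw [hw]
    exact hr
  · rintro ⟨⟨l', b'⟩, rfl, hl, hb⟩
    have hr := (hrun (FreeMonoid.toList l') 0 (Nat.zero_le _)).2 hl
    rw [hw] at hr
    exact ⟨_, _, 1, _, (mul_one (M := ctxObj [.fn A B]) _).symm, ⟨l', b', hb, rfl, hr⟩, rfl, rfl,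
      rfl, rfl⟩

/-- Every event has an observer and every sequence of events has a producer. -/
theorem accepts_and_exists_isProducer : ∀ A : Ty,
    (∀ a, Accepts δ A fun l => ∃ a', l = FreeMonoid.of a' ∧ EvLe A false a a') ∧
      ∀ s, ∃ w, w 0 = 0 ∧ IsProducer δ A s w
  | .nat => ⟨accepts_nat, exists_isProducer_nat⟩
  | .comm => ⟨accepts_comm, exists_isProducer_comm⟩
  | .var => ⟨accepts_var, exists_isProducer_var⟩
  | .fn A B =>
    have hA := accepts_and_exists_isProducer A
    have hB := accepts_and_exists_isProducer B
    ⟨accepts_fn hA.2 hB.1, exists_isProducer_fn hA.1 hB.2⟩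

/-! ### Full abstraction -/

/-- The events of a closed term can be observed by contexts, up to the order of observation. -/
theorem exists_evLe_of_ctxEquiv {d : Deriv Γ M A} {e : Deriv Γ N A} (h : CtxEquiv δ Γ A M N)
    (C : Ctx Ω Γ A [] B) {b : Ev B} (hb : 1 ∈ sem δ (C.plugDeriv d) b) :
    ∃ b', EvLe B false b b' ∧ 1 ∈ sem δ (C.plugDeriv e) b' := by
  obtain ⟨T, dT, hdT⟩ := (accepts_and_exists_isProducer (δ := δ) B).1 b
  obtain ⟨D, hD⟩ := exists_ctx_of_deriv (δ := δ) Γ A dT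
  let E : Ctx Ω Γ A [] .comm := .app (Δ := []) D C
  have key : ∀ {M : Tm Ω} (d : Deriv Γ M A), 1 ∈ sem δ (E.plugDeriv d) () ↔
      ∃ b', EvLe B false b b' ∧ 1 ∈ sem δ (C.plugDeriv d) b' := by
    intro M d
    have hT : ∀ l, 1 ∈ sem δ (D.plugDeriv d) (l, ()) ↔
        ∃ b', l = FreeMonoid.of b' ∧ EvLe B false b b' := fun l =>
      (Set.ext_iff.1 (congrArg (MonRel.tuples · (l, ())) (hD d)) 1).trans (hdT l)
    constructor
    · intro h
      obtain ⟨l, x, y, hx, hy, _⟩ := mem_sem_app.1 h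
      obtain ⟨b', rfl, hbb'⟩ := (hT l).1 hx
      exact ⟨b', hbb', hy⟩
    · rintro ⟨b', hbb', hb'⟩
      exact mem_sem_app.2 ⟨FreeMonoid.of b', 1, 1, (hT _).2 ⟨b', rfl, hbb'⟩, hb', rfl⟩
  exact (key e).1 (((ctxEquiv_iff d e).1 h .comm (.inl rfl) E ()).1
    ((key d).2 ⟨b, .refl _ _ _, hb⟩))

theorem den_eq_of_ctxEquiv {d : Deriv Γ M A} {e : Deriv Γ N A} (h : CtxEquiv δ Γ A M N) :
    den δ d = den δ e := by
  obtain ⟨B, C, hC⟩ := exists_closed_ctx (δ := δ) Γ A (.hole : Ctx Ω Γ A Γ A)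
  refine hC d e (den_eq_iff.2 fun b => ?_)
  have h' : CtxEquiv δ Γ A N M := fun B hB C V hV hV' => (h B hB C V hV hV').symm
  -- Observing twice leads from an event of one term to a larger event of the same term, and so by
  -- determinacy back to the event itself.
  have key : ∀ {M N : Tm Ω} {d : Deriv Γ M A} {e : Deriv Γ N A}, CtxEquiv δ Γ A M N →
      CtxEquiv δ Γ A N M → 1 ∈ sem δ (C.plugDeriv d) b → 1 ∈ sem δ (C.plugDeriv e) b := by
    intro M N d e h h' hb
    obtain ⟨b', hbb', hb'⟩ := exists_evLe_of_ctxEquiv (e := e) h C hb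
    obtain ⟨b'', hbb'', hb''⟩ := exists_evLe_of_ctxEquiv (e := d) h' C hb'
    obtain rfl := eq_of_evLe_of_mem_sem hb hb'' (hbb'.trans hbb'')
    rwa [hbb'.antisymm hbb'']
  ext g
  exact ⟨fun hb => key h h' hb, fun hb => key h' h hb⟩

end

end SCI

/-- The object-spaces model of SCI in `MonRel` is fully abstract. -/
theorem mainTheorem1 {Ω : Type} (δ : Ω → ℕ → ℕ → ℕ) {Γ : List SCI.Ty} {A : SCI.Ty}
    {M N : SCI.Tm Ω} (d : SCI.Deriv Γ M A) (e : SCI.Deriv Γ N A) :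
    SCI.den δ d = SCI.den δ e ↔ SCI.CtxEquiv δ Γ A M N :=
  ⟨SCI.ctxEquiv_of_den_eq, SCI.den_eq_of_ctxEquiv⟩
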